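/- Let $\mathbb T=\mathbb R/2\pi\mathbb Z$. For $u\in L^1(\mathbb T)$ real-valued put $\widehat u(k)=\frac1{2\pi}\int_{\mathbb T}u(x)e^{-ikx}\,dx$, and for $s\ge 0$ let $|u|_s=\sum_{k\in\mathbb Z}|k|^s|\widehat u(k)|$ and $\mathcal A_s=\{u\in L^1(\mathbb T): |u|_s<\infty\}$. Here $L^p_TX=L^p(0,T;X)$ is the Bochner space. Let $-1\le\mu\le1$, $0\le\Gamma\le\frac14$, $\epsilon>0$, write $\nu=\epsilon(2\Gamma-2\Gamma^2)$, and consider the extended one-dimensional Derrida–Lebowitz–Speer–Spohn equation of Bordenave, Germain and Trogdon for $u=w-1$, $$u_t-\tfrac{\mu\Gamma}{3}u_{xxx}-\mu\Gamma\big((u+1)(\log(u+1))_{xx}\big)_x=-\nu\big((u+1)(\log(u+1))_{xx}\big)_{xx},\qquad u(0,\cdot)=u_0. \tag{1}$$ A function $u\in L^\infty_TL^\infty\cap L^2_TH^1\cap L^1_TW^{2,1}$ with $1+u>0$ a.e. is a strong solution of (1) on $[0,T]$ if the weak second derivative $(\log(u+1))_{xx}$ exists for a.e. $t$, $(\log(u+1))_{xx}(1+u)\in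 L^1_TL^1$, and for all $\phi\in C_c^\infty([0,T)\times\mathbb T)$ $$-\int_0^T\!\!\int_{\mathbb T}\phi_t u+\frac{\mu\Gamma}{3}\int_0^T\!\!\int_{\mathbb T}u\,\phi_{xxx}-\int_{\mathbb T}\phi(0,x)u_0(x)\,dx+\mu\Gamma\int_0^T\!\!\int_{\mathbb T}(\log(u+1))_{xx}(1+u)\phi_x+\nu\int_0^T\!\!\int_{\mathbb T}(\log(u+1))_{xx}(1+u)\phi_{xx}=0 .$$ Let $$P_1(z)=\frac{4z}{1-z}+\frac{5z^2}{(1-z)^2}+\frac{4z^3}{(1-z)^3},\qquad P_2(z)=\frac{z}{1-z}+\frac{z^2}{(1-z)^2}.$$ **Theorem.** Let $u_0\in\mathcal A_0$ be real-valued with zero mean, $|u_0|_0<1$, and $$|\mu|\Gamma P_2(|u_0|_0)+\nu P_1(|u_0|_0)<\nu .$$ Put $\delta=\nu-|\mu|\Gamma P_2(|u_0|_0)-\nu P_1(|u_0|_0)>0$. Then there is a function $u$ on $[0,\infty)\times\mathbb T$ such that: 1. for every $T>0$, $u$ is a strong solution of (1) on $[0,T]$, and $u\in L^\infty_TL^\infty\cap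 L^p_T\mathcal A_{4/p}$ for all $1<p<\infty$; 2. $\|u(t)\|_{L^\infty}\le|u_0|_0\,e^{-\delta t}$ for all $t\ge0$; 3. for every $\sigma>0$ with $\delta-\sigma>0$ and every $T>0$, $\big(e^{\sigma t|k|}\,\widehat u(t,k)\big)_{k\in\mathbb Z}\in L^\infty(0,T;\ell^1(\mathbb Z))$. -/

import Mathlib

open MeasureTheory Set
open scoped ENNReal ContDiff

noncomputable section

namespace DLSS

/-- The one-dimensional torus `ℝ / 2πℤ`; its `volume` is Lebesgue measure, of total mass `2π`. -/
abbrev Torus : Type := AddCircle (2 * Real.pi)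

instance : Fact (0 < 2 * Real.pi) := ⟨Real.two_pi_pos⟩

/-- `û(k) = (1/2π) ∫ u(x) e^{-ikx} dx` for a real function `u` on the torus. -/
def coeff (u : Torus → ℝ) (k : ℤ) : ℂ := fourierCoeff (fun x => (u x : ℂ)) k

/-- The Wiener space `A_s`. -/
def MemWiener (s : ℝ) (u : Torus → ℝ) : Prop :=
  Integrable u ∧ Summable fun k : ℤ => |(k : ℝ)| ^ s * ‖coeff u k‖

/-- `|u|_s = ∑ₖ |k|^s |û(k)|`. -/
def wienerNorm (s : ℝ) (u : Torus → ℝ) : ℝ := ∑' k : ℤ, |(k : ℝ)| ^ s * ‖coeff u k‖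

/-- The family of sequences `a` belongs to the Bochner space `L^p(0,T; ℓ¹(ℤ))`. -/
def MemLpSeq (p : ℝ≥0∞) (T : ℝ) (a : ℝ → ℤ → ℂ) : Prop :=
  ∃ F : ℝ → lp (fun _ : ℤ => ℂ) 1, MemLp F p (volume.restrict (Ioo 0 T)) ∧
    ∀ᵐ t ∂(volume.restrict (Ioo 0 T)), ∀ k : ℤ, F t k = a t k

/-- `u ∈ L^p(0,T; A_s)`. The space `A_s` is identified with `ℓ¹(ℤ)`-sequences through
`u ↦ (max(1, |k|^s) û(k))ₖ`. On functions of mean zero this is isometric for `|·|_s`, because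
`û(0) = 0` and `|k|^s ≥ 1` for `k ≠ 0`; in general it only adds the mean, so that the seminorm
`|·|_s` becomes a norm. -/
def MemLpWiener (p : ℝ≥0∞) (s T : ℝ) (u : ℝ → Torus → ℝ) : Prop :=
  (∀ᵐ t ∂(volume.restrict (Ioo 0 T)), MemWiener s (u t)) ∧
    MemLpSeq p T fun t k => ((max 1 (|(k : ℝ)| ^ s) : ℝ) : ℂ) * coeff (u t) k

/-- `u` belongs to the Bochner space `L^p(0,T; L^q)`. -/
def MemLpLq (p q : ℝ≥0∞) [Fact (1 ≤ q)] (T : ℝ) (u : ℝ → Torus → ℝ) : Prop :=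
  ∃ F : ℝ → Lp ℝ q (volume : Measure Torus), MemLp F p (volume.restrict (Ioo 0 T)) ∧
    ∀ᵐ t ∂(volume.restrict (Ioo 0 T)), F t =ᵐ[volume] u t

/-- `g` is the `n`-th weak derivative of `f` on the torus. -/
def HasWeakDeriv (n : ℕ) (f g : Torus → ℝ) : Prop :=
  Integrable f ∧ Integrable g ∧
    ∀ φ : ℝ → ℝ, ContDiff ℝ ∞ φ → Function.Periodic φ (2 * Real.pi) →
      ∫ x in (-Real.pi)..Real.pi, f (x : Torus) * iteratedDeriv n φ x =
        (-1) ^ n * ∫ x in (-Real.pi)..Real.pi, g (x : Torus) * φ x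

/-- `u ∈ L^p(0,T; W^{n,q})`, where `W^{n,q}` consists of the `f ∈ L^q` with `∂ₓⁿ f ∈ L^q`. -/
def MemLpSobolev (n : ℕ) (p q : ℝ≥0∞) [Fact (1 ≤ q)] (T : ℝ) (u : ℝ → Torus → ℝ) : Prop :=
  MemLpLq p q T u ∧ ∃ v : ℝ → Torus → ℝ, MemLpLq p q T v ∧
    ∀ᵐ t ∂(volume.restrict (Ioo 0 T)), HasWeakDeriv n (u t) (v t)

/-- Smooth functions `φ(t,x)`, `2π`-periodic in `x`, that vanish for times `t` near and after `T`:
their restrictions to `t ≥ 0` are the elements of `C_c^∞([0,T) × 𝕋)`. -/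
def IsTestFunction (T : ℝ) (φ : ℝ → ℝ → ℝ) : Prop :=
  ContDiff ℝ ∞ (fun z : ℝ × ℝ => φ z.1 z.2) ∧
    (∀ t, Function.Periodic (φ t) (2 * Real.pi)) ∧
    ∃ T' < T, ∀ t ≥ T', ∀ x, φ t x = 0

/-- `u` is a strong solution on `(0,T)`, with initial value `u₀`, of
`u_t - (μΓ/3) u_xxx - μΓ ((u+1)(log(u+1))_xx)_x = -ε(2Γ-2Γ²) ((u+1)(log(u+1))_xx)_xx`.
Here `L = (log(u+1))_xx` in the weak sense. -/
def IsStrongSolution (μ Γ ε T : ℝ) (u₀ : Torus → ℝ) (u : ℝ → Torus → ℝ) : Prop :=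
  MemLpLq ∞ ∞ T u ∧ MemLpSobolev 1 2 2 T u ∧ MemLpSobolev 2 1 1 T u ∧
  (∀ᵐ t ∂(volume.restrict (Ioo 0 T)), ∀ᵐ x : Torus, 0 < u t x + 1) ∧
  ∃ L : ℝ → Torus → ℝ,
    (∀ᵐ t ∂(volume.restrict (Ioo 0 T)), HasWeakDeriv 2 (fun x => Real.log (u t x + 1)) (L t)) ∧
    MemLpLq 1 1 T (fun t x => L t x * (1 + u t x)) ∧
    ∀ φ : ℝ → ℝ → ℝ, IsTestFunction T φ →
      - (∫ t in (0 : ℝ)..T, ∫ x in (-Real.pi)..Real.pi,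
            deriv (fun s => φ s x) t * u t (x : Torus))
        + μ * Γ / 3 * (∫ t in (0 : ℝ)..T, ∫ x in (-Real.pi)..Real.pi,
            u t (x : Torus) * iteratedDeriv 3 (φ t) x)
        - (∫ x in (-Real.pi)..Real.pi, φ 0 x * u₀ (x : Torus))
        + μ * Γ * (∫ t in (0 : ℝ)..T, ∫ x in (-Real.pi)..Real.pi,
            L t (x : Torus) * (1 + u t (x : Torus)) * deriv (φ t) x)
        + ε * (2 * Γ - 2 * Γ ^ 2) * (∫ t in (0 : ℝ)..T, ∫ x in (-Real.pi)..Real.pi,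
            L t (x : Torus) * (1 + u t (x : Torus)) * iteratedDeriv 2 (φ t) x) = 0

def P₁ (z : ℝ) : ℝ :=
  4 * z / (1 - z) + 5 * z ^ 2 / (1 - z) ^ 2 + 4 * z ^ 3 / (1 - z) ^ 3

def P₂ (z : ℝ) : ℝ := z / (1 - z) + z ^ 2 / (1 - z) ^ 2

/-- The decay rate `ε(2Γ-2Γ²) - |μ|Γ P₂(z) - ε(2Γ-2Γ²) P₁(z)`. -/
def rate (μ Γ ε z : ℝ) : ℝ :=
  ε * (2 * Γ - 2 * Γ ^ 2) - |μ| * Γ * P₂ z - ε * (2 * Γ - 2 * Γ ^ 2) * P₁ z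

end DLSS

end

/-!
With `κ = μ Γ` and `ν = ε (2 Γ - 2 Γ²)`, the identity
`(1 + u) (log (1 + u))ₓₓ = uₓₓ - uₓ² / (1 + u)` turns the equation into
`u_t = -ν uₓₓₓₓ + (4/3) κ uₓₓₓ - (κ ∂ₓ - ν ∂ₓ²) (uₓ² / (1 + u))`.
On the Fourier side the linear part damps the mode `k` at the rate `ν |k|⁴`. The third-order term
is dispersive and does not affect `|û(k)|`. Everything rests on absorbing the quadratic term into
this damping, in the space of absolutely summable Fourier coefficients.

Write `m_s = ∑ₖ |k|^s e^{τ|k|} |û(k)|`. Since `e^{τ|k|}` is submultiplicative, these weighted moments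
of a product are estimated by convolution, and `Q = uₓ² / (1 + u)` is the fixed point of
`Q ↦ uₓ² - u Q`. Together with Chebyshev's inequality `m_p m_q ≤ m₀ m_{p+q}` this yields
`m₁(Q) ≤ P₂(m₀) m₄` and `m₂(Q) ≤ P₁(m₀) m₄` as long as `m₀ < 1` (`emom_qcoeff_le`). The constant in
`P₂` requires `m₁(uₓ²) ≤ m₀ m₄`, which holds because `u` is real (`emom_one_sq_le`).

With `τ = δ t` the weight costs `δ m₁ ≤ δ m₄`, and `δ` is exactly what the damping leaves:
`d/dt m₀ ≤ -(ν - |κ| P₂(r) - ν P₁(r)) m₄ + δ m₁ = -δ (m₄ - m₁) ≤ 0` while `m₀ ≤ r = |u₀|₀`.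
Hence `∑ₖ e^{δt|k|} |û(t, k)| ≤ r` for all times, and `m₄` (without exponential weight) is integrable
in time. This is proved for Galerkin truncations whose vector field is composed with a retraction
onto the ball `m₀ ≤ r`, so that existence is the Picard–Lindelöf theorem and the estimate shows that
the retraction plays no role (`galerkin_apriori`, `exists_isGalerkin`). The bounds give
equicontinuity in time of every mode, and a diagonal sequence converges to a solution of the infinite
system (`exists_isFourierSol`).

All claims follow from the two bounds. As the mean vanishes, `e^{δt|k|} ≥ e^{δt}` on every mode
present, which gives the decay of the supremum norm, and the exponential decay in `k` makes the
solution smooth for `t > 0`. The integrability of `m₄`, interpolated with the bound on `m₀`, gives the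
Bochner regularity up to `t = 0`. The weak formulation is, mode by mode, the fundamental theorem of
calculus for `û(t, k) ∫ φ(t, x) e^{ikx} dx`; absolute convergence allows summation over the modes
(`weak_formulation_of_isFourierSol`).
-/

namespace DLSS

/-! ### Weighted moments of sequences of Fourier coefficients -/

/-- The weight `|k|^s e^{τ|k|}`, as an extended nonnegative real. -/
noncomputable def wt (τ : ℝ) (s : ℕ) (k : ℤ) : ℝ≥0∞ :=
  ENNReal.ofReal (|(k : ℝ)| ^ s * Real.exp (τ * |(k : ℝ)|))

/-- The weighted moment `∑ₖ |k|^s e^{τ|k|} |a k|`, allowed to be infinite. -/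
noncomputable def emom (τ : ℝ) (s : ℕ) (a : ℤ → ℂ) : ℝ≥0∞ := ∑' k, wt τ s k * ‖a k‖ₑ

lemma wt_ne_top (τ : ℝ) (s : ℕ) (k : ℤ) : wt τ s k ≠ ⊤ := ENNReal.ofReal_ne_top

lemma wt_mul (τ : ℝ) (s t : ℕ) (i j : ℤ) :
    wt τ s i * wt τ t j = ENNReal.ofReal (|(i : ℝ)| ^ s * |(j : ℝ)| ^ t *
      (Real.exp (τ * |(i : ℝ)|) * Real.exp (τ * |(j : ℝ)|))) := by
  unfold wt
  rw [← ENNReal.ofReal_mul (by positivity)]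
  congr 1
  ring

lemma wt_add_pow (τ : ℝ) (hτ : 0 ≤ τ) (s : ℕ) (i j : ℤ) :
    wt τ s (i + j) ≤
      ENNReal.ofReal ((|(i : ℝ)| + |(j : ℝ)|) ^ s *
        (Real.exp (τ * |(i : ℝ)|) * Real.exp (τ * |(j : ℝ)|))) := by
  unfold wt
  apply ENNReal.ofReal_le_ofReal
  rw [← Real.exp_add, ← mul_add]
  have h : |((i + j : ℤ) : ℝ)| ≤ |(i : ℝ)| + |(j : ℝ)| := by
    push_cast; exact abs_add_le _ _
  gcongr

lemma wt_zero_add (τ : ℝ) (hτ : 0 ≤ τ) (i j : ℤ) :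
    wt τ 0 (i + j) ≤ wt τ 0 i * wt τ 0 j := by
  refine (wt_add_pow τ hτ 0 i j).trans ?_
  unfold wt
  rw [← ENNReal.ofReal_mul (by positivity)]
  apply ENNReal.ofReal_le_ofReal
  apply le_of_eq; ring

lemma wt_one_add (τ : ℝ) (hτ : 0 ≤ τ) (i j : ℤ) :
    wt τ 1 (i + j) ≤ wt τ 1 i * wt τ 0 j + wt τ 0 i * wt τ 1 j := by
  refine (wt_add_pow τ hτ 1 i j).trans ?_
  unfold wt
  rw [← ENNReal.ofReal_mul (by positivity), ← ENNReal.ofReal_mul (by positivity),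
    ← ENNReal.ofReal_add (by positivity) (by positivity)]
  apply ENNReal.ofReal_le_ofReal
  apply le_of_eq; ring

lemma wt_two_add (τ : ℝ) (hτ : 0 ≤ τ) (i j : ℤ) :
    wt τ 2 (i + j) ≤ wt τ 2 i * wt τ 0 j + 2 * (wt τ 1 i * wt τ 1 j) + wt τ 0 i * wt τ 2 j := by
  refine (wt_add_pow τ hτ 2 i j).trans ?_
  have h2 : (2 : ℝ≥0∞) = ENNReal.ofReal 2 := by simp
  unfold wt
  rw [h2, ← ENNReal.ofReal_mul (by positivity), ← ENNReal.ofReal_mul (by positivity),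
    ← ENNReal.ofReal_mul (by positivity), ← ENNReal.ofReal_mul (by positivity),
    ← ENNReal.ofReal_add (by positivity) (by positivity),
    ← ENNReal.ofReal_add (by positivity) (by positivity)]
  apply ENNReal.ofReal_le_ofReal
  apply le_of_eq; ring

/-- `‖c k‖ ≤ ∑ⱼ ‖a j‖ ‖b (k - j)‖`: the coefficients `c` are dominated by a convolution. -/
def ConvBound (a b c : ℤ → ℂ) : Prop := ∀ k, ‖c k‖ₑ ≤ ∑' j, ‖a j‖ₑ * ‖b (k - j)‖ₑ

lemma ConvBound.tsum_le {a b c : ℤ → ℂ} (h : ConvBound a b c) (w : ℤ → ℝ≥0∞) :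
    ∑' k, w k * ‖c k‖ₑ ≤ ∑' i, ∑' j, w (i + j) * (‖a i‖ₑ * ‖b j‖ₑ) := by
  calc ∑' k, w k * ‖c k‖ₑ ≤ ∑' k, ∑' i, w k * (‖a i‖ₑ * ‖b (k - i)‖ₑ) := by
        refine ENNReal.tsum_le_tsum fun k => ?_
        rw [ENNReal.tsum_mul_left]
        gcongr
        exact h k
    _ = ∑' i, ∑' k, w k * (‖a i‖ₑ * ‖b (k - i)‖ₑ) := ENNReal.tsum_comm
    _ = _ := by
        refine tsum_congr fun i => ?_
        rw [← (Equiv.addLeft i).tsum_eq]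
        simp

lemma tsum_tsum_mul (τ : ℝ) (s t : ℕ) (a b : ℤ → ℂ) :
    ∑' i, ∑' j, (wt τ s i * wt τ t j) * (‖a i‖ₑ * ‖b j‖ₑ) = emom τ s a * emom τ t b := by
  unfold emom
  rw [← ENNReal.tsum_mul_right]
  refine tsum_congr fun i => ?_
  rw [← ENNReal.tsum_mul_left]
  refine tsum_congr fun j => ?_
  ring

lemma ConvBound.emom_zero {a b c : ℤ → ℂ} (h : ConvBound a b c) {τ : ℝ} (hτ : 0 ≤ τ) :
    emom τ 0 c ≤ emom τ 0 a * emom τ 0 b := by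
  refine (h.tsum_le _).trans ?_
  rw [← tsum_tsum_mul]
  refine ENNReal.tsum_le_tsum fun i => ENNReal.tsum_le_tsum fun j => ?_
  gcongr
  exact wt_zero_add τ hτ i j

lemma ConvBound.emom_one {a b c : ℤ → ℂ} (h : ConvBound a b c) {τ : ℝ} (hτ : 0 ≤ τ) :
    emom τ 1 c ≤ emom τ 1 a * emom τ 0 b + emom τ 0 a * emom τ 1 b := by
  refine (h.tsum_le _).trans ?_
  simp only [← tsum_tsum_mul, ← ENNReal.tsum_add]
  refine ENNReal.tsum_le_tsum fun i => ENNReal.tsum_le_tsum fun j => ?_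
  rw [← add_mul]
  gcongr
  exact wt_one_add τ hτ i j

lemma ConvBound.emom_two {a b c : ℤ → ℂ} (h : ConvBound a b c) {τ : ℝ} (hτ : 0 ≤ τ) :
    emom τ 2 c ≤ emom τ 2 a * emom τ 0 b + 2 * (emom τ 1 a * emom τ 1 b)
      + emom τ 0 a * emom τ 2 b := by
  refine (h.tsum_le _).trans ?_
  simp only [← tsum_tsum_mul, ← ENNReal.tsum_add, ← ENNReal.tsum_mul_left]
  refine ENNReal.tsum_le_tsum fun i => ENNReal.tsum_le_tsum fun j => ?_
  rw [← mul_assoc 2, ← add_mul, ← add_mul]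
  gcongr
  exact wt_two_add τ hτ i j

lemma emom_add_le (τ : ℝ) (s : ℕ) {a b c : ℤ → ℂ} (h : ∀ k, ‖c k‖ₑ ≤ ‖a k‖ₑ + ‖b k‖ₑ) :
    emom τ s c ≤ emom τ s a + emom τ s b := by
  unfold emom
  rw [← ENNReal.tsum_add]
  refine ENNReal.tsum_le_tsum fun k => ?_
  rw [← mul_add]
  gcongr
  exact h k

/-- Chebyshev's inequality for the moments: `m_p m_q ≤ m_0 m_{p+q}`. -/
lemma emom_mul_le (τ : ℝ) (p q : ℕ) (a : ℤ → ℂ) :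
    emom τ p a * emom τ q a ≤ emom τ 0 a * emom τ (p + q) a := by
  have key : emom τ p a * emom τ q a + emom τ q a * emom τ p a ≤
      emom τ 0 a * emom τ (p + q) a + emom τ (p + q) a * emom τ 0 a := by
    simp only [← tsum_tsum_mul, ← ENNReal.tsum_add]
    refine ENNReal.tsum_le_tsum fun i => ENNReal.tsum_le_tsum fun j => ?_
    rw [← add_mul, ← add_mul]
    gcongr ?_ * _
    simp only [wt_mul]
    rw [← ENNReal.ofReal_add (by positivity) (by positivity),
      ← ENNReal.ofReal_add (by positivity) (by positivity)]
    apply ENNReal.ofReal_le_ofReal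
    set x := |(i : ℝ)|
    set y := |(j : ℝ)|
    have hx : 0 ≤ x := abs_nonneg _
    have hy : 0 ≤ y := abs_nonneg _
    have h : 0 ≤ (x ^ p - y ^ p) * (x ^ q - y ^ q) := by
      rcases le_total x y with hxy | hxy
      · exact mul_nonneg_of_nonpos_of_nonpos
          (sub_nonpos.2 (pow_le_pow_left₀ hx hxy p)) (sub_nonpos.2 (pow_le_pow_left₀ hx hxy q))
      · exact mul_nonneg
          (sub_nonneg.2 (pow_le_pow_left₀ hy hxy p)) (sub_nonneg.2 (pow_le_pow_left₀ hy hxy q))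
    have h2 : 0 ≤ ((x ^ p - y ^ p) * (x ^ q - y ^ q)) *
      (Real.exp (τ * x) * Real.exp (τ * y)) := by positivity
    rw [pow_add, pow_add, pow_zero, pow_zero]
    nlinarith [h2]
  rw [mul_comm (emom τ q a), mul_comm (emom τ (p + q) a), ← two_mul, ← two_mul] at key
  exact (ENNReal.mul_le_mul_iff_right (by simp) (by simp)).1 key

/-- Multiplication of coefficients by `ik`: the Fourier side of `∂ₓ`. -/
def D (a : ℤ → ℂ) (k : ℤ) : ℂ := Complex.I * k * a k

lemma enorm_D (a : ℤ → ℂ) (k : ℤ) : ‖D a k‖ₑ = ENNReal.ofReal |(k : ℝ)| * ‖a k‖ₑ := by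
  unfold D
  rw [enorm_mul, enorm_mul]
  congr 1
  rw [← ofReal_norm, ← ofReal_norm]
  simp

lemma norm_D (a : ℤ → ℂ) (k : ℤ) : ‖D a k‖ = |(k : ℝ)| * ‖a k‖ := by
  simp [D]

lemma emom_D (τ : ℝ) (s : ℕ) (a : ℤ → ℂ) : emom τ s (D a) = emom τ (s + 1) a := by
  unfold emom wt
  refine tsum_congr fun k => ?_
  rw [enorm_D, ← mul_assoc, ← ENNReal.ofReal_mul (by positivity)]
  congr 2
  ring

lemma emom_le_of_le (τ : ℝ) {s t : ℕ} (hs : 0 < s) (hst : s ≤ t) (a : ℤ → ℂ) :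
    emom τ s a ≤ emom τ t a := by
  unfold emom wt
  refine ENNReal.tsum_le_tsum fun k => ?_
  gcongr ENNReal.ofReal (?_ * _) * _
  rcases eq_or_ne k 0 with rfl | hk
  · simp [hs.ne', (hs.trans_le hst).ne']
  · have : (1 : ℝ) ≤ |(k : ℝ)| := by exact_mod_cast Int.one_le_abs hk
    exact pow_le_pow_right₀ this hst

/-- For coefficients of a real function, the first moment of the square of the derivative only
costs `m₀ m₄` (the crude bound is `2 m₁ m₂`): averaging over the sign of one frequency replaces
`|i| + |j|` by `max |i| |j|`. -/
lemma emom_one_sq_le {τ : ℝ} (hτ : 0 ≤ τ) {a c : ℤ → ℂ} (ha : ∀ k, ‖a (-k)‖ₑ = ‖a k‖ₑ)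
    (h : ConvBound (D a) (D a) c) : emom τ 1 c ≤ emom τ 0 a * emom τ 4 a := by
  have hw : ∀ i j : ℤ, wt τ 1 (i + j) * (‖D a i‖ₑ * ‖D a j‖ₑ) ≤
      ENNReal.ofReal (|(i + j : ℝ)| * |(i : ℝ)| * |(j : ℝ)| *
        (Real.exp (τ * |(i : ℝ)|) * Real.exp (τ * |(j : ℝ)|))) * (‖a i‖ₑ * ‖a j‖ₑ) := by
    intro i j
    rw [enorm_D, enorm_D]
    have : wt τ 1 (i + j) ≤ ENNReal.ofReal (|(i + j : ℝ)| *
        (Real.exp (τ * |(i : ℝ)|) * Real.exp (τ * |(j : ℝ)|))) := by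
      unfold wt
      apply ENNReal.ofReal_le_ofReal
      rw [← Real.exp_add, ← mul_add, pow_one]
      push_cast
      have := abs_add_le (i : ℝ) j
      gcongr
    calc _ ≤ ENNReal.ofReal (|(i + j : ℝ)| *
        (Real.exp (τ * |(i : ℝ)|) * Real.exp (τ * |(j : ℝ)|))) *
          (ENNReal.ofReal |(i : ℝ)| * ‖a i‖ₑ * (ENNReal.ofReal |(j : ℝ)| * ‖a j‖ₑ)) := by gcongr
      _ = ENNReal.ofReal (|(i + j : ℝ)| *
        (Real.exp (τ * |(i : ℝ)|) * Real.exp (τ * |(j : ℝ)|))) *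
          (ENNReal.ofReal |(i : ℝ)| * ENNReal.ofReal |(j : ℝ)|) * (‖a i‖ₑ * ‖a j‖ₑ) := by ring
      _ = _ := by
        rw [← ENNReal.ofReal_mul (by positivity), ← ENNReal.ofReal_mul (by positivity)]
        congr 2
        ring
  set B : ℤ → ℤ → ℝ≥0∞ := fun i j => ENNReal.ofReal (|(i + j : ℝ)| * |(i : ℝ)| * |(j : ℝ)| *
        (Real.exp (τ * |(i : ℝ)|) * Real.exp (τ * |(j : ℝ)|))) * (‖a i‖ₑ * ‖a j‖ₑ) with hB
  have h1 : emom τ 1 c ≤ ∑' i, ∑' j, B i j :=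
    (h.tsum_le _).trans (ENNReal.tsum_le_tsum fun i => ENNReal.tsum_le_tsum fun j => hw i j)
  have h2 : ∑' i, ∑' j, B i j = ∑' i, ∑' j, B i (-j) :=
    tsum_congr fun i => ((Equiv.neg ℤ).tsum_eq (B i)).symm
  have h3 : ∑' i, ∑' j, B i j + ∑' i, ∑' j, B i (-j) ≤
      emom τ 0 a * emom τ 4 a + emom τ 4 a * emom τ 0 a := by
    simp only [← tsum_tsum_mul, ← ENNReal.tsum_add]
    refine ENNReal.tsum_le_tsum fun i => ENNReal.tsum_le_tsum fun j => ?_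
    simp only [hB, ha]
    rw [← add_mul, ← add_mul]
    gcongr ?_ * _
    simp only [wt_mul]
    rw [← ENNReal.ofReal_add (by positivity) (by positivity),
      ← ENNReal.ofReal_add (by positivity) (by positivity)]
    apply ENNReal.ofReal_le_ofReal
    push_cast
    rw [abs_neg]
    set E := Real.exp (τ * |(i : ℝ)|)
    set F := Real.exp (τ * |(j : ℝ)|)
    have hEF : 0 ≤ E * F := by positivity
    have hij : (|(i : ℝ) + j| + |(i : ℝ) + -j|) * (|(i : ℝ)| * |(j : ℝ)|) ≤
        |(j : ℝ)| ^ 4 + |(i : ℝ)| ^ 4 := by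
      rcases eq_or_ne i 0 with rfl | hi
      · simp
      rcases eq_or_ne j 0 with rfl | hj
      · simp
      have hi1 : (1 : ℝ) ≤ |(i : ℝ)| := by exact_mod_cast Int.one_le_abs hi
      have hj1 : (1 : ℝ) ≤ |(j : ℝ)| := by exact_mod_cast Int.one_le_abs hj
      have hsum : |(i : ℝ) + j| + |(i : ℝ) + -j| = 2 * max |(i : ℝ)| |(j : ℝ)| := by
        rcases abs_cases ((i : ℝ) + j) with ⟨h1, _⟩ | ⟨h1, _⟩ <;>
        rcases abs_cases ((i : ℝ) + -j) with ⟨h2, _⟩ | ⟨h2, _⟩ <;>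
        rcases abs_cases (i : ℝ) with ⟨h3, _⟩ | ⟨h3, _⟩ <;>
        rcases abs_cases (j : ℝ) with ⟨h4, _⟩ | ⟨h4, _⟩ <;>
        rcases max_cases |(i : ℝ)| |(j : ℝ)| with ⟨h5, _⟩ | ⟨h5, _⟩ <;>
        rw [h1, h2, h5] <;> linarith
      rw [hsum]
      -- `x ≥ y ≥ 1` integers: either `x = y`, or `x ≥ 2` and `y ≤ x²/2`.
      have aux : ∀ x y : ℤ, 1 ≤ y → y ≤ x → 2 * x * (x * y) ≤ y ^ 4 + x ^ 4 := by
        intro x y hy hxy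
        rcases eq_or_lt_of_le hxy with rfl | hlt
        · nlinarith [pow_le_pow_right₀ hy (show 3 ≤ 4 by norm_num)]
        · have h2 : 2 * y ≤ x ^ 2 := by nlinarith
          nlinarith [mul_le_mul_of_nonneg_left h2 (sq_nonneg x), sq_nonneg (y ^ 2)]
      have hcast : ∀ m : ℤ, |(m : ℝ)| = ((|m| : ℤ) : ℝ) := fun m => by simp
      rcases le_total |(i : ℝ)| |(j : ℝ)| with hle | hle
      · rw [max_eq_right hle]
        have := aux |j| |i| (Int.one_le_abs hi) (by rw [hcast, hcast] at hle; exact_mod_cast hle)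
        rw [hcast, hcast]
        have h' : ((2 * |j| * (|j| * |i|) : ℤ) : ℝ) ≤ ((|i| ^ 4 + |j| ^ 4 : ℤ) : ℝ) := by
          exact_mod_cast this
        push_cast at h' ⊢
        linarith
      · rw [max_eq_left hle]
        have := aux |i| |j| (Int.one_le_abs hj) (by rw [hcast, hcast] at hle; exact_mod_cast hle)
        rw [hcast, hcast]
        have h' : ((2 * |i| * (|i| * |j|) : ℤ) : ℝ) ≤ ((|j| ^ 4 + |i| ^ 4 : ℤ) : ℝ) := by
          exact_mod_cast this
        push_cast at h' ⊢
        linarith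
    nlinarith [mul_le_mul_of_nonneg_right hij hEF]
  rw [← h2, mul_comm (emom τ 4 a), ← two_mul, ← two_mul] at h3
  exact h1.trans ((ENNReal.mul_le_mul_iff_right (by simp) (by simp)).1 h3)

/-! ### Absolutely convergent Fourier series -/

/-- The function `x ↦ ∑ₖ a k e^{ikx}`. -/
noncomputable def synth (a : ℤ → ℂ) (x : Torus) : ℂ := ∑' k, a k * fourier k x

lemma norm_fourier_apply (k : ℤ) (x : Torus) : ‖(fourier k x : ℂ)‖ = 1 := by
  rw [fourier_apply]; exact Circle.norm_coe _

lemma summable_synth {a : ℤ → ℂ} (ha : Summable fun k => ‖a k‖) (x : Torus) :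
    Summable fun k => a k * fourier k x := by
  apply Summable.of_norm
  simpa [norm_fourier_apply, -fourier_apply] using ha

lemma norm_synth_le {a : ℤ → ℂ} (ha : Summable fun k => ‖a k‖) (x : Torus) :
    ‖synth a x‖ ≤ ∑' k, ‖a k‖ := by
  refine (norm_tsum_le_tsum_norm ?_).trans (le_of_eq ?_)
  · simpa [norm_fourier_apply, -fourier_apply] using ha
  · simp [norm_fourier_apply, -fourier_apply]

lemma continuous_synth {a : ℤ → ℂ} (ha : Summable fun k => ‖a k‖) : Continuous (synth a) := by
  refine continuous_tsum (fun k => by fun_prop) ha fun k x => ?_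
  simp [norm_fourier_apply, -fourier_apply]

lemma synth_sub {a b : ℤ → ℂ} (ha : Summable fun k => ‖a k‖) (hb : Summable fun k => ‖b k‖)
    (x : Torus) : synth a x - synth b x = synth (fun k => a k - b k) x := by
  unfold synth
  rw [← (summable_synth ha x).tsum_sub (summable_synth hb x)]
  simp [sub_mul]

lemma integrable_of_continuous {g : Torus → ℂ} (hg : Continuous g) :
    Integrable g AddCircle.haarAddCircle :=
  hg.integrable_of_hasCompactSupport (HasCompactSupport.of_compactSpace g)

lemma exists_norm_le {g : Torus → ℂ} (hg : Continuous g) : ∃ C, ∀ x, ‖g x‖ ≤ C := by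
  obtain ⟨C, hC⟩ := isCompact_univ.exists_bound_of_continuousOn hg.continuousOn
  exact ⟨C, fun x => hC x (mem_univ x)⟩

lemma norm_fourierCoeff_le {f : Torus → ℂ} {C : ℝ} (hf : ∀ x, ‖f x‖ ≤ C) (k : ℤ) :
    ‖fourierCoeff f k‖ ≤ C := by
  unfold fourierCoeff
  refine (norm_integral_le_of_norm_le_const (C := C) ?_).trans (by simp)
  filter_upwards with x
  rw [norm_smul, norm_fourier_apply, one_mul]
  exact hf x

lemma fourierCoeff_sub {f g : Torus → ℂ} (hf : Continuous f) (hg : Continuous g) (k : ℤ) :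
    fourierCoeff (fun x => f x - g x) k = fourierCoeff f k - fourierCoeff g k := by
  unfold fourierCoeff
  rw [← integral_sub]
  · simp [mul_sub]
  · exact integrable_of_continuous (by fun_prop)
  · exact integrable_of_continuous (by fun_prop)

/-- The coefficients of a product are the convolution of the coefficients. -/
lemma fourierCoeff_synth_mul {a : ℤ → ℂ} (ha : Summable fun k => ‖a k‖) {g : Torus → ℂ}
    (hg : Continuous g) (k : ℤ) :
    HasSum (fun j => a j * fourierCoeff g (k - j)) (fourierCoeff (fun x => synth a x * g x) k) := by
  obtain ⟨C, hC⟩ := exists_norm_le hg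
  have hC0 : 0 ≤ C := (norm_nonneg _).trans (hC 0)
  have h := hasSum_integral_of_summable_integral_norm
    (μ := (AddCircle.haarAddCircle : Measure Torus))
    (F := fun (j : ℤ) (x : Torus) => a j * (fourier (-(k - j)) x * g x)) ?_ ?_
  · have e1 : (fun j => a j * fourierCoeff g (k - j)) = fun (j : ℤ) => ∫ x : Torus,
        a j * (fourier (-(k - j)) x * g x) ∂AddCircle.haarAddCircle := by
      funext j
      rw [integral_const_mul]
      rfl
    have e2 : fourierCoeff (fun x => synth a x * g x) k = ∫ x : Torus,
        ∑' j : ℤ, a j * (fourier (-(k - j)) x * g x) ∂AddCircle.haarAddCircle := by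
      unfold fourierCoeff
      refine integral_congr_ae (Filter.Eventually.of_forall fun x => ?_)
      simp only [smul_eq_mul]
      have : ∀ j : ℤ, a j * (fourier (-(k - j)) x * g x) =
          (a j * fourier j x) * (fourier (-k) x * g x) := by
        intro j
        rw [show -(k - j) = -k + j by ring, fourier_add]
        ring
      simp_rw [this]
      rw [tsum_mul_right]
      unfold synth
      ring
    rw [e1, e2]
    exact h
  · intro j
    exact integrable_of_continuous (by fun_prop)
  · refine Summable.of_nonneg_of_le (fun j => integral_nonneg fun x => norm_nonneg _) (fun j => ?_)
      (ha.mul_right C)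
    calc ∫ x, ‖a j * (fourier (-(k - j)) x * g x)‖ ∂AddCircle.haarAddCircle
        ≤ ∫ x : Torus, ‖a j‖ * C ∂AddCircle.haarAddCircle := by
          apply integral_mono_of_nonneg
          · exact Filter.Eventually.of_forall fun x => norm_nonneg _
          · exact integrable_const _
          · refine Filter.Eventually.of_forall fun x => ?_
            simp only [norm_mul, norm_fourier_apply, one_mul]
            gcongr
            exact hC x
      _ = ‖a j‖ * C := by simp

lemma fourierCoeff_synth {a : ℤ → ℂ} (ha : Summable fun k => ‖a k‖) (k : ℤ) :
    fourierCoeff (synth a) k = a k := by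
  have h := fourierCoeff_synth_mul ha (continuous_const (y := (1 : ℂ))) k
  have h1 : (fun _ : Torus => (1 : ℂ)) = fourier 0 := by ext x; simp
  simp only [mul_one] at h
  rw [h1] at h
  have h2 := hasSum_ite_eq k (a k)
  refine HasSum.unique ?_ h2
  convert h using 1
  funext j
  rw [fourierCoeff_fourier]
  by_cases hj : j = k
  · simp [hj]
  · have : k - j ≠ 0 := sub_ne_zero.2 (Ne.symm hj)
    simp [hj, this]

lemma convBound_synth_mul {a : ℤ → ℂ} (ha : Summable fun k => ‖a k‖) {g : Torus → ℂ}
    (hg : Continuous g) :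
    ConvBound a (fourierCoeff g) (fourierCoeff fun x => synth a x * g x) := by
  intro k
  rw [← (fourierCoeff_synth_mul ha hg k).tsum_eq]
  refine (enorm_tsum_le_tsum_enorm).trans (le_of_eq ?_)
  simp [enorm_mul]

/-! ### The quadratic term `uₓ² / (1 + u)` -/

/-- The function `uₓ² / (1 + u)` for `u = ∑ₖ a k e^{ikx}`. -/
noncomputable def qfun (a : ℤ → ℂ) (x : Torus) : ℂ := synth (D a) x ^ 2 / (1 + synth a x)

/-- The Fourier coefficients of `uₓ² / (1 + u)`. -/
noncomputable def qcoeff (a : ℤ → ℂ) (k : ℤ) : ℂ := fourierCoeff (qfun a) k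

/-- The iteration `Q ↦ uₓ² - u Q` started from `0`, whose fixed point is `uₓ² / (1 + u)`. -/
noncomputable def qiter (a : ℤ → ℂ) : ℕ → Torus → ℂ
  | 0 => fun _ => 0
  | n + 1 => fun x => synth (D a) x * synth (D a) x - synth a x * qiter a n x

lemma continuous_qiter {a : ℤ → ℂ} (ha : Summable fun k => ‖a k‖)
    (hD : Summable fun k => ‖D a k‖) (n : ℕ) : Continuous (qiter a n) := by
  have h1 := continuous_synth ha
  have h2 := continuous_synth hD
  induction n with
  | zero => exact continuous_const
  | succ n ih => simp only [qiter]; fun_prop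

lemma one_add_synth_ne_zero {a : ℤ → ℂ} (ha : Summable fun k => ‖a k‖)
    (h1 : ∑' k, ‖a k‖ < 1) (x : Torus) : 1 + synth a x ≠ 0 := by
  intro h
  have h2 := (norm_synth_le ha x).trans_lt h1
  rw [show synth a x = -1 by linear_combination h] at h2
  simp at h2

lemma continuous_qfun {a : ℤ → ℂ} (ha : Summable fun k => ‖a k‖)
    (hD : Summable fun k => ‖D a k‖) (h1 : ∑' k, ‖a k‖ < 1) : Continuous (qfun a) :=
  ((continuous_synth hD).pow 2).div (continuous_const.add (continuous_synth ha))
    (one_add_synth_ne_zero ha h1)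

lemma qiter_sub_qfun {a : ℤ → ℂ} (ha : Summable fun k => ‖a k‖)
    (h1 : ∑' k, ‖a k‖ < 1) (n : ℕ) (x : Torus) :
    qiter a n x - qfun a x = -(-synth a x) ^ n * qfun a x := by
  have hx := one_add_synth_ne_zero ha h1 x
  induction n with
  | zero => simp [qiter]
  | succ n ih =>
    have h2 : qfun a x * (1 + synth a x) = synth (D a) x ^ 2 := by
      unfold qfun; field_simp
    simp only [qiter]
    rw [pow_succ]
    linear_combination (-synth a x) * ih - h2

/-- The iteration converges uniformly, since `‖u‖_∞ < 1`; hence so do its coefficients. -/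
lemma tendsto_fourierCoeff_qiter {a : ℤ → ℂ} (ha : Summable fun k => ‖a k‖)
    (hD : Summable fun k => ‖D a k‖) (h1 : ∑' k, ‖a k‖ < 1) (k : ℤ) :
    Filter.Tendsto (fun n => fourierCoeff (qiter a n) k) Filter.atTop (nhds (qcoeff a k)) := by
  obtain ⟨C, hC⟩ := exists_norm_le (continuous_qfun ha hD h1)
  rw [tendsto_iff_norm_sub_tendsto_zero]
  have h0 : 0 ≤ ∑' k, ‖a k‖ := tsum_nonneg fun k => norm_nonneg _
  have hlim : Filter.Tendsto (fun n : ℕ => (∑' k, ‖a k‖) ^ n * C) Filter.atTop (nhds 0) := by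
    simpa using (tendsto_pow_atTop_nhds_zero_of_lt_one h0 h1).mul_const C
  refine squeeze_zero (fun n => norm_nonneg _) (fun n => ?_) hlim
  rw [qcoeff, ← fourierCoeff_sub (continuous_qiter ha hD n) (continuous_qfun ha hD h1)]
  refine norm_fourierCoeff_le (fun x => ?_) k
  rw [qiter_sub_qfun ha h1, norm_mul, norm_neg, norm_pow, norm_neg]
  gcongr
  · exact norm_synth_le ha x
  · exact hC x

/-- Fatou's lemma for the moments. -/
lemma emom_le_of_tendsto {τ : ℝ} {s : ℕ} {c : ℕ → ℤ → ℂ} {c' : ℤ → ℂ} {B : ℝ≥0∞}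
    (hlim : ∀ k, Filter.Tendsto (fun n => c n k) Filter.atTop (nhds (c' k)))
    (hB : ∀ n, emom τ s (c n) ≤ B) : emom τ s c' ≤ B := by
  unfold emom
  rw [ENNReal.tsum_eq_iSup_sum]
  refine iSup_le fun F => ?_
  have : Filter.Tendsto (fun n => ∑ k ∈ F, wt τ s k * ‖c n k‖ₑ) Filter.atTop
      (nhds (∑ k ∈ F, wt τ s k * ‖c' k‖ₑ)) := by
    refine tendsto_finsetSum _ fun k _ => ?_
    exact ENNReal.Tendsto.const_mul (hlim k).enorm (Or.inr (wt_ne_top τ s k))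
  refine le_of_tendsto' this fun n => ?_
  exact (ENNReal.sum_le_tsum F).trans (hB n)

lemma tsum_enorm_le_emom {τ : ℝ} (hτ : 0 ≤ τ) (a : ℤ → ℂ) :
    ∑' k, ‖a k‖ₑ ≤ emom τ 0 a := by
  refine ENNReal.tsum_le_tsum fun k => ?_
  have : 1 ≤ wt τ 0 k := by
    unfold wt
    rw [pow_zero, one_mul, ← ENNReal.ofReal_one]
    exact ENNReal.ofReal_le_ofReal (Real.one_le_exp (by positivity))
  exact le_mul_of_one_le_left (zero_le) this

lemma summable_norm_of_emom {τ : ℝ} (hτ : 0 ≤ τ) {a : ℤ → ℂ} (h : emom τ 0 a ≠ ⊤) :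
    Summable fun k => ‖a k‖ := by
  have := ne_top_of_le_ne_top h (tsum_enorm_le_emom hτ a)
  have h2 := ENNReal.summable_toReal this
  simpa using h2

lemma tsum_norm_le_of_emom {τ : ℝ} (hτ : 0 ≤ τ) {a : ℤ → ℂ} {z : ℝ} (hz : 0 ≤ z)
    (h : emom τ 0 a ≤ ENNReal.ofReal z) : ∑' k, ‖a k‖ ≤ z := by
  have hs := summable_norm_of_emom hτ (ne_top_of_le_ne_top ENNReal.ofReal_ne_top h)
  have h2 := (tsum_enorm_le_emom hτ a).trans h
  rw [← ENNReal.ofReal_le_ofReal_iff hz, ENNReal.ofReal_tsum_of_nonneg (fun _ => norm_nonneg _) hs]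
  simpa using h2

/-! ### Moments of the quadratic term -/

lemma emom_fourierCoeff_qiter_succ {a : ℤ → ℂ} (ha : Summable fun k => ‖a k‖)
    (hD : Summable fun k => ‖D a k‖) (τ : ℝ) (s n : ℕ) :
    emom τ s (fourierCoeff (qiter a (n + 1))) ≤
      emom τ s (fourierCoeff fun x => synth (D a) x * synth (D a) x) +
      emom τ s (fourierCoeff fun x => synth a x * qiter a n x) := by
  have h1 := continuous_synth ha
  have h2 := continuous_synth hD
  have h3 := continuous_qiter ha hD n
  refine emom_add_le τ s fun k => ?_
  simp only [qiter]
  rw [fourierCoeff_sub (by fun_prop) (by fun_prop)]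
  exact enorm_sub_le

lemma emom_fourierCoeff_zero (τ : ℝ) (s : ℕ) (a : ℤ → ℂ) :
    emom τ s (fourierCoeff (qiter a 0)) = 0 := by
  simp [qiter, emom, fourierCoeff]

/-- The moments of `Q = uₓ² / (1 + u)` of order `0`, `1` and `2`. Each pass through the recursion
`Q = uₓ² - u Q` costs a factor `m₀(u) ≤ z`, so the bounds that reproduce themselves under it carry
powers of the geometric factor `1 / (1 - z)`. All products of moments that arise are then reduced to
`m₄` by Chebyshev's inequality `m_p m_q ≤ m₀ m_{p+q}`. -/
theorem emom_qcoeff_le {τ : ℝ} (hτ : 0 ≤ τ) {a : ℤ → ℂ} {z : ℝ} (hz : 0 ≤ z) (hz1 : z < 1)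
    (hsym : ∀ k, ‖a (-k)‖ₑ = ‖a k‖ₑ) (h0 : emom τ 0 a ≤ ENNReal.ofReal z)
    (h4 : emom τ 4 a ≠ ⊤) :
    emom τ 0 (qcoeff a) ≤ ENNReal.ofReal (1 / (1 - z)) * emom τ 1 a ^ 2 ∧
    emom τ 1 (qcoeff a) ≤ ENNReal.ofReal (P₂ z) * emom τ 4 a ∧
    emom τ 2 (qcoeff a) ≤ ENNReal.ofReal (P₁ z) * emom τ 4 a := by
  have hz' : 0 < 1 - z := by linarith
  have hfin : ∀ s, 0 < s → s ≤ 4 → emom τ s a ≠ ⊤ := fun s h h' =>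
    ne_top_of_le_ne_top h4 (emom_le_of_le τ h h' a)
  have hfin0 : emom τ 0 a ≠ ⊤ := ne_top_of_le_ne_top ENNReal.ofReal_ne_top h0
  have ha : Summable fun k => ‖a k‖ := summable_norm_of_emom hτ hfin0
  have hD : Summable fun k => ‖D a k‖ := by
    apply summable_norm_of_emom hτ
    rw [emom_D]; exact hfin 1 (by norm_num) (by norm_num)
  have hsum1 : ∑' k, ‖a k‖ < 1 := (tsum_norm_le_of_emom hτ hz h0).trans_lt hz1
  -- real-valued moments
  obtain ⟨m0, e0, p0⟩ : ∃ m : ℝ, emom τ 0 a = ENNReal.ofReal m ∧ 0 ≤ m :=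
    ⟨_, (ENNReal.ofReal_toReal hfin0).symm, ENNReal.toReal_nonneg⟩
  obtain ⟨m1, e1, p1⟩ : ∃ m : ℝ, emom τ 1 a = ENNReal.ofReal m ∧ 0 ≤ m :=
    ⟨_, (ENNReal.ofReal_toReal (hfin 1 (by norm_num) (by norm_num))).symm, ENNReal.toReal_nonneg⟩
  obtain ⟨m2, e2, p2⟩ : ∃ m : ℝ, emom τ 2 a = ENNReal.ofReal m ∧ 0 ≤ m :=
    ⟨_, (ENNReal.ofReal_toReal (hfin 2 (by norm_num) (by norm_num))).symm, ENNReal.toReal_nonneg⟩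
  obtain ⟨m3, e3, p3⟩ : ∃ m : ℝ, emom τ 3 a = ENNReal.ofReal m ∧ 0 ≤ m :=
    ⟨_, (ENNReal.ofReal_toReal (hfin 3 (by norm_num) (by norm_num))).symm, ENNReal.toReal_nonneg⟩
  obtain ⟨m4, e4, p4⟩ : ∃ m : ℝ, emom τ 4 a = ENNReal.ofReal m ∧ 0 ≤ m :=
    ⟨_, (ENNReal.ofReal_toReal h4).symm, ENNReal.toReal_nonneg⟩
  have h0z : m0 ≤ z := by
    rw [e0] at h0; exact (ENNReal.ofReal_le_ofReal_iff hz).1 h0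
  have i11 : m1 * m1 ≤ m0 * m2 := by
    have := emom_mul_le τ 1 1 a
    rw [e0, e1, e2, ← ENNReal.ofReal_mul p1, ← ENNReal.ofReal_mul p0] at this
    exact (ENNReal.ofReal_le_ofReal_iff (by positivity)).1 this
  have i12 : m1 * m2 ≤ m0 * m3 := by
    have := emom_mul_le τ 1 2 a
    rw [e0, e1, e2, e3, ← ENNReal.ofReal_mul p1, ← ENNReal.ofReal_mul p0] at this
    exact (ENNReal.ofReal_le_ofReal_iff (by positivity)).1 this
  have i13 : m1 * m3 ≤ m0 * m4 := by
    have := emom_mul_le τ 1 3 a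
    rw [e0, e1, e3, e4, ← ENNReal.ofReal_mul p1, ← ENNReal.ofReal_mul p0] at this
    exact (ENNReal.ofReal_le_ofReal_iff (by positivity)).1 this
  have i22 : m2 * m2 ≤ m0 * m4 := by
    have := emom_mul_le τ 2 2 a
    rw [e0, e2, e4, ← ENNReal.ofReal_mul p2, ← ENNReal.ofReal_mul p0] at this
    exact (ENNReal.ofReal_le_ofReal_iff (by positivity)).1 this
  have i34 : m3 ≤ m4 := by
    have := emom_le_of_le τ (show 0 < 3 by norm_num) (show 3 ≤ 4 by norm_num) a
    rw [e3, e4] at this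
    exact (ENNReal.ofReal_le_ofReal_iff p4).1 this
  -- moments of `uₓ²`
  have hU := convBound_synth_mul hD (continuous_synth hD)
  have hcoef : fourierCoeff (synth (D a)) = D a := funext fun k => fourierCoeff_synth hD k
  rw [hcoef] at hU
  have s0 : emom τ 0 (fourierCoeff fun x => synth (D a) x * synth (D a) x) ≤
      ENNReal.ofReal (m1 * m1) := by
    refine (hU.emom_zero hτ).trans (le_of_eq ?_)
    rw [emom_D, e1, ENNReal.ofReal_mul p1]
  have s1 : emom τ 1 (fourierCoeff fun x => synth (D a) x * synth (D a) x) ≤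
      ENNReal.ofReal (m0 * m4) := by
    refine (emom_one_sq_le hτ hsym hU).trans (le_of_eq ?_)
    rw [e0, e4, ENNReal.ofReal_mul p0]
  have s1' : emom τ 1 (fourierCoeff fun x => synth (D a) x * synth (D a) x) ≤
      ENNReal.ofReal (2 * (m1 * m2)) := by
    refine (hU.emom_one hτ).trans (le_of_eq ?_)
    rw [emom_D, emom_D, e1, e2, ← ENNReal.ofReal_mul p1, ← ENNReal.ofReal_mul p2,
      ← ENNReal.ofReal_add (by positivity) (by positivity)]
    congr 1; ring
  have s2 : emom τ 2 (fourierCoeff fun x => synth (D a) x * synth (D a) x) ≤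
      ENNReal.ofReal (2 * (m1 * m3) + 2 * (m2 * m2)) := by
    refine (hU.emom_two hτ).trans (le_of_eq ?_)
    rw [emom_D, emom_D, emom_D, e1, e2, e3, show (2 : ℝ≥0∞) = ENNReal.ofReal 2 by simp,
      ← ENNReal.ofReal_mul p1, ← ENNReal.ofReal_mul p2, ← ENNReal.ofReal_mul p3,
      ← ENNReal.ofReal_mul (by norm_num),
      ← ENNReal.ofReal_add (by positivity) (by positivity),
      ← ENNReal.ofReal_add (by positivity) (by positivity)]
    congr 1; ring
  have hV : ∀ n, ConvBound a (fourierCoeff (qiter a n))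
      (fourierCoeff fun x => synth a x * qiter a n x) :=
    fun n => convBound_synth_mul ha (continuous_qiter ha hD n)
  -- the fixed points of the recursive bounds for the moments of order `0`, `1`, `2` of the iterates;
  -- `B1` (from `m₁(uₓ²) ≤ m₀ m₄`) is the sharper first moment, while `B1'` (from `2 m₁ m₂`) is the
  -- form that combines with `m1` in the second moment
  set B0 := m1 * m1 / (1 - z) with hB0
  set B1' := (2 * (m1 * m2) + m1 * B0) / (1 - z) with hB1'
  set B1 := (m0 * m4 + m1 * B0) / (1 - z) with hB1
  set B2 := (2 * (m1 * m3) + 2 * (m2 * m2) + m2 * B0 + 2 * (m1 * B1')) / (1 - z) with hB2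
  have q0 : 0 ≤ B0 := by positivity
  have q1' : 0 ≤ B1' := by positivity
  have q1 : 0 ≤ B1 := by positivity
  have q2 : 0 ≤ B2 := by positivity
  have t0 : ∀ n, emom τ 0 (fourierCoeff (qiter a n)) ≤ ENNReal.ofReal B0 := by
    intro n
    induction n with
    | zero => simp [emom_fourierCoeff_zero]
    | succ n ih =>
      refine (emom_fourierCoeff_qiter_succ ha hD τ 0 n).trans ?_
      calc _ ≤ ENNReal.ofReal (m1 * m1) + ENNReal.ofReal z * ENNReal.ofReal B0 := by
            gcongr
            exact ((hV n).emom_zero hτ).trans (by gcongr)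
        _ = ENNReal.ofReal B0 := by
            rw [← ENNReal.ofReal_mul hz, ← ENNReal.ofReal_add (by positivity) (by positivity)]
            congr 1
            rw [hB0]; field_simp; ring
  have t1g : ∀ S : ℝ, 0 ≤ S →
      emom τ 1 (fourierCoeff fun x => synth (D a) x * synth (D a) x) ≤ ENNReal.ofReal S →
      ∀ n, emom τ 1 (fourierCoeff (qiter a n)) ≤ ENNReal.ofReal ((S + m1 * B0) / (1 - z)) := by
    intro S hS hSS n
    induction n with
    | zero => simp [emom_fourierCoeff_zero]
    | succ n ih =>
      refine (emom_fourierCoeff_qiter_succ ha hD τ 1 n).trans ?_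
      calc _ ≤ ENNReal.ofReal S + (ENNReal.ofReal m1 * ENNReal.ofReal B0 +
              ENNReal.ofReal z * ENNReal.ofReal ((S + m1 * B0) / (1 - z))) := by
            gcongr
            refine ((hV n).emom_one hτ).trans ?_
            rw [e1]
            gcongr
            exact t0 n
        _ = ENNReal.ofReal ((S + m1 * B0) / (1 - z)) := by
            rw [← ENNReal.ofReal_mul hz, ← ENNReal.ofReal_mul p1,
              ← ENNReal.ofReal_add (by positivity) (by positivity),
              ← ENNReal.ofReal_add (by positivity) (by positivity)]
            congr 1
            field_simp; ring
  have t1 := t1g _ (by positivity) s1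
  have t1' := t1g _ (by positivity) s1'
  have t2 : ∀ n, emom τ 2 (fourierCoeff (qiter a n)) ≤ ENNReal.ofReal B2 := by
    intro n
    induction n with
    | zero => simp [emom_fourierCoeff_zero]
    | succ n ih =>
      refine (emom_fourierCoeff_qiter_succ ha hD τ 2 n).trans ?_
      calc _ ≤ ENNReal.ofReal (2 * (m1 * m3) + 2 * (m2 * m2)) +
              (ENNReal.ofReal m2 * ENNReal.ofReal B0 +
                ENNReal.ofReal 2 * (ENNReal.ofReal m1 * ENNReal.ofReal B1') +
              ENNReal.ofReal z * ENNReal.ofReal B2) := by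
            gcongr
            refine ((hV n).emom_two hτ).trans ?_
            rw [e1, e2, show (2 : ℝ≥0∞) = ENNReal.ofReal 2 by simp]
            gcongr
            · exact t0 n
            · exact t1' n
        _ = ENNReal.ofReal B2 := by
            rw [← ENNReal.ofReal_mul hz, ← ENNReal.ofReal_mul p1, ← ENNReal.ofReal_mul p2,
              ← ENNReal.ofReal_mul (by norm_num),
              ← ENNReal.ofReal_add (by positivity) (by positivity),
              ← ENNReal.ofReal_add (by positivity) (by positivity),
              ← ENNReal.ofReal_add (by positivity) (by positivity)]
            congr 1
            rw [hB2]; field_simp; ring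
  have hlim := tendsto_fourierCoeff_qiter ha hD hsum1
  -- products of moments in terms of `m4`
  have j112 : m1 * m1 * m2 ≤ z ^ 2 * m4 := by
    calc m1 * m1 * m2 ≤ m0 * m2 * m2 := by gcongr
      _ = m0 * (m2 * m2) := by ring
      _ ≤ m0 * (m0 * m4) := by gcongr
      _ ≤ z * (z * m4) := by gcongr
      _ = _ := by ring
  have j1111 : m1 * m1 * (m1 * m1) ≤ z ^ 3 * m4 := by
    calc m1 * m1 * (m1 * m1) ≤ m1 * m1 * (m0 * m2) := by gcongr
      _ = m0 * (m1 * m1 * m2) := by ring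
      _ ≤ z * (z ^ 2 * m4) := by gcongr
      _ = _ := by ring
  have j111 : m1 * (m1 * m1) ≤ z ^ 2 * m4 := by
    calc m1 * (m1 * m1) ≤ m1 * (m0 * m2) := by gcongr
      _ = m0 * (m1 * m2) := by ring
      _ ≤ m0 * (m0 * m3) := by gcongr
      _ ≤ z * (z * m4) := by gcongr
      _ = _ := by ring
  have j13 : m1 * m3 ≤ z * m4 := i13.trans (by gcongr)
  have j22 : m2 * m2 ≤ z * m4 := i22.trans (by gcongr)
  have hP2 : B1 ≤ P₂ z * m4 := by
    have : m1 * B0 ≤ z ^ 2 * m4 / (1 - z) := by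
      rw [hB0, ← mul_div_assoc]; gcongr
    calc B1 ≤ (z * m4 + z ^ 2 * m4 / (1 - z)) / (1 - z) := by rw [hB1]; gcongr
      _ = P₂ z * m4 := by unfold P₂; field_simp
  have hP1 : B2 ≤ P₁ z * m4 := by
    have k1 : m2 * B0 ≤ z ^ 2 * m4 / (1 - z) := by
      rw [hB0, ← mul_div_assoc, mul_comm m2]; gcongr
    have k2 : m1 * B1' ≤ (2 * (z ^ 2 * m4) + z ^ 3 * m4 / (1 - z)) / (1 - z) := by
      have : m1 * B1' = (2 * (m1 * m1 * m2) + m1 * m1 * (m1 * m1) / (1 - z)) / (1 - z) := by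
        rw [hB1', hB0]; field_simp
      rw [this]; gcongr
    calc B2 ≤ (2 * (z * m4) + 2 * (z * m4) + z ^ 2 * m4 / (1 - z) +
          2 * ((2 * (z ^ 2 * m4) + z ^ 3 * m4 / (1 - z)) / (1 - z))) / (1 - z) := by
          rw [hB2]; gcongr
      _ = P₁ z * m4 - 2 * z ^ 3 / (1 - z) ^ 3 * m4 := by unfold P₁; field_simp; ring
      _ ≤ P₁ z * m4 := by
          have : 0 ≤ 2 * z ^ 3 / (1 - z) ^ 3 * m4 := by positivity
          linarith
  have pP2 : 0 ≤ P₂ z := by unfold P₂; positivity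
  have pP1 : 0 ≤ P₁ z := by unfold P₁; positivity
  refine ⟨?_, ?_, ?_⟩
  · refine (emom_le_of_tendsto hlim t0).trans (le_of_eq ?_)
    rw [e1, ← ENNReal.ofReal_pow p1, ← ENNReal.ofReal_mul (by positivity), hB0]
    congr 1; ring
  · refine (emom_le_of_tendsto hlim t1).trans ?_
    rw [e4, ← ENNReal.ofReal_mul pP2]
    exact ENNReal.ofReal_le_ofReal hP2
  · refine (emom_le_of_tendsto hlim t2).trans ?_
    rw [e4, ← ENNReal.ofReal_mul pP1]
    exact ENNReal.ofReal_le_ofReal hP1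

/-! ### Continuity of the quadratic term -/

lemma norm_one_add_synth_ge {a : ℤ → ℂ} (ha : Summable fun k => ‖a k‖) {z : ℝ}
    (h : ∑' k, ‖a k‖ ≤ z) (x : Torus) : 1 - z ≤ ‖1 + synth a x‖ := by
  have h1 := norm_synth_le ha x
  have h2 : ‖(1 : ℂ)‖ ≤ ‖1 + synth a x‖ + ‖synth a x‖ := by
    simpa using norm_sub_le (1 + synth a x) (synth a x)
  rw [norm_one] at h2
  linarith

lemma norm_qfun_le {a : ℤ → ℂ} (ha : Summable fun k => ‖a k‖)
    (hD : Summable fun k => ‖D a k‖) {z : ℝ} (hz1 : z < 1) (h : ∑' k, ‖a k‖ ≤ z) (x : Torus) :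
    ‖qfun a x‖ ≤ (∑' k, ‖D a k‖) ^ 2 / (1 - z) := by
  unfold qfun
  rw [norm_div, norm_pow]
  have h1 := norm_one_add_synth_ge ha h x
  have h2 := norm_synth_le hD x
  have : 0 < 1 - z := by linarith
  gcongr

lemma norm_qcoeff_le {a : ℤ → ℂ} (ha : Summable fun k => ‖a k‖)
    (hD : Summable fun k => ‖D a k‖) {z : ℝ} (hz1 : z < 1) (h : ∑' k, ‖a k‖ ≤ z) (k : ℤ) :
    ‖qcoeff a k‖ ≤ (∑' k, ‖D a k‖) ^ 2 / (1 - z) :=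
  norm_fourierCoeff_le (norm_qfun_le ha hD hz1 h) k

/-- The coefficients of `uₓ² / (1 + u)` are locally Lipschitz in `u`, for the norms
`∑ ‖a k‖` and `∑ |k| ‖a k‖`. -/
lemma norm_qcoeff_sub_le {a b : ℤ → ℂ} (ha : Summable fun k => ‖a k‖)
    (hDa : Summable fun k => ‖D a k‖) (hb : Summable fun k => ‖b k‖)
    (hDb : Summable fun k => ‖D b k‖) {z B : ℝ} (hz1 : z < 1)
    (hza : ∑' k, ‖a k‖ ≤ z) (hzb : ∑' k, ‖b k‖ ≤ z) (hBa : ∑' k, ‖D a k‖ ≤ B)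
    (hBb : ∑' k, ‖D b k‖ ≤ B) (k : ℤ) :
    ‖qcoeff a k - qcoeff b k‖ ≤ 2 * B / (1 - z) * ∑' k, ‖D a k - D b k‖ +
      B ^ 2 / (1 - z) ^ 2 * ∑' k, ‖a k - b k‖ := by
  have hz : 0 < 1 - z := by linarith
  have hB : 0 ≤ B := (tsum_nonneg fun k => norm_nonneg _).trans hBa
  unfold qcoeff
  rw [← fourierCoeff_sub (continuous_qfun ha hDa (by linarith))
    (continuous_qfun hb hDb (by linarith))]
  refine norm_fourierCoeff_le (fun x => ?_) k
  have na := norm_one_add_synth_ge ha hza x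
  have nb := norm_one_add_synth_ge hb hzb x
  have hna := one_add_synth_ne_zero ha (by linarith) x
  have hnb := one_add_synth_ne_zero hb (by linarith) x
  have dab : ‖synth a x - synth b x‖ ≤ ∑' k, ‖a k - b k‖ := by
    rw [synth_sub ha hb]
    exact norm_synth_le (.of_nonneg_of_le (fun _ => norm_nonneg _)
      (fun k => norm_sub_le _ _) (ha.add hb)) x
  have dDab : ‖synth (D a) x - synth (D b) x‖ ≤ ∑' k, ‖D a k - D b k‖ := by
    rw [synth_sub hDa hDb]
    exact norm_synth_le (.of_nonneg_of_le (fun _ => norm_nonneg _)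
      (fun k => norm_sub_le _ _) (hDa.add hDb)) x
  have lDa := (norm_synth_le hDa x).trans hBa
  have lDb := (norm_synth_le hDb x).trans hBb
  have e : qfun a x - qfun b x =
      (synth (D a) x + synth (D b) x) / (1 + synth a x) * (synth (D a) x - synth (D b) x) -
      synth (D b) x ^ 2 / ((1 + synth a x) * (1 + synth b x)) * (synth a x - synth b x) := by
    unfold qfun
    field_simp
    ring
  rw [e]
  refine (norm_sub_le _ _).trans ?_
  simp only [norm_mul, norm_div, norm_pow]
  have l1 : ‖synth (D a) x + synth (D b) x‖ ≤ 2 * B := (norm_add_le _ _).trans (by linarith)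
  rw [sq (1 - z)]
  gcongr

/-! ### Coefficients of real functions -/

/-- Coefficients of a real function: `a (-k)` is the conjugate of `a k`. -/
def IsHerm (a : ℤ → ℂ) : Prop := ∀ k, a (-k) = starRingEnd ℂ (a k)

lemma IsHerm.enorm {a : ℤ → ℂ} (h : IsHerm a) (k : ℤ) : ‖a (-k)‖ₑ = ‖a k‖ₑ := by
  rw [h k]; simp [← ofReal_norm]

lemma IsHerm.D {a : ℤ → ℂ} (h : IsHerm a) : IsHerm (D a) := by
  intro k
  simp [DLSS.D, h k]

lemma IsHerm.conj_synth {a : ℤ → ℂ} (h : IsHerm a) (x : Torus) :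
    starRingEnd ℂ (synth a x) = synth a x := by
  unfold synth
  rw [Complex.conj_tsum, ← (Equiv.neg ℤ).tsum_eq]
  refine tsum_congr fun k => ?_
  rw [Equiv.neg_apply, h k, map_mul, Complex.conj_conj, fourier_neg, Complex.conj_conj]

lemma IsHerm.synth_re {a : ℤ → ℂ} (h : IsHerm a) (x : Torus) :
    ((synth a x).re : ℂ) = synth a x := Complex.conj_eq_iff_re.1 (h.conj_synth x)

lemma isHerm_fourierCoeff {f : Torus → ℂ} (hf : ∀ x, starRingEnd ℂ (f x) = f x) :
    IsHerm (fourierCoeff f) := by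
  intro k
  unfold fourierCoeff
  rw [← integral_conj]
  congr 1
  ext x
  rw [smul_eq_mul, smul_eq_mul, map_mul, hf x, fourier_neg, fourier_neg, Complex.conj_conj]

lemma IsHerm.qcoeff {a : ℤ → ℂ} (h : IsHerm a) : IsHerm (qcoeff a) := by
  refine isHerm_fourierCoeff fun x => ?_
  simp [qfun, h.conj_synth, h.D.conj_synth]

/-! ### An energy inequality for complex-valued curves -/

/-- If `⟨b, b'⟩ ≤ -q |b|² + F |b|`, then `|b(t)| + ∫ q |b| ≤ |b(0)| + ∫ F`. -/
lemma norm_add_integral_le {T : ℝ} {b b' : ℝ → ℂ} {q F : ℝ → ℝ}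
    (hb : ∀ t ∈ Icc 0 T, HasDerivWithinAt b (b' t) (Icc 0 T) t)
    (hq : ContinuousOn q (Icc 0 T)) (hF : ContinuousOn F (Icc 0 T))
    (hq0 : ∀ t ∈ Icc 0 T, 0 ≤ q t) (hF0 : ∀ t ∈ Icc 0 T, 0 ≤ F t)
    (h : ∀ t ∈ Icc 0 T, inner ℝ (b t) (b' t) ≤ -q t * ‖b t‖ ^ 2 + F t * ‖b t‖)
    {t : ℝ} (ht : t ∈ Icc 0 T) :
    ‖b t‖ + ∫ s in (0 : ℝ)..t, q s * ‖b s‖ ≤ ‖b 0‖ + ∫ s in (0 : ℝ)..t, F s := by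
  have hsub : Icc 0 t ⊆ Icc 0 T := Icc_subset_Icc_right ht.2
  have hbc : ContinuousOn b (Icc 0 t) := fun s hs =>
    ((hb s (hsub hs)).continuousWithinAt).mono hsub
  have hqc := hq.mono hsub
  have hFc := hF.mono hsub
  -- `|b|` is not differentiable at zeros of `b`, so `√(|b|² + η²)` is used in its place
  have key : ∀ η : ℝ, 0 < η → ‖b t‖ + ∫ s in (0 : ℝ)..t, q s * ‖b s‖ ≤
      ‖b 0‖ + (∫ s in (0 : ℝ)..t, F s) + η * (1 + ∫ s in (0 : ℝ)..t, q s) := by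
    intro η hη
    have hpos : ∀ s, 0 < ‖b s‖ ^ 2 + η ^ 2 := fun s => by positivity
    have hmain := intervalIntegral.sub_le_integral_of_hasDeriv_right_of_le
      (g := fun s => Real.sqrt (‖b s‖ ^ 2 + η ^ 2))
      (g' := fun s => (2 * inner ℝ (b s) (b' s)) / (2 * Real.sqrt (‖b s‖ ^ 2 + η ^ 2)))
      (φ := fun s => F s - q s * ‖b s‖ + η * q s) ht.1 ?_ ?_ ?_ ?_
    · have e : ∫ s in (0 : ℝ)..t, (F s - q s * ‖b s‖ + η * q s) =
          (∫ s in (0 : ℝ)..t, F s) - (∫ s in (0 : ℝ)..t, q s * ‖b s‖) +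
            η * ∫ s in (0 : ℝ)..t, q s := by
        rw [intervalIntegral.integral_add, intervalIntegral.integral_sub,
          intervalIntegral.integral_const_mul]
        all_goals
          apply ContinuousOn.intervalIntegrable_of_Icc ht.1
          fun_prop
      rw [e] at hmain
      have h1 : ‖b t‖ ≤ Real.sqrt (‖b t‖ ^ 2 + η ^ 2) := by
        apply Real.le_sqrt_of_sq_le; nlinarith
      have h2 : Real.sqrt (‖b 0‖ ^ 2 + η ^ 2) ≤ ‖b 0‖ + η := by
        rw [Real.sqrt_le_left (by positivity)]
        nlinarith [norm_nonneg (b 0)]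
      linarith
    · fun_prop
    · intro s hs
      have hs' : s ∈ Icc 0 T := hsub (Ioo_subset_Icc_self hs)
      have hd : HasDerivAt b (b' s) s := (hb s hs').hasDerivAt
        (Icc_mem_nhds hs.1 (hs.2.trans_le ht.2))
      exact (((hd.norm_sq).add_const (η ^ 2)).sqrt (hpos s).ne').hasDerivWithinAt
    · apply ContinuousOn.integrableOn_Icc
      fun_prop
    · intro s hs
      have hs' : s ∈ Icc 0 T := hsub (Ioo_subset_Icc_self hs)
      have hh := h s hs'
      have hq1 := hq0 s hs'
      have hF1 := hF0 s hs'
      set n := ‖b s‖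
      have hn : 0 ≤ n := norm_nonneg _
      set S := Real.sqrt (n ^ 2 + η ^ 2) with hS
      have hS0 : 0 < S := Real.sqrt_pos.2 (hpos s)
      have hS2 : S ^ 2 = n ^ 2 + η ^ 2 := Real.sq_sqrt (hpos s).le
      have hnS : n ≤ S := by apply Real.le_sqrt_of_sq_le; nlinarith
      have hηS : η ≤ S := by apply Real.le_sqrt_of_sq_le; nlinarith
      rw [mul_div_mul_left _ _ two_ne_zero, div_le_iff₀ hS0]
      have a1 : F s * n ≤ F s * S := by gcongr
      have a2 : q s * (n * S) ≤ q s * (n ^ 2 + η * S) := by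
        gcongr
        nlinarith
      nlinarith
  have hC : 0 ≤ ∫ s in (0 : ℝ)..t, q s :=
    intervalIntegral.integral_nonneg ht.1 fun s hs => hq0 s (hsub hs)
  refine le_of_forall_pos_le_add fun e he => ?_
  refine (key (e / (1 + ∫ s in (0 : ℝ)..t, q s)) (by positivity)).trans (le_of_eq ?_)
  field_simp

/-! ### The Galerkin system -/

/-- The symbol of the linear part `-ν ∂ₓ⁴ + (4/3) κ ∂ₓ³`; the coefficient `4/3` collects the `1/3`
of the equation and the linear part of `κ ((1 + u) (log (1 + u))ₓₓ)ₓ`. -/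
noncomputable def linSymbol (ν κ : ℝ) (k : ℤ) : ℂ :=
  -(ν * (k : ℂ) ^ 4) - Complex.I * (((4 / 3 * κ : ℝ) : ℂ) * (k : ℂ) ^ 3)

/-- The symbol of the operator `κ ∂ₓ - ν ∂ₓ²` acting on `uₓ² / (1 + u)`. -/
noncomputable def quadSymbol (ν κ : ℝ) (k : ℤ) : ℂ := Complex.I * (κ * k) + ν * (k : ℂ) ^ 2

lemma linSymbol_neg (ν κ : ℝ) (k : ℤ) :
    linSymbol ν κ (-k) = starRingEnd ℂ (linSymbol ν κ k) := by
  simp only [linSymbol, map_sub, map_neg, map_mul, map_pow, Complex.conj_ofReal, Complex.conj_I]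
  push_cast
  rw [map_intCast]
  ring

lemma quadSymbol_neg (ν κ : ℝ) (k : ℤ) :
    quadSymbol ν κ (-k) = starRingEnd ℂ (quadSymbol ν κ k) := by
  simp [quadSymbol]

lemma linSymbol_re (ν κ : ℝ) (k : ℤ) : (linSymbol ν κ k).re = -(ν * (k : ℝ) ^ 4) := by
  have : linSymbol ν κ k = ((-(ν * (k : ℝ) ^ 4) : ℝ) : ℂ) +
      ((-(4 / 3 * κ * (k : ℝ) ^ 3) : ℝ) : ℂ) * Complex.I := by
    simp [linSymbol]; ring
  rw [this]; simp only [Complex.add_re, Complex.ofReal_re, Complex.re_ofReal_mul, Complex.I_re]; ring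

lemma norm_quadSymbol_le {ν : ℝ} (hν : 0 ≤ ν) (κ : ℝ) (k : ℤ) :
    ‖quadSymbol ν κ k‖ ≤ |κ| * |(k : ℝ)| + ν * |(k : ℝ)| ^ 2 := by
  unfold quadSymbol
  refine (norm_add_le _ _).trans (le_of_eq ?_)
  simp [abs_of_nonneg hν]

/-- The vector `(b₁, …, b_N)` viewed as the coefficients of a real trigonometric polynomial of mean
zero and degree at most `N`. -/
noncomputable def ext {N : ℕ} (b : Fin N → ℂ) (k : ℤ) : ℂ :=
  if h : 0 < k.natAbs ∧ k.natAbs ≤ N then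
    if 0 < k then b ⟨k.natAbs - 1, by omega⟩ else starRingEnd ℂ (b ⟨k.natAbs - 1, by omega⟩)
  else 0

section Ext

variable {N : ℕ}

lemma ext_succ (b : Fin N → ℂ) (j : Fin N) : ext b ((j : ℤ) + 1) = b j := by
  have h1 : ((j : ℤ) + 1).natAbs = j + 1 := by omega
  have h2 : (0 : ℤ) < (j : ℤ) + 1 := by omega
  have h3 : 0 < ((j : ℤ) + 1).natAbs ∧ ((j : ℤ) + 1).natAbs ≤ N := by omega
  unfold ext
  rw [dif_pos h3, if_pos h2]
  congr 1

lemma isHerm_ext (b : Fin N → ℂ) : IsHerm (ext b) := by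
  intro k
  unfold ext
  simp only [Int.natAbs_neg]
  by_cases h : 0 < k.natAbs ∧ k.natAbs ≤ N
  · rw [dif_pos h, dif_pos h]
    by_cases hk : 0 < k
    · rw [if_pos hk, if_neg (by omega)]
    · rw [if_neg hk, if_pos (by omega)]; simp
  · rw [dif_neg h, dif_neg h]; simp

lemma ext_eq_zero (b : Fin N → ℂ) {k : ℤ} (hk : k ∉ Finset.Icc (-N : ℤ) N) : ext b k = 0 := by
  unfold ext
  rw [dif_neg]
  rw [Finset.mem_Icc] at hk
  omega

lemma ext_zero_index (b : Fin N → ℂ) : ext b 0 = 0 := by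
  simp [ext]

lemma ext_sub (b c : Fin N → ℂ) (k : ℤ) : ext (b - c) k = ext b k - ext c k := by
  unfold ext
  split_ifs <;> simp

lemma ext_smul (x : ℝ) (b : Fin N → ℂ) (k : ℤ) : ext (x • b) k = x * ext b k := by
  unfold ext
  split_ifs <;> simp

lemma norm_ext_le (b : Fin N → ℂ) (k : ℤ) : ‖ext b k‖ ≤ ‖b‖ := by
  unfold ext
  split_ifs
  · exact norm_le_pi_norm b _
  · rw [RCLike.norm_conj]; exact norm_le_pi_norm b _
  · simp

/-- The norm `∑ₖ ‖b k‖`, summed over all frequencies `-N ≤ k ≤ N`. -/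
noncomputable def ell (b : Fin N → ℂ) : ℝ := ∑ k ∈ Finset.Icc (-N : ℤ) N, ‖ext b k‖

lemma ell_nonneg (b : Fin N → ℂ) : 0 ≤ ell b := Finset.sum_nonneg fun _ _ => norm_nonneg _

lemma ell_le (b : Fin N → ℂ) : ell b ≤ (2 * N + 1) * ‖b‖ := by
  unfold ell
  refine (Finset.sum_le_card_nsmul _ _ ‖b‖ fun k _ => norm_ext_le b k).trans (le_of_eq ?_)
  have : ((N : ℤ) + 1 - -N).toNat = 2 * N + 1 := by omega
  rw [Int.card_Icc, this, nsmul_eq_mul]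
  push_cast; ring

lemma norm_le_ell (b : Fin N → ℂ) : ‖b‖ ≤ ell b := by
  refine (pi_norm_le_iff_of_nonneg (ell_nonneg b)).2 fun j => ?_
  rw [← ext_succ b j]
  exact Finset.single_le_sum (f := fun k => ‖ext b k‖) (fun _ _ => norm_nonneg _)
    (Finset.mem_Icc.2 (by omega))

lemma abs_ell_sub_le (b c : Fin N → ℂ) : |ell b - ell c| ≤ (2 * N + 1) * ‖b - c‖ := by
  refine le_trans ?_ (ell_le (b - c))
  unfold ell
  rw [← Finset.sum_sub_distrib]
  refine (Finset.abs_sum_le_sum_abs _ _).trans (Finset.sum_le_sum fun k _ => ?_)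
  rw [ext_sub]
  exact abs_norm_sub_norm_le _ _

lemma ell_smul {x : ℝ} (hx : 0 ≤ x) (b : Fin N → ℂ) : ell (x • b) = x * ell b := by
  unfold ell
  rw [Finset.mul_sum]
  refine Finset.sum_congr rfl fun k _ => ?_
  rw [ext_smul, norm_mul, Complex.norm_real, Real.norm_of_nonneg hx]

/-- The scaling factor of the radial retraction onto the ball `ell b ≤ r`. -/
noncomputable def scale (r : ℝ) (b : Fin N → ℂ) : ℝ := r / max r (ell b)

lemma scale_nonneg {r : ℝ} (hr : 0 ≤ r) (b : Fin N → ℂ) : 0 ≤ scale r b :=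
  div_nonneg hr (hr.trans (le_max_left _ _))

lemma scale_le_one {r : ℝ} (hr : 0 ≤ r) (b : Fin N → ℂ) : scale r b ≤ 1 :=
  div_le_one_of_le₀ (le_max_left _ _) (hr.trans (le_max_left _ _))

lemma ell_scale_le {r : ℝ} (hr : 0 ≤ r) (b : Fin N → ℂ) : ell (scale r b • b) ≤ r := by
  rw [ell_smul (scale_nonneg hr b), scale, div_mul_eq_mul_div]
  exact div_le_of_le_mul₀ (hr.trans (le_max_left _ _)) hr (by gcongr; exact le_max_right _ _)

lemma scale_smul_of_le {r : ℝ} (hr : 0 ≤ r) {b : Fin N → ℂ} (h : ell b ≤ r) :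
    scale r b • b = b := by
  rcases hr.eq_or_lt with rfl | hr
  · have : b = 0 := norm_le_zero_iff.1 ((norm_le_ell b).trans h)
    rw [this, smul_zero]
  · rw [scale, max_eq_left h, div_self hr.ne', one_smul]

lemma norm_scale_sub_le {r : ℝ} (hr : 0 ≤ r) (b c : Fin N → ℂ) :
    ‖scale r b • b - scale r c • c‖ ≤ (2 * N + 2) * ‖b - c‖ := by
  rcases hr.eq_or_lt with rfl | hr
  · simp only [scale, zero_div, zero_smul, sub_self, norm_zero]; positivity
  have hb : 0 < max r (ell b) := hr.trans_le (le_max_left _ _)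
  have hc : 0 < max r (ell c) := hr.trans_le (le_max_left _ _)
  have e : scale r b • b - scale r c • c =
      scale r b • (b - c) + (scale r b - scale r c) • c := by
    rw [smul_sub, sub_smul]; abel
  have h1 : |scale r b - scale r c| * ‖c‖ ≤ (2 * N + 1) * ‖b - c‖ := by
    have e2 : scale r b - scale r c =
        scale r b * ((max r (ell c) - max r (ell b)) / max r (ell c)) := by
      unfold scale; field_simp
    rw [e2, abs_mul, abs_of_nonneg (scale_nonneg hr.le b), abs_div, abs_of_pos hc]
    have h3 : |max r (ell c) - max r (ell b)| ≤ (2 * N + 1) * ‖b - c‖ := by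
      refine (abs_max_sub_max_le_max _ _ _ _).trans ?_
      rw [sub_self, abs_zero, max_eq_right (abs_nonneg _), abs_sub_comm]
      exact abs_ell_sub_le b c
    have h4 : ‖c‖ ≤ max r (ell c) := (norm_le_ell c).trans (le_max_right _ _)
    calc scale r b * (|max r (ell c) - max r (ell b)| / max r (ell c)) * ‖c‖
        ≤ 1 * (|max r (ell c) - max r (ell b)| / max r (ell c)) * max r (ell c) := by
          gcongr
          exact scale_le_one hr.le b
      _ = |max r (ell c) - max r (ell b)| := by field_simp
      _ ≤ _ := h3
  rw [e]
  refine (norm_add_le _ _).trans ?_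
  rw [norm_smul, norm_smul, Real.norm_of_nonneg (scale_nonneg hr.le b), Real.norm_eq_abs]
  have := mul_le_mul_of_nonneg_right (scale_le_one hr.le b) (norm_nonneg (b - c))
  linarith

/-- The coefficients `e^{-δ t |k|} b k`: the unknowns of the Galerkin system are
`b k = e^{δ t |k|} û(t, k)`. -/
noncomputable def damp (δ t : ℝ) (b : ℤ → ℂ) (k : ℤ) : ℂ := Real.exp (-(δ * t * |(k : ℝ)|)) * b k

lemma norm_damp (δ t : ℝ) (b : ℤ → ℂ) (k : ℤ) :
    ‖damp δ t b k‖ = Real.exp (-(δ * t * |(k : ℝ)|)) * ‖b k‖ := by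
  rw [damp, norm_mul, Complex.norm_real, Real.norm_of_nonneg (Real.exp_pos _).le]

lemma norm_damp_le {δ t : ℝ} (h : 0 ≤ δ * t) (b : ℤ → ℂ) (k : ℤ) : ‖damp δ t b k‖ ≤ ‖b k‖ := by
  rw [norm_damp]
  refine mul_le_of_le_one_left (norm_nonneg _) (Real.exp_le_one_iff.2 ?_)
  have := mul_nonneg h (abs_nonneg (k : ℝ))
  linarith

lemma IsHerm.damp {b : ℤ → ℂ} (h : IsHerm b) (δ t : ℝ) : IsHerm (damp δ t b) := by
  intro k
  simp only [DLSS.damp, h k, map_mul, Complex.conj_ofReal]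
  simp

lemma summable_of_support {α : Type*} [NormedAddCommGroup α] {g : ℤ → α}
    (h : ∀ k, k ∉ Finset.Icc (-N : ℤ) N → g k = 0) : Summable g :=
  summable_of_ne_finset_zero (s := Finset.Icc (-N : ℤ) N) fun k hk => h k hk

lemma damp_ext_eq_zero (δ t : ℝ) (b : Fin N → ℂ) {k : ℤ} (hk : k ∉ Finset.Icc (-N : ℤ) N) :
    damp δ t (ext b) k = 0 := by
  simp [damp, ext_eq_zero b hk]

lemma summable_damp_ext (δ t : ℝ) (b : Fin N → ℂ) : Summable fun k => ‖damp δ t (ext b) k‖ :=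
  summable_of_support (N := N) fun k hk => by simp [damp_ext_eq_zero δ t b hk]

lemma summable_D_damp_ext (δ t : ℝ) (b : Fin N → ℂ) :
    Summable fun k => ‖D (damp δ t (ext b)) k‖ :=
  summable_of_support (N := N) fun k hk => by simp [D, damp_ext_eq_zero δ t b hk]

lemma tsum_damp_ext_le {δ t : ℝ} (h : 0 ≤ δ * t) (b : Fin N → ℂ) :
    ∑' k, ‖damp δ t (ext b) k‖ ≤ ell b := by
  rw [tsum_eq_sum (s := Finset.Icc (-N : ℤ) N)
    fun k hk => by simp [damp_ext_eq_zero δ t b hk]]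
  exact Finset.sum_le_sum fun k _ => norm_damp_le h _ k

lemma tsum_D_damp_ext_le {δ t : ℝ} (h : 0 ≤ δ * t) (b : Fin N → ℂ) :
    ∑' k, ‖D (damp δ t (ext b)) k‖ ≤ N * ell b := by
  rw [tsum_eq_sum (s := Finset.Icc (-N : ℤ) N)
    fun k hk => by simp [D, damp_ext_eq_zero δ t b hk], ell, Finset.mul_sum]
  refine Finset.sum_le_sum fun k hk => ?_
  rw [norm_D]
  have : |(k : ℝ)| ≤ N := by
    rw [Finset.mem_Icc] at hk
    rw [abs_le]; exact ⟨by exact_mod_cast hk.1, by exact_mod_cast hk.2⟩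
  gcongr
  exact norm_damp_le h _ k

lemma damp_ext_sub (δ t : ℝ) (b c : Fin N → ℂ) (k : ℤ) :
    damp δ t (ext b) k - damp δ t (ext c) k = damp δ t (ext (b - c)) k := by
  simp only [damp, ext_sub]; ring

/-- The right-hand side of the Galerkin system for `b k = e^{δ t |k|} û(t, k)`, before the
retraction. The growing weight contributes the term `δ |k|`. -/
noncomputable def galerkinField (ν κ δ : ℝ) (t : ℝ) (b : Fin N → ℂ) (k : ℤ) : ℂ :=
  (linSymbol ν κ k + δ * |(k : ℝ)|) * ext b k -
    quadSymbol ν κ k * (Real.exp (δ * t * |(k : ℝ)|) * qcoeff (damp δ t (ext b)) k)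

/-- The Galerkin vector field, composed with the radial retraction onto the ball `ell b ≤ r`, which
makes it bounded and Lipschitz. -/
noncomputable def galerkinRhs (ν κ δ r : ℝ) (t : ℝ) (b : Fin N → ℂ) : Fin N → ℂ :=
  fun j => galerkinField ν κ δ t (scale r b • b) ((j : ℤ) + 1)

lemma galerkinField_lipschitz {ν κ δ T r : ℝ} (hδ : 0 ≤ δ) (hr : 0 ≤ r) (hr1 : r < 1) (k : ℤ) :
    ∃ K : ℝ, 0 ≤ K ∧ ∀ t ∈ Icc 0 T, ∀ b c : Fin N → ℂ, ell b ≤ r → ell c ≤ r →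
      ‖galerkinField ν κ δ t b k - galerkinField ν κ δ t c k‖ ≤ K * ‖b - c‖ := by
  have hz : 0 < 1 - r := by linarith
  refine ⟨‖linSymbol ν κ k + δ * |(k : ℝ)|‖ + ‖quadSymbol ν κ k‖ * (Real.exp (δ * T * |(k : ℝ)|) *
    (2 * (N * r) / (1 - r) * (N * (2 * N + 1)) + (N * r) ^ 2 / (1 - r) ^ 2 * (2 * N + 1))),
    by positivity, ?_⟩
  intro t ht b c hb hc
  have hδt : 0 ≤ δ * t := mul_nonneg hδ ht.1
  have hq := norm_qcoeff_sub_le (summable_damp_ext δ t b) (summable_D_damp_ext δ t b)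
    (summable_damp_ext δ t c) (summable_D_damp_ext δ t c) hr1
    ((tsum_damp_ext_le hδt b).trans hb) ((tsum_damp_ext_le hδt c).trans hc)
    ((tsum_D_damp_ext_le hδt b).trans (by gcongr : _ ≤ N * r))
    ((tsum_D_damp_ext_le hδt c).trans (by gcongr : _ ≤ N * r)) k
  have e1 : ∑' k, ‖damp δ t (ext b) k - damp δ t (ext c) k‖ ≤ (2 * N + 1) * ‖b - c‖ := by
    simp_rw [damp_ext_sub]
    exact (tsum_damp_ext_le hδt _).trans (ell_le _)
  have e2 : ∑' k, ‖D (damp δ t (ext b)) k - D (damp δ t (ext c)) k‖ ≤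
      N * ((2 * N + 1) * ‖b - c‖) := by
    have : ∀ k, D (damp δ t (ext b)) k - D (damp δ t (ext c)) k = D (damp δ t (ext (b - c))) k := by
      intro k
      rw [D, D, D, ← damp_ext_sub]; ring
    simp_rw [this]
    refine (tsum_D_damp_ext_le hδt _).trans ?_
    gcongr
    exact ell_le _
  have hq' : ‖qcoeff (damp δ t (ext b)) k - qcoeff (damp δ t (ext c)) k‖ ≤
      (2 * (N * r) / (1 - r) * (N * (2 * N + 1)) + (N * r) ^ 2 / (1 - r) ^ 2 * (2 * N + 1)) *
        ‖b - c‖ := by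
    refine hq.trans ?_
    calc _ ≤ 2 * (N * r) / (1 - r) * (N * ((2 * N + 1) * ‖b - c‖)) +
        (N * r) ^ 2 / (1 - r) ^ 2 * ((2 * N + 1) * ‖b - c‖) := by gcongr
      _ = _ := by ring
  have e3 : galerkinField ν κ δ t b k - galerkinField ν κ δ t c k =
      (linSymbol ν κ k + δ * |(k : ℝ)|) * ext (b - c) k -
      quadSymbol ν κ k * (Real.exp (δ * t * |(k : ℝ)|) *
        (qcoeff (damp δ t (ext b)) k - qcoeff (damp δ t (ext c)) k)) := by
    simp only [galerkinField, ext_sub]; ring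
  rw [e3]
  refine (norm_sub_le _ _).trans ?_
  rw [norm_mul, norm_mul, norm_mul, Complex.norm_real, Real.norm_of_nonneg (Real.exp_pos _).le]
  calc _ ≤ ‖linSymbol ν κ k + δ * |(k : ℝ)|‖ * ‖b - c‖ + ‖quadSymbol ν κ k‖ *
        (Real.exp (δ * T * |(k : ℝ)|) * ((2 * (N * r) / (1 - r) * (N * (2 * N + 1)) +
          (N * r) ^ 2 / (1 - r) ^ 2 * (2 * N + 1)) * ‖b - c‖)) := by
        gcongr
        · exact norm_ext_le _ _
        · exact ht.2
    _ = _ := by ring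

lemma galerkinField_continuousOn {ν κ δ T r : ℝ} (hδ : 0 ≤ δ) (hr1 : r < 1) (k : ℤ)
    {b : Fin N → ℂ} (hb : ell b ≤ r) :
    ContinuousOn (fun t => galerkinField ν κ δ t b k) (Icc 0 T) := by
  have hz : 0 < 1 - r := by linarith
  have hq : ContinuousOn (fun t => qcoeff (damp δ t (ext b)) k) (Icc 0 T) := by
    intro t ht
    rw [ContinuousWithinAt, tendsto_iff_norm_sub_tendsto_zero]
    have hd : ∀ k, Continuous fun s => damp δ s (ext b) k := fun k => by
      unfold damp; fun_prop
    have hlim : Filter.Tendsto (fun s => 2 * (N * r) / (1 - r) * (∑ k ∈ Finset.Icc (-N : ℤ) N,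
        ‖D (damp δ s (ext b)) k - D (damp δ t (ext b)) k‖) + (N * r) ^ 2 / (1 - r) ^ 2 *
        ∑ k ∈ Finset.Icc (-N : ℤ) N, ‖damp δ s (ext b) k - damp δ t (ext b) k‖)
        (nhdsWithin t (Icc 0 T)) (nhds 0) := by
      have hc : Continuous (fun s => 2 * (N * r) / (1 - r) * (∑ k ∈ Finset.Icc (-N : ℤ) N,
        ‖D (damp δ s (ext b)) k - D (damp δ t (ext b)) k‖) + (N * r) ^ 2 / (1 - r) ^ 2 *
        ∑ k ∈ Finset.Icc (-N : ℤ) N, ‖damp δ s (ext b) k - damp δ t (ext b) k‖) := by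
        unfold D; fun_prop
      have := (hc.tendsto t).mono_left (nhdsWithin_le_nhds (s := Icc 0 T))
      simpa using this
    refine squeeze_zero' (Filter.Eventually.of_forall fun s => norm_nonneg _) ?_ hlim
    filter_upwards [self_mem_nhdsWithin] with s hs
    have hδt : 0 ≤ δ * t := mul_nonneg hδ ht.1
    have hδs : 0 ≤ δ * s := mul_nonneg hδ hs.1
    have := norm_qcoeff_sub_le (summable_damp_ext δ s b) (summable_D_damp_ext δ s b)
      (summable_damp_ext δ t b) (summable_D_damp_ext δ t b) hr1
      ((tsum_damp_ext_le hδs b).trans hb) ((tsum_damp_ext_le hδt b).trans hb)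
      ((tsum_D_damp_ext_le hδs b).trans (by gcongr : _ ≤ N * r))
      ((tsum_D_damp_ext_le hδt b).trans (by gcongr : _ ≤ N * r)) k
    rwa [tsum_eq_sum (s := Finset.Icc (-N : ℤ) N), tsum_eq_sum (s := Finset.Icc (-N : ℤ) N)] at this
    · intro k hk; simp [damp_ext_eq_zero _ _ b hk]
    · intro k hk; simp [D, damp_ext_eq_zero _ _ b hk]
  unfold galerkinField
  fun_prop

lemma norm_galerkinField_le {ν κ δ T r : ℝ} (hδ : 0 ≤ δ) (hr1 : r < 1) (hr : 0 ≤ r) (k : ℤ) :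
    ∃ K : ℝ, 0 ≤ K ∧ ∀ t ∈ Icc 0 T, ∀ b : Fin N → ℂ, ell b ≤ r →
      ‖galerkinField ν κ δ t b k‖ ≤ K := by
  have hz : 0 < 1 - r := by linarith
  obtain ⟨K, hK, h⟩ := galerkinField_lipschitz (N := N) (ν := ν) (κ := κ) (T := T) hδ hr hr1 k
  have h0 : ell (0 : Fin N → ℂ) ≤ r := by
    have := ell_le (0 : Fin N → ℂ); rw [norm_zero, mul_zero] at this; linarith
  have hz0 : ∀ t, galerkinField ν κ δ t (0 : Fin N → ℂ) k = 0 := by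
    intro t
    have e : ext (0 : Fin N → ℂ) = fun _ => 0 := by funext k; simp [ext]
    simp [galerkinField, e, qcoeff, fourierCoeff, qfun, damp, D, synth]
  refine ⟨K * r, by positivity, fun t ht b hb => ?_⟩
  have := h t ht b 0 hb h0
  rw [hz0, sub_zero, sub_zero] at this
  exact this.trans (by gcongr; exact (norm_le_ell b).trans hb)

end Ext

/-! ### The a priori estimate for the Galerkin system -/

section Galerkin

variable {N : ℕ}

lemma exists_uniform_bound {P : Fin N → ℝ → Prop} (hmono : ∀ j K K', K ≤ K' → P j K → P j K')
    (h : ∀ j, ∃ K, 0 ≤ K ∧ P j K) : ∃ K, 0 ≤ K ∧ ∀ j, P j K := by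
  choose K hK0 hK using h
  exact ⟨∑ j, K j, Finset.sum_nonneg fun j _ => hK0 j, fun j => hmono j _ _
    (Finset.single_le_sum (fun i _ => hK0 i) (Finset.mem_univ j)) (hK j)⟩

/-- The truncated field is bounded and Lipschitz, so the Picard–Lindelöf theorem gives a solution on
the whole of `[0, T]`. -/
lemma exists_galerkin_curve {ν κ δ T r : ℝ} (hδ : 0 ≤ δ) (hT : 0 ≤ T) (hr : 0 ≤ r) (hr1 : r < 1)
    (x₀ : Fin N → ℂ) : ∃ α : ℝ → Fin N → ℂ, α 0 = x₀ ∧ ∀ t ∈ Icc 0 T,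
      HasDerivWithinAt α (galerkinRhs ν κ δ r t (α t)) (Icc 0 T) t := by
  obtain ⟨K, hK0, hK⟩ := exists_uniform_bound (N := N)
    (P := fun j K => ∀ t ∈ Icc 0 T, ∀ b c : Fin N → ℂ, ell b ≤ r → ell c ≤ r →
      ‖galerkinField ν κ δ t b ((j : ℤ) + 1) - galerkinField ν κ δ t c ((j : ℤ) + 1)‖ ≤
        K * ‖b - c‖)
    (fun j K K' h hP t ht b c hb hc => (hP t ht b c hb hc).trans (by gcongr))
    (fun j => galerkinField_lipschitz hδ hr hr1 _)
  obtain ⟨L, hL0, hL⟩ := exists_uniform_bound (N := N)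
    (P := fun j K => ∀ t ∈ Icc 0 T, ∀ b : Fin N → ℂ, ell b ≤ r →
      ‖galerkinField ν κ δ t b ((j : ℤ) + 1)‖ ≤ K)
    (fun j K K' h hP t ht b hb => (hP t ht b hb).trans h)
    (fun j => norm_galerkinField_le hδ hr1 hr _)
  have hPL : IsPicardLindelof (galerkinRhs (N := N) ν κ δ r) (tmin := 0) (tmax := T)
      ⟨0, le_refl 0, hT⟩ x₀ (L * T).toNNReal 0 L.toNNReal (K * (2 * N + 2)).toNNReal := by
    refine ⟨fun t ht => ?_, fun x _ => ?_, fun t ht x _ => ?_, ?_⟩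
    · refine (LipschitzWith.of_dist_le' fun b c => ?_).lipschitzOnWith
      rw [dist_eq_norm, dist_eq_norm, pi_norm_le_iff_of_nonneg (by positivity)]
      intro j
      refine (hK j t ht _ _ (ell_scale_le hr b) (ell_scale_le hr c)).trans ?_
      rw [mul_assoc]
      gcongr
      exact norm_scale_sub_le hr b c
    · exact continuousOn_pi.2 fun j => galerkinField_continuousOn hδ hr1 _ (ell_scale_le hr x)
    · rw [Real.coe_toNNReal _ hL0, pi_norm_le_iff_of_nonneg hL0]
      exact fun j => hL j t ht _ (ell_scale_le hr x)
    · rw [Real.coe_toNNReal _ hL0, Real.coe_toNNReal _ (by positivity)]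
      simp [hT]
  exact hPL.exists_eq_forall_mem_Icc_hasDerivWithinAt₀

lemma galerkinField_neg (ν κ δ t : ℝ) (b : Fin N → ℂ) (k : ℤ) :
    galerkinField ν κ δ t b (-k) = starRingEnd ℂ (galerkinField ν κ δ t b k) := by
  simp only [galerkinField, map_sub, map_mul, map_add, Complex.conj_ofReal]
  rw [linSymbol_neg, quadSymbol_neg, isHerm_ext b k, ((isHerm_ext b).damp δ t).qcoeff k]
  simp

/-- The components of a solution of the Galerkin system, for positive and negative frequencies. -/
lemma hasDerivWithinAt_ext {ν κ δ r : ℝ} {s : Set ℝ} {α : ℝ → Fin N → ℂ} {t : ℝ}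
    (h : HasDerivWithinAt α (galerkinRhs ν κ δ r t (α t)) s t) {k : ℤ} (hk0 : k ≠ 0)
    (hk : k ∈ Finset.Icc (-N : ℤ) N) :
    HasDerivWithinAt (fun t => ext (α t) k)
      (galerkinField ν κ δ t (scale r (α t) • α t) k) s t := by
  rw [Finset.mem_Icc] at hk
  have hpos : ∀ j : Fin N, HasDerivWithinAt (fun t => ext (α t) ((j : ℤ) + 1))
      (galerkinField ν κ δ t (scale r (α t) • α t) ((j : ℤ) + 1)) s t := by
    intro j
    simp only [ext_succ]
    exact (hasDerivWithinAt_pi.1 h) j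
  rcases lt_or_gt_of_ne hk0 with hneg | hpos'
  · obtain ⟨j, hj⟩ : ∃ j : Fin N, k = -((j : ℤ) + 1) :=
      ⟨⟨k.natAbs - 1, by omega⟩, by simp only []; omega⟩
    rw [hj, galerkinField_neg]
    have e : (fun t => ext (α t) (-((j : ℤ) + 1))) =
        fun t => starRingEnd ℂ (ext (α t) ((j : ℤ) + 1)) := funext fun t => isHerm_ext _ _
    rw [e]
    exact (hpos j).star
  · obtain ⟨j, hj⟩ : ∃ j : Fin N, k = (j : ℤ) + 1 :=
      ⟨⟨k.natAbs - 1, by omega⟩, by simp only []; omega⟩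
    rw [hj]
    exact hpos j

lemma emom_damp (δ t : ℝ) (s : ℕ) (b : Fin N → ℂ) :
    emom (δ * t) s (damp δ t (ext b)) =
      ENNReal.ofReal (∑ k ∈ Finset.Icc (-N : ℤ) N, |(k : ℝ)| ^ s * ‖ext b k‖) := by
  unfold emom
  rw [tsum_eq_sum (s := Finset.Icc (-N : ℤ) N)
    fun k hk => by simp [damp_ext_eq_zero δ t b hk],
    ENNReal.ofReal_sum_of_nonneg (fun k _ => by positivity)]
  refine Finset.sum_congr rfl fun k _ => ?_
  rw [wt, ← ofReal_norm, norm_damp, ← ENNReal.ofReal_mul (by positivity)]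
  congr 1
  rw [Real.exp_neg]
  field_simp

/-- The nonlinear term of the Galerkin system is controlled by the fourth moment. -/
lemma sum_quad_le {ν κ δ t r : ℝ} (hν : 0 ≤ ν) (hδt : 0 ≤ δ * t) (hr : 0 ≤ r) (hr1 : r < 1)
    {b : Fin N → ℂ} (hb : ell b ≤ r) :
    ∑ k ∈ Finset.Icc (-N : ℤ) N, ‖quadSymbol ν κ k *
      (Real.exp (δ * t * |(k : ℝ)|) * qcoeff (damp δ t (ext b)) k)‖ ≤
    (|κ| * P₂ r + ν * P₁ r) * ∑ k ∈ Finset.Icc (-N : ℤ) N, |(k : ℝ)| ^ 4 * ‖ext b k‖ := by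
  have h0 : emom (δ * t) 0 (damp δ t (ext b)) ≤ ENNReal.ofReal r := by
    rw [emom_damp]
    apply ENNReal.ofReal_le_ofReal
    simpa [ell] using hb
  obtain ⟨-, h1, h2⟩ := emom_qcoeff_le hδt hr hr1 ((isHerm_ext b).damp δ t).enorm h0
    (by rw [emom_damp]; exact ENNReal.ofReal_ne_top)
  have hz' : 0 < 1 - r := by linarith
  have pP2 : 0 ≤ P₂ r := by unfold P₂; positivity
  have pP1 : 0 ≤ P₁ r := by unfold P₁; positivity
  set M := ∑ k ∈ Finset.Icc (-N : ℤ) N, |(k : ℝ)| ^ 4 * ‖ext b k‖ with hM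
  have hM0 : 0 ≤ M := Finset.sum_nonneg fun k _ => by positivity
  have hfin : ∀ s : ℕ, ∀ P : ℝ, 0 ≤ P →
      emom (δ * t) s (qcoeff (damp δ t (ext b))) ≤ ENNReal.ofReal P *
        emom (δ * t) 4 (damp δ t (ext b)) →
      ∑ k ∈ Finset.Icc (-N : ℤ) N, |(k : ℝ)| ^ s * Real.exp (δ * t * |(k : ℝ)|) *
        ‖qcoeff (damp δ t (ext b)) k‖ ≤ P * M := by
    intro s P hP h
    rw [emom_damp, ← hM, ← ENNReal.ofReal_mul hP] at h
    rw [← ENNReal.ofReal_le_ofReal_iff (by positivity)]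
    refine le_trans ?_ h
    rw [ENNReal.ofReal_sum_of_nonneg (fun k _ => by positivity)]
    refine le_trans (le_of_eq ?_) (ENNReal.sum_le_tsum (Finset.Icc (-N : ℤ) N))
    refine Finset.sum_congr rfl fun k _ => ?_
    rw [ENNReal.ofReal_mul (by positivity), ofReal_norm, wt]
  have g1 := hfin 1 _ pP2 h1
  have g2 := hfin 2 _ pP1 h2
  calc _ ≤ ∑ k ∈ Finset.Icc (-N : ℤ) N, (|κ| * (|(k : ℝ)| ^ 1 * Real.exp (δ * t * |(k : ℝ)|) *
        ‖qcoeff (damp δ t (ext b)) k‖) + ν * (|(k : ℝ)| ^ 2 * Real.exp (δ * t * |(k : ℝ)|) *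
        ‖qcoeff (damp δ t (ext b)) k‖)) := by
        refine Finset.sum_le_sum fun k _ => ?_
        rw [norm_mul, norm_mul, Complex.norm_real, Real.norm_of_nonneg (Real.exp_pos _).le]
        calc _ ≤ (|κ| * |(k : ℝ)| + ν * |(k : ℝ)| ^ 2) * (Real.exp (δ * t * |(k : ℝ)|) *
              ‖qcoeff (damp δ t (ext b)) k‖) := by gcongr; exact norm_quadSymbol_le hν κ k
          _ = _ := by ring
    _ ≤ |κ| * (P₂ r * M) + ν * (P₁ r * M) := by
        rw [Finset.sum_add_distrib, ← Finset.mul_sum, ← Finset.mul_sum]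
        gcongr
    _ = _ := by ring

lemma continuous_ext (k : ℤ) : Continuous fun b : Fin N → ℂ => ext b k := by
  unfold ext
  split_ifs <;> fun_prop

lemma continuous_scale {r : ℝ} (hr : 0 < r) : Continuous fun b : Fin N → ℂ => scale r b := by
  unfold scale
  have h1 : Continuous fun b : Fin N → ℂ => ell b := by
    unfold ell
    exact continuous_finsetSum _ fun k _ => (continuous_ext k).norm
  exact continuous_const.div (continuous_const.max h1)
    fun b => (hr.trans_le (le_max_left _ _)).ne'

/-- The a priori estimate for the Galerkin system. The dissipation contributes `-ν |k|⁴` and the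
weight `δ |k|`, while the nonlinear term costs `(|κ| P₂(r) + ν P₁(r)) |k|⁴`; by the choice of `δ` the
net gain is `δ (|k|⁴ - |k|) ≥ 0`. The retraction multiplies gain and cost by the same factor
`scale r`, so that the estimate survives it and shows a posteriori that it is never active. -/
lemma galerkin_apriori {ν κ δ r T : ℝ} (hν : 0 ≤ ν) (hδ : 0 < δ) (hr : 0 < r) (hr1 : r < 1)
    (hrate : δ = ν - |κ| * P₂ r - ν * P₁ r) {α : ℝ → Fin N → ℂ} (h0 : ell (α 0) ≤ r)
    (hα : ∀ t ∈ Icc 0 T, HasDerivWithinAt α (galerkinRhs ν κ δ r t (α t)) (Icc 0 T) t)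
    {t : ℝ} (ht : t ∈ Icc 0 T) :
    ell (α t) + δ * ∫ s in (0 : ℝ)..t, scale r (α s) *
      ∑ k ∈ Finset.Icc (-N : ℤ) N, (|(k : ℝ)| ^ 4 - |(k : ℝ)|) * ‖ext (α s) k‖ ≤ r := by
  have hz' : 0 < 1 - r := by linarith
  have pP2 : 0 ≤ P₂ r := by unfold P₂; positivity
  have pP1 : 0 ≤ P₁ r := by unfold P₁; positivity
  have hδν : δ ≤ ν := by
    have := mul_nonneg (abs_nonneg κ) pP2
    have := mul_nonneg hν pP1
    linarith
  have hαc : ContinuousOn α (Icc 0 T) := fun t ht => (hα t ht).continuousWithinAt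
  have hθc : ContinuousOn (fun t => scale r (α t)) (Icc 0 T) :=
    (continuous_scale hr).comp_continuousOn hαc
  have hec : ∀ k, ContinuousOn (fun t => ext (α t) k) (Icc 0 T) := fun k =>
    (continuous_ext k).comp_continuousOn hαc
  set F : ℤ → ℝ → ℝ := fun k t => ‖quadSymbol ν κ k * (Real.exp (δ * t * |(k : ℝ)|) *
    qcoeff (damp δ t (ext (scale r (α t) • α t))) k)‖ with hF
  have hk4 : ∀ k : ℤ, |(k : ℝ)| ≤ |(k : ℝ)| ^ 4 := by
    intro k
    rcases eq_or_ne k 0 with rfl | hk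
    · simp
    · have : (1 : ℝ) ≤ |(k : ℝ)| := by exact_mod_cast Int.one_le_abs hk
      exact le_self_pow₀ this (by norm_num)
  have hkk : ∀ k : ℤ, 0 ≤ ν * |(k : ℝ)| ^ 4 - δ * |(k : ℝ)| := by
    intro k
    have h1 := mul_le_mul_of_nonneg_left (hk4 k) hδ.le
    have h2 := mul_le_mul_of_nonneg_right hδν (by positivity : 0 ≤ |(k : ℝ)| ^ 4)
    linarith
  have hFc : ∀ k ∈ Finset.Icc (-N : ℤ) N, k ≠ 0 → ContinuousOn (F k) (Icc 0 T) := by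
    intro k hk hk0
    have h1 : ContinuousOn (fun p : ℝ × (Fin N → ℂ) => galerkinField ν κ δ p.1 p.2 k)
        (Icc 0 T ×ˢ {b | ell b ≤ r}) := by
      obtain ⟨K, hK, hl⟩ := galerkinField_lipschitz (N := N) (ν := ν) (κ := κ) (T := T)
        hδ.le hr.le hr1 k
      refine continuousOn_prod_of_continuousOn_lipschitzOnWith' _ K.toNNReal (fun t ht => ?_)
        (fun b hb => galerkinField_continuousOn hδ.le hr1 k hb)
      refine LipschitzOnWith.of_dist_le' fun b hb c hc => ?_
      rw [dist_eq_norm, dist_eq_norm]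
      exact hl t ht b c hb hc
    have h2 : ContinuousOn (fun t => galerkinField ν κ δ t (scale r (α t) • α t) k) (Icc 0 T) :=
      h1.comp (f := fun t => (t, scale r (α t) • α t)) (by fun_prop)
        fun t ht => ⟨ht, ell_scale_le hr.le _⟩
    have h3 : ContinuousOn (fun t => ext (scale r (α t) • α t) k) (Icc 0 T) := by
      simp only [ext_smul]
      fun_prop
    have e : F k = fun t => ‖(linSymbol ν κ k + δ * |(k : ℝ)|) *
        ext (scale r (α t) • α t) k - galerkinField ν κ δ t (scale r (α t) • α t) k‖ := by
      funext t
      rw [hF, galerkinField, sub_sub_cancel]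
    rw [e]
    fun_prop
  have hmode : ∀ k ∈ Finset.Icc (-N : ℤ) N,
      ‖ext (α t) k‖ + ∫ s in (0 : ℝ)..t, scale r (α s) *
        (ν * |(k : ℝ)| ^ 4 - δ * |(k : ℝ)|) * ‖ext (α s) k‖ ≤
      ‖ext (α 0) k‖ + ∫ s in (0 : ℝ)..t, F k s := by
    intro k hk
    by_cases hk0 : k = 0
    · subst hk0
      have : 0 ≤ ∫ s in (0 : ℝ)..t, F 0 s :=
        intervalIntegral.integral_nonneg ht.1 fun s _ => norm_nonneg _
      simpa [ext_zero_index] using this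
    refine norm_add_integral_le (b := fun t => ext (α t) k)
      (fun t ht => hasDerivWithinAt_ext (hα t ht) hk0 hk) (by fun_prop) (hFc k hk hk0)
      (fun t _ => mul_nonneg (scale_nonneg hr.le _) (hkk k)) (fun t _ => norm_nonneg _)
      (fun t _ => ?_) ht
    rw [galerkinField, inner_sub_right, ext_smul]
    -- the dispersive part of the symbol is imaginary and drops out
    have e1 : inner ℝ (ext (α t) k) ((linSymbol ν κ k + δ * |(k : ℝ)|) *
        (scale r (α t) * ext (α t) k)) =
        -(scale r (α t) * (ν * |(k : ℝ)| ^ 4 - δ * |(k : ℝ)|)) * ‖ext (α t) k‖ ^ 2 := by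
      have hre := linSymbol_re ν κ k
      have e2 : ((linSymbol ν κ k + δ * |(k : ℝ)|) *
        (scale r (α t) * ext (α t) k)) * starRingEnd ℂ (ext (α t) k) =
        ((scale r (α t) * ‖ext (α t) k‖ ^ 2 : ℝ) : ℂ) * (linSymbol ν κ k + δ * |(k : ℝ)|) := by
        have := Complex.mul_conj' (ext (α t) k)
        push_cast
        rw [← this]; ring
      rw [Complex.inner, e2, Complex.re_ofReal_mul, Complex.add_re, hre]
      rw [← Complex.ofReal_mul, Complex.ofReal_re, Even.pow_abs (by decide)]
      ring
    rw [e1]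
    have e3 := neg_le_of_abs_le (abs_real_inner_le_norm (ext (α t) k) (quadSymbol ν κ k *
      (Real.exp (δ * t * |(k : ℝ)|) * qcoeff (damp δ t (ext (scale r (α t) • α t))) k)))
    rw [hF]
    simp only
    linarith
  have hsum := Finset.sum_le_sum hmode
  rw [Finset.sum_add_distrib, Finset.sum_add_distrib] at hsum
  have hsub : Icc 0 t ⊆ Icc 0 T := Icc_subset_Icc_right ht.2
  have hci : ∀ {g : ℝ → ℝ}, ContinuousOn g (Icc 0 T) → IntervalIntegrable g volume 0 t :=
    fun hg => (hg.mono hsub).intervalIntegrable_of_Icc ht.1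
  have hFc' : ∀ k ∈ Finset.Icc (-N : ℤ) N, ContinuousOn (F k) (Icc 0 T) := by
    intro k hk
    by_cases hk0 : k = 0
    · subst hk0
      have : F 0 = fun _ => 0 := by funext t; simp [hF, quadSymbol]
      rw [this]; exact continuousOn_const
    · exact hFc k hk hk0
  rw [← intervalIntegral.integral_finsetSum (fun k hk => hci (by fun_prop)),
    ← intervalIntegral.integral_finsetSum (fun k hk => hci (hFc' k hk))] at hsum
  have hle : ∫ s in (0 : ℝ)..t, ∑ k ∈ Finset.Icc (-N : ℤ) N, F k s ≤
      ∫ s in (0 : ℝ)..t, (|κ| * P₂ r + ν * P₁ r) * (scale r (α s) *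
        ∑ k ∈ Finset.Icc (-N : ℤ) N, |(k : ℝ)| ^ 4 * ‖ext (α s) k‖) := by
    refine intervalIntegral.integral_mono_on ht.1 (hci ?_) (hci (by fun_prop)) fun s hs => ?_
    · exact continuousOn_finsetSum _ hFc'
    · refine (sum_quad_le hν (mul_nonneg hδ.le hs.1) hr.le hr1
        (ell_scale_le hr.le (α s))).trans (le_of_eq ?_)
      congr 1
      rw [Finset.mul_sum]
      refine Finset.sum_congr rfl fun k _ => ?_
      rw [ext_smul, norm_mul, Complex.norm_real, Real.norm_of_nonneg (scale_nonneg hr.le _)]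
      ring
  have hfinal : ∫ s in (0 : ℝ)..t, ∑ k ∈ Finset.Icc (-N : ℤ) N, scale r (α s) *
        (ν * |(k : ℝ)| ^ 4 - δ * |(k : ℝ)|) * ‖ext (α s) k‖ =
      δ * (∫ s in (0 : ℝ)..t, scale r (α s) *
        ∑ k ∈ Finset.Icc (-N : ℤ) N, (|(k : ℝ)| ^ 4 - |(k : ℝ)|) * ‖ext (α s) k‖) +
      ∫ s in (0 : ℝ)..t, (|κ| * P₂ r + ν * P₁ r) * (scale r (α s) *
        ∑ k ∈ Finset.Icc (-N : ℤ) N, |(k : ℝ)| ^ 4 * ‖ext (α s) k‖) := by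
    rw [← intervalIntegral.integral_const_mul, ← intervalIntegral.integral_add
      (hci (by fun_prop)) (hci (by fun_prop))]
    refine intervalIntegral.integral_congr fun s _ => ?_
    rw [Finset.mul_sum, Finset.mul_sum, Finset.mul_sum, Finset.mul_sum,
      ← Finset.sum_add_distrib]
    refine Finset.sum_congr rfl fun k _ => ?_
    rw [hrate]; ring
  rw [hfinal] at hsum
  have : ell (α t) = ∑ k ∈ Finset.Icc (-N : ℤ) N, ‖ext (α t) k‖ := rfl
  have : ell (α 0) = ∑ k ∈ Finset.Icc (-N : ℤ) N, ‖ext (α 0) k‖ := rfl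
  linarith

end Galerkin

/-! ### Galerkin approximations -/

/-- The right-hand side of the equation on the Fourier side, for the frequency `k`. -/
noncomputable def fourierField (ν κ : ℝ) (a : ℤ → ℂ) (k : ℤ) : ℂ :=
  linSymbol ν κ k * a k - quadSymbol ν κ k * qcoeff a k

/-- `c` solves the Galerkin system of degree `N` on `[0, T]` with initial coefficients `a₀`, and
obeys the a priori bounds, which do not depend on `N`. -/
structure IsGalerkin (ν κ δ r : ℝ) (N : ℕ) (T : ℝ) (a₀ : ℤ → ℂ) (c : ℝ → ℤ → ℂ) : Prop where
  herm : ∀ t, IsHerm (c t)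
  support : ∀ t, ∀ k ∉ Finset.Icc (-N : ℤ) N, c t k = 0
  zero : ∀ t, c t 0 = 0
  init : ∀ k ∈ Finset.Icc (-N : ℤ) N, c 0 k = a₀ k
  bound : ∀ t ∈ Icc 0 T, ∀ F : Finset ℤ, ∑ k ∈ F, Real.exp (δ * t * |(k : ℝ)|) * ‖c t k‖ ≤ r
  deriv : ∀ t ∈ Icc 0 T, ∀ k ∈ Finset.Icc (-N : ℤ) N,
    HasDerivWithinAt (fun t => c t k) (fourierField ν κ (c t) k) (Icc 0 T) t
  int : ∀ t ∈ Icc 0 T, ∀ F : Finset ℤ,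
    ∫ s in (0 : ℝ)..t, ∑ k ∈ F, |(k : ℝ)| ^ 4 * ‖c s k‖ ≤ 2 * r / δ + r * t

/-- The a priori estimate controls the weight `|k|⁴ - |k|`, which vanishes at `|k| = 1`; adding the
zeroth moment recovers `|k|⁴`. -/
lemma pow_four_le (k : ℤ) : |(k : ℝ)| ^ 4 ≤ 2 * (|(k : ℝ)| ^ 4 - |(k : ℝ)|) + 1 := by
  have h : ∀ n : ℕ, 2 * n ≤ n ^ 4 + 1 := by
    intro n
    rcases n with _ | _ | n
    · simp
    · simp
    · have : 2 ≤ n + 2 := by omega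
      nlinarith [Nat.pow_le_pow_left this 3]
  have h1 := h k.natAbs
  have h2 : ((k.natAbs : ℕ) : ℝ) = |(k : ℝ)| := by simp [Nat.cast_natAbs]
  have h3 : 2 * |(k : ℝ)| ≤ |(k : ℝ)| ^ 4 + 1 := by rw [← h2]; exact_mod_cast h1
  linarith

/-- A curve that stays in the ball where the retraction is the identity solves the true Galerkin
system. -/
lemma isGalerkin_of_curve {ν κ δ r T : ℝ} {N : ℕ} (hδ : 0 < δ) (hr : 0 ≤ r)
    {a₀ : ℤ → ℂ} {α : ℝ → Fin N → ℂ}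
    (h0 : ∀ k ∈ Finset.Icc (-N : ℤ) N, ext (α 0) k = a₀ k)
    (hα : ∀ t ∈ Icc 0 T, HasDerivWithinAt α (galerkinRhs ν κ δ r t (α t)) (Icc 0 T) t)
    (hell : ∀ t ∈ Icc 0 T, ell (α t) ≤ r)
    (hint : ∀ t ∈ Icc 0 T, δ * ∫ s in (0 : ℝ)..t,
      ∑ k ∈ Finset.Icc (-N : ℤ) N, (|(k : ℝ)| ^ 4 - |(k : ℝ)|) * ‖ext (α s) k‖ ≤ r) :
    IsGalerkin ν κ δ r N T a₀ fun t => damp δ t (ext (α t)) where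
  herm t := (isHerm_ext _).damp δ t
  support t k hk := damp_ext_eq_zero δ t _ hk
  zero t := by simp [damp, ext_zero_index]
  init k hk := by simp [damp, h0 k hk]
  bound t ht F := by
    refine le_trans ?_ (hell t ht)
    have e : ∀ k : ℤ, Real.exp (δ * t * |(k : ℝ)|) * ‖damp δ t (ext (α t)) k‖ =
        ‖ext (α t) k‖ := by
      intro k
      rw [norm_damp, Real.exp_neg]; field_simp
    simp only [e]
    have e3 : ∑' k, ‖ext (α t) k‖ = ∑ k ∈ Finset.Icc (-N : ℤ) N, ‖ext (α t) k‖ :=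
      tsum_eq_sum fun k hk => by rw [ext_eq_zero (α t) hk, norm_zero]
    rw [ell, ← e3]
    exact (summable_of_support (N := N) fun k hk => by rw [ext_eq_zero (α t) hk, norm_zero]).sum_le_tsum F
      fun _ _ => norm_nonneg _
  deriv t ht k hk := by
    by_cases hk0 : k = 0
    · subst hk0
      have e : (fun t => damp δ t (ext (α t)) 0) = fun _ => 0 := by
        funext t; simp [damp, ext_zero_index]
      rw [e]
      have : fourierField ν κ (damp δ t (ext (α t))) 0 = 0 := by
        simp [fourierField, linSymbol, quadSymbol]
      rw [this]
      exact hasDerivWithinAt_const _ _ _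
    · have h1 := hasDerivWithinAt_ext (hα t ht) hk0 hk
      rw [scale_smul_of_le hr (hell t ht)] at h1
      have h2 : HasDerivAt (fun t => ((Real.exp (-(δ * t * |(k : ℝ)|)) : ℝ) : ℂ))
          ((Real.exp (-(δ * t * |(k : ℝ)|)) * -(δ * |(k : ℝ)|) : ℝ) : ℂ) t := by
        refine HasDerivAt.ofReal_comp (HasDerivAt.exp ?_)
        have h := (((hasDerivAt_id t).const_mul δ).mul_const |(k : ℝ)|).fun_neg
        simpa using h
      have h3 := h2.hasDerivWithinAt.mul h1
      refine h3.congr_deriv ?_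
      have e : (Real.exp (-(δ * t * |(k : ℝ)|)) : ℂ) * Real.exp (δ * t * |(k : ℝ)|) = 1 := by
        rw [← Complex.ofReal_mul, ← Real.exp_add]; simp
      simp only [fourierField, galerkinField, damp]
      push_cast at e ⊢
      linear_combination (-quadSymbol ν κ k * qcoeff (damp δ t (ext (α t))) k) * e
  int t ht F := by
    have hsub : Icc 0 t ⊆ Icc 0 T := Icc_subset_Icc_right ht.2
    have hαc : ContinuousOn α (Icc 0 t) := fun t ht => ((hα t (hsub ht)).continuousWithinAt).mono hsub
    have hec : ∀ k, ContinuousOn (fun t => ext (α t) k) (Icc 0 t) := fun k =>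
      (continuous_ext k).comp_continuousOn hαc
    have hdc : ∀ k, ContinuousOn (fun t => damp δ t (ext (α t)) k) (Icc 0 t) := fun k => by
      unfold damp; fun_prop
    have hci : ∀ {g : ℝ → ℝ}, ContinuousOn g (Icc 0 t) → IntervalIntegrable g volume 0 t :=
      fun hg => hg.intervalIntegrable_of_Icc ht.1
    have hI := hint t ht
    rw [← le_div_iff₀' hδ] at hI
    calc ∫ s in (0 : ℝ)..t, ∑ k ∈ F, |(k : ℝ)| ^ 4 * ‖damp δ s (ext (α s)) k‖
        ≤ ∫ s in (0 : ℝ)..t, (2 * (∑ k ∈ Finset.Icc (-N : ℤ) N,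
            (|(k : ℝ)| ^ 4 - |(k : ℝ)|) * ‖ext (α s) k‖) + r) := by
          refine intervalIntegral.integral_mono_on ht.1 (hci (by fun_prop)) (hci (by fun_prop))
            fun s hs => ?_
          have hδs : 0 ≤ δ * s := mul_nonneg hδ.le hs.1
          calc ∑ k ∈ F, |(k : ℝ)| ^ 4 * ‖damp δ s (ext (α s)) k‖
              ≤ ∑' k : ℤ, |(k : ℝ)| ^ 4 * ‖damp δ s (ext (α s)) k‖ :=
                (summable_of_support (N := N) fun k hk => by
                  simp [damp_ext_eq_zero δ s (α s) hk]).sum_le_tsum F fun _ _ => by positivity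
            _ = ∑ k ∈ Finset.Icc (-N : ℤ) N, |(k : ℝ)| ^ 4 * ‖damp δ s (ext (α s)) k‖ :=
                tsum_eq_sum fun k hk => by simp [damp_ext_eq_zero δ s (α s) hk]
            _ ≤ ∑ k ∈ Finset.Icc (-N : ℤ) N, (2 * ((|(k : ℝ)| ^ 4 - |(k : ℝ)|) * ‖ext (α s) k‖)
                  + ‖ext (α s) k‖) := by
                refine Finset.sum_le_sum fun k _ => ?_
                calc _ ≤ |(k : ℝ)| ^ 4 * ‖ext (α s) k‖ := by gcongr; exact norm_damp_le hδs _ k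
                  _ ≤ (2 * (|(k : ℝ)| ^ 4 - |(k : ℝ)|) + 1) * ‖ext (α s) k‖ := by
                    gcongr; exact pow_four_le k
                  _ = _ := by ring
            _ ≤ _ := by
                rw [Finset.sum_add_distrib, ← Finset.mul_sum]
                gcongr
                exact hell s (hsub hs)
      _ = 2 * (∫ s in (0 : ℝ)..t, ∑ k ∈ Finset.Icc (-N : ℤ) N,
            (|(k : ℝ)| ^ 4 - |(k : ℝ)|) * ‖ext (α s) k‖) + r * t := by
          rw [intervalIntegral.integral_add (hci (by fun_prop)) (hci (by fun_prop)),
            intervalIntegral.integral_const_mul, intervalIntegral.integral_const]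
          simp [mul_comm]
      _ ≤ 2 * (r / δ) + r * t := by gcongr
      _ = _ := by ring

/-- The Galerkin system has a solution for every degree and on every time interval. -/
theorem exists_isGalerkin {ν κ δ r T : ℝ} (N : ℕ) (hν : 0 ≤ ν) (hδ : 0 < δ) (hr : 0 ≤ r)
    (hr1 : r < 1) (hT : 0 ≤ T) (hrate : δ = ν - |κ| * P₂ r - ν * P₁ r) {a₀ : ℤ → ℂ}
    (ha : IsHerm a₀) (ha0 : a₀ 0 = 0) (hs : ∀ F : Finset ℤ, ∑ k ∈ F, ‖a₀ k‖ ≤ r) :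
    ∃ c, IsGalerkin ν κ δ r N T a₀ c := by
  set x₀ : Fin N → ℂ := fun j => a₀ ((j : ℤ) + 1) with hx₀
  have hx : ∀ k ∈ Finset.Icc (-N : ℤ) N, ext x₀ k = a₀ k := by
    intro k hk
    rw [Finset.mem_Icc] at hk
    rcases lt_trichotomy k 0 with hneg | rfl | hpos
    · obtain ⟨j, hj⟩ : ∃ j : Fin N, k = -((j : ℤ) + 1) :=
        ⟨⟨k.natAbs - 1, by omega⟩, by simp only []; omega⟩
      rw [hj, isHerm_ext, ext_succ, ha]
    · rw [ext_zero_index, ha0]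
    · obtain ⟨j, hj⟩ : ∃ j : Fin N, k = (j : ℤ) + 1 :=
        ⟨⟨k.natAbs - 1, by omega⟩, by simp only []; omega⟩
      rw [hj, ext_succ]
  have hell0 : ell x₀ ≤ r := by
    refine le_trans (le_of_eq ?_) (hs (Finset.Icc (-N : ℤ) N))
    exact Finset.sum_congr rfl fun k hk => by rw [hx k hk]
  obtain ⟨α, hα0, hα⟩ := exists_galerkin_curve (ν := ν) (κ := κ) hδ.le hT hr hr1 x₀
  rw [← hα0] at hx hell0
  rcases hr.eq_or_lt with rfl | hr'
  · -- for `r = 0` the vector field vanishes identically and the curve is constant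
    refine ⟨_, isGalerkin_of_curve (α := fun _ => α 0) hδ le_rfl hx (fun t ht => ?_)
      (fun t ht => hell0) (fun t ht => ?_)⟩
    · have h0 : α 0 = 0 := norm_le_zero_iff.1 ((norm_le_ell _).trans hell0)
      have e : ext (0 : Fin N → ℂ) = fun _ => 0 := by funext k; simp [ext]
      have : galerkinRhs ν κ δ 0 t (α 0) = 0 := by
        funext j
        simp [galerkinRhs, h0, galerkinField, e, qcoeff, fourierCoeff, qfun, damp, D, synth]
      rw [this]
      exact hasDerivWithinAt_const _ _ _
    · have h0 : α 0 = 0 := norm_le_zero_iff.1 ((norm_le_ell _).trans hell0)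
      have e : ext (0 : Fin N → ℂ) = fun _ => 0 := by funext k; simp [ext]
      simp [h0, e]
  · have hap := fun t ht => galerkin_apriori hν hδ hr' hr1 hrate hell0 hα (t := t) ht
    have hpos : ∀ s, 0 ≤ scale r (α s) *
        ∑ k ∈ Finset.Icc (-N : ℤ) N, (|(k : ℝ)| ^ 4 - |(k : ℝ)|) * ‖ext (α s) k‖ := by
      intro s
      refine mul_nonneg (scale_nonneg hr _) (Finset.sum_nonneg fun k _ =>
        mul_nonneg (sub_nonneg.2 ?_) (norm_nonneg _))
      rcases eq_or_ne k 0 with rfl | hk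
      · simp
      · have : (1 : ℝ) ≤ |(k : ℝ)| := by exact_mod_cast Int.one_le_abs hk
        exact le_self_pow₀ this (by norm_num)
    have hell : ∀ t ∈ Icc 0 T, ell (α t) ≤ r := by
      intro t ht
      have h1 := hap t ht
      have h2 := mul_nonneg hδ.le
        (intervalIntegral.integral_nonneg (μ := volume) ht.1 fun s _ => hpos s)
      linarith
    refine ⟨_, isGalerkin_of_curve hδ hr hx hα hell fun t ht => ?_⟩
    have h1 := hap t ht
    have h2 := ell_nonneg (α t)
    have e : ∫ s in (0 : ℝ)..t,
        ∑ k ∈ Finset.Icc (-N : ℤ) N, (|(k : ℝ)| ^ 4 - |(k : ℝ)|) * ‖ext (α s) k‖ =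
        ∫ s in (0 : ℝ)..t, scale r (α s) *
          ∑ k ∈ Finset.Icc (-N : ℤ) N, (|(k : ℝ)| ^ 4 - |(k : ℝ)|) * ‖ext (α s) k‖ := by
      refine intervalIntegral.integral_congr fun s hs => ?_
      rw [uIcc_of_le ht.1] at hs
      have hs' : ell (α s) ≤ r := hell s ⟨hs.1, hs.2.trans ht.2⟩
      simp only [scale, max_eq_left hs', div_self hr'.ne', one_mul]
    rw [e]
    linarith

/-! ### Compactness of the Galerkin approximations -/

/-- Pointwise convergence of dominated coefficients passes to the quadratic term. -/
lemma tendsto_qcoeff {ι : Type*} {l : Filter ι} {c : ι → ℤ → ℂ} {c' : ℤ → ℂ} {g : ℤ → ℝ} {z : ℝ}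
    (hz1 : z < 1) (hg : Summable g) (hDg : Summable fun k : ℤ => |(k : ℝ)| * g k)
    (hc : ∀ᶠ n in l, (∀ k, ‖c n k‖ ≤ g k) ∧ ∑' k, ‖c n k‖ ≤ z)
    (hc' : ∀ k, ‖c' k‖ ≤ g k) (hz' : ∑' k, ‖c' k‖ ≤ z)
    (hlim : ∀ k, Filter.Tendsto (fun n => c n k) l (nhds (c' k))) (k : ℤ) :
    Filter.Tendsto (fun n => qcoeff (c n) k) l (nhds (qcoeff c' k)) := by
  set B := ∑' k : ℤ, |(k : ℝ)| * g k
  have hD : ∀ a : ℤ → ℂ, (∀ k, ‖a k‖ ≤ g k) → ∀ k, ‖D a k‖ ≤ |(k : ℝ)| * g k := by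
    intro a ha k
    rw [norm_D]
    gcongr
    exact ha k
  have hs : ∀ a : ℤ → ℂ, (∀ k, ‖a k‖ ≤ g k) → Summable fun k => ‖a k‖ := fun a ha =>
    hg.of_nonneg_of_le (fun _ => norm_nonneg _) ha
  have hsD : ∀ a : ℤ → ℂ, (∀ k, ‖a k‖ ≤ g k) → Summable fun k => ‖D a k‖ := fun a ha =>
    hDg.of_nonneg_of_le (fun _ => norm_nonneg _) (hD a ha)
  have hB : ∀ a : ℤ → ℂ, (∀ k, ‖a k‖ ≤ g k) → ∑' k, ‖D a k‖ ≤ B := fun a ha =>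
    (hsD a ha).tsum_le_tsum (hD a ha) hDg
  rw [tendsto_iff_norm_sub_tendsto_zero]
  have h1 : Filter.Tendsto (fun n => ∑' k, ‖c n k - c' k‖) l (nhds (∑' _ : ℤ, (0 : ℝ))) := by
    refine tendsto_tsum_of_dominated_convergence (hg.mul_left 2) (fun k => ?_) ?_
    · simpa using ((hlim k).sub_const (c' k)).norm
    · filter_upwards [hc] with n hn k
      rw [norm_norm]
      refine (norm_sub_le _ _).trans ?_
      linarith [hn.1 k, hc' k]
  have h2 : Filter.Tendsto (fun n => ∑' k, ‖D (c n) k - D c' k‖) l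
      (nhds (∑' _ : ℤ, (0 : ℝ))) := by
    refine tendsto_tsum_of_dominated_convergence (hDg.mul_left 2) (fun k => ?_) ?_
    · have := (((hlim k).const_mul (Complex.I * k)).sub_const (D c' k)).norm
      simpa [D] using this
    · filter_upwards [hc] with n hn k
      rw [norm_norm]
      refine (norm_sub_le _ _).trans ?_
      linarith [hD _ hn.1 k, hD _ hc' k]
  rw [tsum_zero] at h1 h2
  have h3 := (h2.const_mul (2 * B / (1 - z))).add (h1.const_mul (B ^ 2 / (1 - z) ^ 2))
  rw [mul_zero, mul_zero, add_zero] at h3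
  refine squeeze_zero' (Filter.Eventually.of_forall fun _ => norm_nonneg _) ?_ h3
  filter_upwards [hc] with n hn
  exact norm_qcoeff_sub_le (hs _ hn.1) (hsD _ hn.1) (hs _ hc') (hsD _ hc') hz1 hn.2 hz'
    (hB _ hn.1) (hB _ hc') k

lemma emom_zero_eq {a : ℤ → ℂ} {s : ℕ} (h : Summable fun k : ℤ => |(k : ℝ)| ^ s * ‖a k‖) :
    emom 0 s a = ENNReal.ofReal (∑' k : ℤ, |(k : ℝ)| ^ s * ‖a k‖) := by
  rw [ENNReal.ofReal_tsum_of_nonneg (fun _ => by positivity) h]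
  refine tsum_congr fun k => ?_
  rw [wt, ← ofReal_norm, ← ENNReal.ofReal_mul (by positivity)]
  simp

lemma summable_of_summable_four {a : ℤ → ℂ} (h0 : Summable fun k => ‖a k‖)
    (h4 : Summable fun k : ℤ => |(k : ℝ)| ^ 4 * ‖a k‖) {s : ℕ} (hs : s ≤ 4) :
    Summable fun k : ℤ => |(k : ℝ)| ^ s * ‖a k‖ := by
  refine (h0.add h4).of_nonneg_of_le (fun _ => by positivity) fun k => ?_
  rcases eq_or_ne k 0 with rfl | hk
  · rcases eq_or_ne s 0 with rfl | hs0
    · simp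
    · simp [hs0]
  · have h1 : (1 : ℝ) ≤ |(k : ℝ)| := by exact_mod_cast Int.one_le_abs hk
    have := mul_le_mul_of_nonneg_right (pow_le_pow_right₀ h1 hs) (norm_nonneg (a k))
    have := norm_nonneg (a k)
    linarith

/-- The interpolation inequality `m₁² ≤ m₀ m₂`. -/
lemma sq_tsum_D_le {a : ℤ → ℂ} (h0 : Summable fun k => ‖a k‖)
    (h4 : Summable fun k : ℤ => |(k : ℝ)| ^ 4 * ‖a k‖) :
    (∑' k, ‖D a k‖) ^ 2 ≤ (∑' k, ‖a k‖) * ∑' k : ℤ, |(k : ℝ)| ^ 2 * ‖a k‖ := by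
  have h := emom_mul_le 0 1 1 a
  have hs := fun s hs => summable_of_summable_four h0 h4 (s := s) hs
  have n : ∀ s : ℕ, 0 ≤ ∑' k : ℤ, |(k : ℝ)| ^ s * ‖a k‖ := fun s =>
    tsum_nonneg fun _ => by positivity
  rw [emom_zero_eq (hs 1 (by norm_num)), emom_zero_eq (hs 0 (by norm_num)),
    emom_zero_eq (hs 2 (by norm_num)), ← ENNReal.ofReal_mul (n 1), ← ENNReal.ofReal_mul (n 0),
    ENNReal.ofReal_le_ofReal_iff (mul_nonneg (n 0) (n 2))] at h
  simp only [norm_D]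
  simpa [sq] using h

/-- `m₁²` is absorbed by an arbitrarily small multiple of `m₄`. The free parameter `h` is what makes
`∫ m₁²` small over short time intervals. -/
lemma sq_tsum_D_le' {a : ℤ → ℂ} {r h : ℝ} (hr : ∑' k, ‖a k‖ ≤ r) (hh : 0 < h)
    (h0 : Summable fun k => ‖a k‖) (h4 : Summable fun k : ℤ => |(k : ℝ)| ^ 4 * ‖a k‖) :
    (∑' k, ‖D a k‖) ^ 2 ≤ r * (h * (∑' k : ℤ, |(k : ℝ)| ^ 4 * ‖a k‖) + r / h) := by
  have hr0 : 0 ≤ r := (tsum_nonneg fun _ => norm_nonneg _).trans hr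
  refine (sq_tsum_D_le h0 h4).trans ?_
  have h2 : ∑' k : ℤ, |(k : ℝ)| ^ 2 * ‖a k‖ ≤
      h * (∑' k : ℤ, |(k : ℝ)| ^ 4 * ‖a k‖) + (∑' k, ‖a k‖) / h := by
    rw [← tsum_mul_left, ← tsum_div_const, ← (h4.mul_left h).tsum_add (h0.div_const h)]
    refine (summable_of_summable_four h0 h4 (by norm_num)).tsum_le_tsum (fun k => ?_)
      ((h4.mul_left h).add (h0.div_const h))
    have : |(k : ℝ)| ^ 2 ≤ h * |(k : ℝ)| ^ 4 + 1 / h := by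
      have e : h * |(k : ℝ)| ^ 4 + 1 / h - |(k : ℝ)| ^ 2 =
          ((h * |(k : ℝ)| ^ 2 - 1 / 2) ^ 2 + 3 / 4) / h := by
        field_simp; ring
      have : 0 ≤ ((h * |(k : ℝ)| ^ 2 - 1 / 2) ^ 2 + 3 / 4) / h := by positivity
      linarith
    calc _ ≤ (h * |(k : ℝ)| ^ 4 + 1 / h) * ‖a k‖ := by gcongr
      _ = _ := by ring
  have h3 : 0 ≤ ∑' k : ℤ, |(k : ℝ)| ^ 2 * ‖a k‖ := tsum_nonneg fun _ => by positivity
  calc _ ≤ r * (h * (∑' k : ℤ, |(k : ℝ)| ^ 4 * ‖a k‖) + (∑' k, ‖a k‖) / h) := by gcongr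
    _ ≤ _ := by gcongr

section IsGalerkin

variable {ν κ δ r T : ℝ} {N : ℕ} {a₀ : ℤ → ℂ} {c : ℝ → ℤ → ℂ}

lemma IsGalerkin.norm_le (hG : IsGalerkin ν κ δ r N T a₀ c) {t : ℝ}
    (ht : t ∈ Icc 0 T) (k : ℤ) : ‖c t k‖ ≤ r * Real.exp (-(δ * t * |(k : ℝ)|)) := by
  have h := hG.bound t ht {k}
  rw [Finset.sum_singleton] at h
  rw [Real.exp_neg, ← div_eq_mul_inv, le_div_iff₀ (Real.exp_pos _), mul_comm]
  exact h

lemma IsGalerkin.norm_le' (hG : IsGalerkin ν κ δ r N T a₀ c) (hδ : 0 < δ) {t : ℝ}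
    (ht : t ∈ Icc 0 T) (k : ℤ) : ‖c t k‖ ≤ r := by
  refine le_trans ?_ (hG.bound t ht {k})
  rw [Finset.sum_singleton]
  exact le_mul_of_one_le_left (norm_nonneg _) (Real.one_le_exp
    (mul_nonneg (mul_nonneg hδ.le ht.1) (abs_nonneg _)))

lemma IsGalerkin.summable (hG : IsGalerkin ν κ δ r N T a₀ c) (t : ℝ) (w : ℤ → ℝ) :
    Summable fun k => w k * ‖c t k‖ :=
  summable_of_support (N := N) fun k hk => by rw [hG.support t k hk, norm_zero, mul_zero]

lemma IsGalerkin.tsum_le (hG : IsGalerkin ν κ δ r N T a₀ c) (hδ : 0 < δ) {t : ℝ}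
    (ht : t ∈ Icc 0 T) : ∑' k, ‖c t k‖ ≤ r := by
  refine Real.tsum_le_of_sum_le (fun _ => norm_nonneg _) fun F => ?_
  refine le_trans (Finset.sum_le_sum fun k _ => ?_) (hG.bound t ht F)
  exact le_mul_of_one_le_left (norm_nonneg _) (Real.one_le_exp
    (mul_nonneg (mul_nonneg hδ.le ht.1) (abs_nonneg _)))

lemma IsGalerkin.continuousOn (hG : IsGalerkin ν κ δ r N T a₀ c) (k : ℤ) :
    ContinuousOn (fun t => c t k) (Icc 0 T) := by
  by_cases hk : k ∈ Finset.Icc (-N : ℤ) N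
  · exact fun t ht => (hG.deriv t ht k hk).continuousWithinAt
  · have : (fun t => c t k) = fun _ => 0 := funext fun t => hG.support t k hk
    rw [this]; exact continuousOn_const

lemma IsGalerkin.continuousOn_field (hG : IsGalerkin ν κ δ r N T a₀ c) (hδ : 0 < δ) (hr1 : r < 1)
    (k : ℤ) : ContinuousOn (fun t => fourierField ν κ (c t) k) (Icc 0 T) := by
  have hq : ContinuousOn (fun t => qcoeff (c t) k) (Icc 0 T) := by
    intro t ht
    set g : ℤ → ℝ := fun k => if k ∈ Finset.Icc (-N : ℤ) N then r else 0 with hg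
    have hcg : ∀ s ∈ Icc 0 T, ∀ k, ‖c s k‖ ≤ g k := by
      intro s hs k
      simp only [hg]
      split_ifs with hk
      · exact hG.norm_le' hδ hs k
      · rw [hG.support s k hk, norm_zero]
    refine tendsto_qcoeff (g := g) hr1 ?_ ?_ ?_ (hcg t ht) (hG.tsum_le hδ ht)
      (fun k => hG.continuousOn k t ht) k
    · exact summable_of_support (N := N) fun k hk => by simp only [hg]; rw [if_neg hk]
    · exact summable_of_support (N := N) fun k hk => by simp only [hg]; rw [if_neg hk, mul_zero]
    · filter_upwards [self_mem_nhdsWithin] with s hs using ⟨hcg s hs, hG.tsum_le hδ hs⟩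
  have := hG.continuousOn k
  unfold fourierField
  fun_prop

lemma IsGalerkin.sub_eq_integral (hG : IsGalerkin ν κ δ r N T a₀ c) (hδ : 0 < δ) (hr1 : r < 1)
    {k : ℤ} (hk : k ∈ Finset.Icc (-N : ℤ) N) {s t : ℝ} (hs : 0 ≤ s) (hst : s ≤ t) (ht : t ≤ T) :
    c t k - c s k = ∫ x in s..t, fourierField ν κ (c x) k := by
  have hsub : Icc s t ⊆ Icc 0 T := Icc_subset_Icc hs ht
  refine (intervalIntegral.integral_eq_sub_of_hasDerivAt_of_le hst
    ((hG.continuousOn k).mono hsub) (fun x hx => ?_)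
    (((hG.continuousOn_field hδ hr1 k).mono hsub).intervalIntegrable_of_Icc hst)).symm
  exact (hG.deriv x (hsub (Ioo_subset_Icc_self hx)) k hk).hasDerivAt
    (Icc_mem_nhds (hs.trans_lt hx.1) (hx.2.trans_le ht))

/-- A modulus of continuity in time, uniform in the degree `N`. -/
lemma IsGalerkin.norm_sub_le (hG : IsGalerkin ν κ δ r N T a₀ c) (hδ : 0 < δ) (hr : 0 ≤ r)
    (hr1 : r < 1) (k : ℤ) {s t h : ℝ} (hs : 0 ≤ s) (hst : s ≤ t) (ht : t ≤ T) (hh : 0 < h) :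
    ‖c t k - c s k‖ ≤ ‖linSymbol ν κ k‖ * r * (t - s) + ‖quadSymbol ν κ k‖ * r / (1 - r) *
      (h * (2 * r / δ + r * T) + r * (t - s) / h) := by
  have hz : 0 < 1 - r := by linarith
  have hT : 0 ≤ T := hs.trans (hst.trans ht)
  by_cases hk : k ∈ Finset.Icc (-N : ℤ) N
  swap
  · rw [hG.support t k hk, hG.support s k hk, sub_zero, norm_zero]
    have : 0 ≤ t - s := by linarith
    positivity
  have hsub : Icc s t ⊆ Icc 0 T := Icc_subset_Icc hs ht
  set S := Finset.Icc (-N : ℤ) N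
  have hm4c : ContinuousOn (fun x => ∑ k ∈ S, |(k : ℝ)| ^ 4 * ‖c x k‖) (Icc 0 T) := by
    have := hG.continuousOn
    fun_prop
  have hm4 : ∀ x, ∑' k : ℤ, |(k : ℝ)| ^ 4 * ‖c x k‖ = ∑ k ∈ S, |(k : ℝ)| ^ 4 * ‖c x k‖ := fun x =>
    tsum_eq_sum fun k hk => by rw [hG.support x k hk, norm_zero, mul_zero]
  have hbound : ∀ x ∈ Icc 0 T, ‖fourierField ν κ (c x) k‖ ≤ ‖linSymbol ν κ k‖ * r +
      ‖quadSymbol ν κ k‖ * r / (1 - r) * (h * (∑ k ∈ S, |(k : ℝ)| ^ 4 * ‖c x k‖) + r / h) := by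
    intro x hx
    have hs0 : Summable fun k => ‖c x k‖ := by simpa using hG.summable x fun _ => 1
    have hsD : Summable fun k => ‖D (c x) k‖ := by
      simp only [norm_D]; exact hG.summable x _
    have h1 := norm_qcoeff_le hs0 hsD hr1 (hG.tsum_le hδ hx) k
    have h2 := sq_tsum_D_le' (hG.tsum_le hδ hx) hh hs0 (hG.summable x _)
    rw [hm4] at h2
    unfold fourierField
    refine (_root_.norm_sub_le _ _).trans ?_
    rw [norm_mul, norm_mul]
    calc _ ≤ ‖linSymbol ν κ k‖ * r + ‖quadSymbol ν κ k‖ *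
          (r * (h * (∑ k ∈ S, |(k : ℝ)| ^ 4 * ‖c x k‖) + r / h) / (1 - r)) := by
          gcongr
          · exact hG.norm_le' hδ hx k
          · exact h1.trans (by gcongr)
      _ = _ := by ring
  rw [hG.sub_eq_integral hδ hr1 hk hs hst ht]
  have hci : ∀ {g : ℝ → ℝ}, ContinuousOn g (Icc 0 T) → IntervalIntegrable g volume s t :=
    fun hg => (hg.mono hsub).intervalIntegrable_of_Icc hst
  refine (intervalIntegral.norm_integral_le_of_norm_le hst
    (Filter.Eventually.of_forall fun x hx => hbound x (hsub (Ioc_subset_Icc_self hx)))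
    (hci (by fun_prop))).trans ?_
  rw [intervalIntegral.integral_add (hci (by fun_prop)) (hci (by fun_prop)),
    intervalIntegral.integral_const_mul (‖quadSymbol ν κ k‖ * r / (1 - r)),
    intervalIntegral.integral_add (hci (by fun_prop)) (hci (by fun_prop)),
    intervalIntegral.integral_const_mul h, intervalIntegral.integral_const,
    intervalIntegral.integral_const, smul_eq_mul, smul_eq_mul]
  have hI : ∫ x in s..t, ∑ k ∈ S, |(k : ℝ)| ^ 4 * ‖c x k‖ ≤ 2 * r / δ + r * T := by
    refine le_trans ?_ (hG.int T ⟨hT, le_rfl⟩ S)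
    refine intervalIntegral.integral_mono_interval hs hst ht ?_
      (hm4c.intervalIntegrable_of_Icc hT)
    exact Filter.Eventually.of_forall fun x => Finset.sum_nonneg fun k _ => by positivity
  have e : (t - s) * (r / h) = r * (t - s) / h := by ring
  rw [e, mul_comm (t - s)]
  gcongr

end IsGalerkin

/-- The estimate of `IsGalerkin.norm_sub_le`, optimised over `h`, is a modulus of continuity. -/
lemma exists_modulus {A B K r T : ℝ} (hB : 0 ≤ B) (hK : 0 ≤ K)
    {ε : ℝ} (hε : 0 < ε) : ∃ η > 0, ∀ f : ℝ → ℂ,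
    (∀ s t h : ℝ, 0 ≤ s → s ≤ t → t ≤ T → 0 < h →
      ‖f t - f s‖ ≤ A * (t - s) + B * (h * K + r * (t - s) / h)) →
    ∀ s ∈ Icc 0 T, ∀ t ∈ Icc 0 T, |t - s| < η → ‖f t - f s‖ ≤ ε := by
  obtain ⟨h, hh, hhε⟩ : ∃ h : ℝ, 0 < h ∧ B * (h * K) < ε := by
    refine ⟨ε / (B * K + 1), by positivity, ?_⟩
    rw [show B * (ε / (B * K + 1) * K) = ε * (B * K) / (B * K + 1) by ring,
      div_lt_iff₀ (by positivity)]
    nlinarith [mul_nonneg hB hK]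
  have hcont : Filter.Tendsto (fun d : ℝ => A * d + B * (h * K + r * d / h)) (nhds 0)
      (nhds (A * 0 + B * (h * K + r * 0 / h))) :=
    Continuous.tendsto (by fun_prop) 0
  have hev := hcont.eventually (gt_mem_nhds (show A * 0 + B * (h * K + r * 0 / h) < ε by simpa))
  obtain ⟨η, hη, hball⟩ := Metric.eventually_nhds_iff.1 hev
  refine ⟨η, hη, fun f hf => ?_⟩
  have main : ∀ s t : ℝ, 0 ≤ s → s ≤ t → t ≤ T → |t - s| < η → ‖f t - f s‖ ≤ ε := by
    intro s t hs hst ht hd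
    exact (hf s t h hs hst ht hh).trans
      (hball (y := t - s) (by rwa [Real.dist_eq, sub_zero])).le
  intro s hs t ht hd
  rcases le_total s t with hst | hst
  · exact main s t hs.1 hst ht.2 hd
  · rw [norm_sub_rev]
    exact main t s ht.1 hst hs.2 (by rwa [abs_sub_comm])

/-- A diagonal argument: a bounded, locally equicontinuous sequence of functions on `[0, ∞)`, the
`n`-th one being controlled on `[0, n]` only, has a pointwise convergent subsequence. -/
theorem exists_subseq_tendsto {c : ℕ → ℝ → ℤ → ℂ} {r : ℝ} (hr : 0 ≤ r)
    (hb : ∀ n : ℕ, ∀ t ∈ Icc (0 : ℝ) n, ∀ k, ‖c n t k‖ ≤ r)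
    (he : ∀ (T : ℝ) (k : ℤ) (ε : ℝ), 0 < ε → ∃ η > 0, ∀ n : ℕ, T ≤ n → ∀ s ∈ Icc 0 T,
      ∀ t ∈ Icc 0 T, |t - s| < η → ‖c n t k - c n s k‖ ≤ ε) :
    ∃ φ : ℕ → ℕ, StrictMono φ ∧ ∃ c' : ℝ → ℤ → ℂ, ∀ t, 0 ≤ t → ∀ k,
      Filter.Tendsto (fun n => c (φ n) t k) Filter.atTop (nhds (c' t k)) := by
  -- Tychonoff's theorem gives convergence at rational times; equicontinuity extends it to all times
  set x : ℕ → ℤ × ℚ → ℂ := fun n p => if (p.2 : ℝ) ∈ Icc (0 : ℝ) n then c n p.2 p.1 else 0 with hx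
  have hK : IsCompact (Set.pi univ fun _ : ℤ × ℚ => Metric.closedBall (0 : ℂ) r) :=
    isCompact_univ_pi fun _ => isCompact_closedBall _ _
  have hxK : ∀ n, x n ∈ Set.pi univ fun _ : ℤ × ℚ => Metric.closedBall (0 : ℂ) r := by
    intro n p _
    rw [mem_closedBall_zero_iff]
    simp only [hx]
    split_ifs with h
    · exact hb n _ h _
    · simpa using hr
  obtain ⟨y, -, φ, hφ, hlim⟩ := hK.tendsto_subseq hxK
  rw [tendsto_pi_nhds] at hlim
  refine ⟨φ, hφ, ?_⟩
  have hcau : ∀ t, 0 ≤ t → ∀ k, CauchySeq fun n => c (φ n) t k := by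
    intro t ht k
    rw [Metric.cauchySeq_iff']
    intro ε hε
    obtain ⟨η, hη, hη'⟩ := he (t + 1) k (ε / 4) (by positivity)
    obtain ⟨q, hq1, hq2⟩ := exists_rat_btwn (show t < t + min η 1 by
      have := lt_min hη one_pos; linarith)
    have hqη : (q : ℝ) < t + η := hq2.trans_le (by gcongr; exact min_le_left _ _)
    have hq1' : (q : ℝ) ≤ t + 1 := hq2.le.trans (by gcongr; exact min_le_right _ _)
    obtain ⟨n₁, hn₁⟩ := Metric.cauchySeq_iff'.1 (hlim (k, q)).cauchySeq (ε / 4) (by positivity)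
    obtain ⟨n₂, hn₂⟩ := exists_nat_ge (t + 1)
    have hbig : ∀ n ≥ max n₁ n₂, t + 1 ≤ (φ n : ℝ) := fun n hn =>
      hn₂.trans (by exact_mod_cast (le_max_right n₁ n₂).trans (hn.trans (hφ.id_le n)))
    have hval : ∀ n ≥ max n₁ n₂, x (φ n) (k, q) = c (φ n) q k := by
      intro n hn
      simp only [hx]
      rw [if_pos ⟨ht.trans hq1.le, hq1'.trans (hbig n hn)⟩]
    have hclose : ∀ n ≥ max n₁ n₂, ‖c (φ n) q k - c (φ n) t k‖ ≤ ε / 4 := fun n hn =>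
      hη' (φ n) (hbig n hn) t ⟨ht, by linarith⟩ q ⟨ht.trans hq1.le, hq1'⟩
        (by rw [abs_of_pos (by linarith)]; linarith)
    refine ⟨max n₁ n₂, fun n hn => ?_⟩
    have h1 := hclose n hn
    have h2 := hclose _ le_rfl
    have h3 := hn₁ n ((le_max_left _ _).trans hn)
    have h4 := hn₁ _ (le_max_left n₁ n₂)
    simp only [Function.comp] at h3 h4
    rw [hval n hn] at h3
    rw [hval _ le_rfl] at h4
    rw [← dist_eq_norm] at h1 h2
    rw [dist_comm] at h1 h4
    have h5 := dist_triangle4 (c (φ n) t k) (c (φ n) q k) (x (φ n₁) (k, q))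
      (c (φ (max n₁ n₂)) q k)
    have h6 := dist_triangle (c (φ n) t k) (c (φ (max n₁ n₂)) q k) (c (φ (max n₁ n₂)) t k)
    linarith
  have hex : ∀ t k, ∃ z : ℂ, 0 ≤ t → Filter.Tendsto (fun n => c (φ n) t k) Filter.atTop (nhds z) := by
    intro t k
    by_cases ht : 0 ≤ t
    · obtain ⟨z, hz⟩ := cauchySeq_tendsto_of_complete (hcau t ht k)
      exact ⟨z, fun _ => hz⟩
    · exact ⟨0, fun h => absurd h ht⟩
  choose c' hc' using hex
  exact ⟨c', fun t ht k => hc' t k ht⟩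

/-! ### Global solutions on the Fourier side -/

/-- `c` is a global solution of the equation on the Fourier side with initial coefficients `a₀`,
with the a priori bounds inherited from the Galerkin approximations. -/
structure IsFourierSol (ν κ δ r : ℝ) (a₀ : ℤ → ℂ) (c : ℝ → ℤ → ℂ) : Prop where
  herm : ∀ t, 0 ≤ t → IsHerm (c t)
  zero : ∀ t, 0 ≤ t → c t 0 = 0
  init : ∀ k, c 0 k = a₀ k
  bound : ∀ t, 0 ≤ t → ∀ F : Finset ℤ, ∑ k ∈ F, Real.exp (δ * t * |(k : ℝ)|) * ‖c t k‖ ≤ r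
  cont : ∀ k, ContinuousOn (fun t => c t k) (Ici 0)
  deriv : ∀ t, 0 < t → ∀ k, HasDerivAt (fun t => c t k) (fourierField ν κ (c t) k) t
  int : ∀ t, 0 ≤ t → ∀ F : Finset ℤ,
    ∫ s in (0 : ℝ)..t, ∑ k ∈ F, |(k : ℝ)| ^ 4 * ‖c s k‖ ≤ 2 * r / δ + r * t

lemma summable_pow_mul_exp {τ : ℝ} (hτ : 0 < τ) (j : ℕ) :
    Summable fun k : ℤ => |(k : ℝ)| ^ j * Real.exp (-(τ * |(k : ℝ)|)) := by
  have h := Real.summable_pow_mul_exp_neg_nat_mul j hτ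
  refine Summable.of_nat_of_neg ?_ ?_
  · simpa using h
  · simpa using h

lemma IsGalerkin.mono {ν κ δ r T T' : ℝ} {N : ℕ} {a₀ : ℤ → ℂ} {c : ℝ → ℤ → ℂ}
    (hG : IsGalerkin ν κ δ r N T a₀ c) (hT : T' ≤ T) : IsGalerkin ν κ δ r N T' a₀ c where
  herm := hG.herm
  support := hG.support
  zero := hG.zero
  init := hG.init
  bound t ht := hG.bound t ⟨ht.1, ht.2.trans hT⟩
  deriv t ht k hk := (hG.deriv t ⟨ht.1, ht.2.trans hT⟩ k hk).mono (Icc_subset_Icc_right hT)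
  int t ht := hG.int t ⟨ht.1, ht.2.trans hT⟩

section Curves

variable {δ r η : ℝ} {a : ℤ → ℂ}

/-- The pointwise bound `‖a k‖ ≤ r e^{-η|k|}` makes the first moment finite. -/
lemma norm_qcoeff_le_of_exp (hη : 0 < η) (hr1 : r < 1) (hz : ∑' k, ‖a k‖ ≤ r)
    (h : ∀ k, ‖a k‖ ≤ r * Real.exp (-(η * |(k : ℝ)|))) (k : ℤ) :
    ‖qcoeff a k‖ ≤ (∑' k : ℤ, |(k : ℝ)| * (r * Real.exp (-(η * |(k : ℝ)|)))) ^ 2 / (1 - r) := by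
  have hz' : 0 < 1 - r := by linarith
  have s0 : Summable fun k : ℤ => r * Real.exp (-(η * |(k : ℝ)|)) := by
    simpa using (summable_pow_mul_exp hη 0).mul_left r
  have s1 : Summable fun k : ℤ => |(k : ℝ)| * (r * Real.exp (-(η * |(k : ℝ)|))) := by
    refine ((summable_pow_mul_exp hη 1).mul_left r).congr fun k => by ring
  have ha := s0.of_nonneg_of_le (fun _ => norm_nonneg _) h
  have hDle : ∀ k, ‖D a k‖ ≤ |(k : ℝ)| * (r * Real.exp (-(η * |(k : ℝ)|))) := by
    intro k; rw [norm_D]; gcongr; exact h k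
  have hD := s1.of_nonneg_of_le (fun _ => norm_nonneg _) hDle
  refine (norm_qcoeff_le ha hD hr1 hz k).trans ?_
  have h0 : 0 ≤ ∑' k, ‖D a k‖ := tsum_nonneg fun _ => norm_nonneg _
  gcongr ?_ ^ 2 / _
  exact hD.tsum_le_tsum hDle s1

lemma exp_decay_of_bound {t : ℝ} (hb : ∀ F : Finset ℤ,
    ∑ k ∈ F, Real.exp (δ * t * |(k : ℝ)|) * ‖a k‖ ≤ r) (k : ℤ) :
    ‖a k‖ ≤ r * Real.exp (-(δ * t * |(k : ℝ)|)) := by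
  have h := hb {k}
  rw [Finset.sum_singleton] at h
  rw [Real.exp_neg, ← div_eq_mul_inv, le_div_iff₀ (Real.exp_pos _), mul_comm]
  exact h

lemma sum_le_of_bound {t : ℝ} (hδt : 0 ≤ δ * t) (hb : ∀ F : Finset ℤ,
    ∑ k ∈ F, Real.exp (δ * t * |(k : ℝ)|) * ‖a k‖ ≤ r) (F : Finset ℤ) : ∑ k ∈ F, ‖a k‖ ≤ r :=
  (Finset.sum_le_sum fun _ _ => le_mul_of_one_le_left (norm_nonneg _) (Real.one_le_exp
    (mul_nonneg hδt (abs_nonneg _)))).trans (hb F)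

lemma tsum_le_of_bound {t : ℝ} (hδt : 0 ≤ δ * t) (hb : ∀ F : Finset ℤ,
    ∑ k ∈ F, Real.exp (δ * t * |(k : ℝ)|) * ‖a k‖ ≤ r) : ∑' k, ‖a k‖ ≤ r :=
  Real.tsum_le_of_sum_le (fun _ => norm_nonneg _) (sum_le_of_bound hδt hb)

lemma exp_decay_mono {s t : ℝ} (hδ : 0 ≤ δ) (hr : 0 ≤ r) (hst : s ≤ t)
    (h : ∀ k : ℤ, ‖a k‖ ≤ r * Real.exp (-(δ * t * |(k : ℝ)|))) (k : ℤ) :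
    ‖a k‖ ≤ r * Real.exp (-(δ * s * |(k : ℝ)|)) :=
  (h k).trans (by gcongr)

/-- The quadratic term is continuous along curves with uniform exponential decay. -/
lemma tendsto_qcoeff_of_exp {ι : Type*} {l : Filter ι} {c : ι → ℤ → ℂ} (hη : 0 < η) (hr1 : r < 1)
    (hc : ∀ᶠ n in l, (∀ k, ‖c n k‖ ≤ r * Real.exp (-(η * |(k : ℝ)|))) ∧ ∑' k, ‖c n k‖ ≤ r)
    (ha : ∀ k, ‖a k‖ ≤ r * Real.exp (-(η * |(k : ℝ)|))) (hz : ∑' k, ‖a k‖ ≤ r)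
    (hlim : ∀ k, Filter.Tendsto (fun n => c n k) l (nhds (a k))) (k : ℤ) :
    Filter.Tendsto (fun n => qcoeff (c n) k) l (nhds (qcoeff a k)) := by
  refine tendsto_qcoeff hr1 ?_ ?_ hc ha hz hlim k
  · simpa using (summable_pow_mul_exp hη 0).mul_left r
  · exact ((summable_pow_mul_exp hη 1).mul_left r).congr fun k => by ring

end Curves

/-- A limit point of the Galerkin approximations is a global solution. -/
theorem exists_isFourierSol {ν κ δ r : ℝ} (hν : 0 ≤ ν) (hδ : 0 < δ) (hr : 0 ≤ r)
    (hr1 : r < 1) (hrate : δ = ν - |κ| * P₂ r - ν * P₁ r) {a₀ : ℤ → ℂ}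
    (ha : IsHerm a₀) (ha0 : a₀ 0 = 0) (hs : ∀ F : Finset ℤ, ∑ k ∈ F, ‖a₀ k‖ ≤ r) :
    ∃ c, IsFourierSol ν κ δ r a₀ c := by
  have hz : 0 < 1 - r := by linarith
  choose c hc using fun n : ℕ =>
    exists_isGalerkin (T := n) n hν hδ hr hr1 n.cast_nonneg hrate ha ha0 hs
  have hcT : ∀ (n : ℕ) (T : ℝ), T ≤ n → IsGalerkin ν κ δ r n T a₀ (c n) := fun n T hT =>
    (hc n).mono hT
  have hmod : ∀ (T : ℝ), 0 ≤ T → ∀ (k : ℤ) (ε : ℝ), 0 < ε → ∃ η > 0, ∀ f : ℝ → ℂ,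
    (∀ s t h : ℝ, 0 ≤ s → s ≤ t → t ≤ T → 0 < h →
      ‖f t - f s‖ ≤ ‖linSymbol ν κ k‖ * r * (t - s) + ‖quadSymbol ν κ k‖ * r / (1 - r) *
        (h * (2 * r / δ + r * T) + r * (t - s) / h)) →
    ∀ s ∈ Icc 0 T, ∀ t ∈ Icc 0 T, |t - s| < η → ‖f t - f s‖ ≤ ε := fun T hT k ε hε =>
    exists_modulus (by positivity) (by positivity) hε
  obtain ⟨φ, hφ, c', hlim⟩ := exists_subseq_tendsto (c := c) hr
    (fun n t ht k => (hc n).norm_le' hδ ht k) (fun T k ε hε => by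
      by_cases hT : 0 ≤ T
      · obtain ⟨η, hη, h⟩ := hmod T hT k ε hε
        exact ⟨η, hη, fun n hn => h _ fun s t h hs hst ht hh =>
          (hcT n T hn).norm_sub_le hδ hr hr1 k hs hst ht hh⟩
      · exact ⟨1, one_pos, fun n _ s hs => absurd (hs.1.trans hs.2) hT⟩)
  have hev : ∀ T : ℝ, ∀ᶠ n in Filter.atTop, T ≤ (φ n : ℝ) := by
    intro T
    obtain ⟨m, hm⟩ := exists_nat_ge T
    filter_upwards [Filter.eventually_ge_atTop m] with n hn
    exact hm.trans (by exact_mod_cast hn.trans (hφ.id_le n))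
  have hbound : ∀ t, 0 ≤ t → ∀ F : Finset ℤ,
      ∑ k ∈ F, Real.exp (δ * t * |(k : ℝ)|) * ‖c' t k‖ ≤ r := by
    intro t ht F
    refine le_of_tendsto (tendsto_finsetSum F fun k _ => ((hlim t ht k).norm).const_mul _) ?_
    filter_upwards [hev t] with n hn
    exact (hc (φ n)).bound t ⟨ht, hn⟩ F
  have hcont : ∀ k, ContinuousOn (fun t => c' t k) (Ici 0) := by
    intro k t ht
    rw [mem_Ici] at ht
    rw [Metric.continuousWithinAt_iff]
    intro ε hε
    obtain ⟨η, hη, h⟩ := hmod (t + 1) (by linarith) k (ε / 2) (by positivity)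
    have h' := h (fun t => c' t k) fun s u h hs hsu hu hh => by
      refine le_of_tendsto ((hlim u (hs.trans hsu) k).sub (hlim s hs k)).norm ?_
      filter_upwards [hev (t + 1)] with n hn
      exact (hcT _ _ hn).norm_sub_le hδ hr hr1 k hs hsu hu hh
    refine ⟨min η 1, lt_min hη one_pos, fun {s} hs hst => ?_⟩
    rw [Real.dist_eq] at hst
    have h1 : |s - t| < η := hst.trans_le (min_le_left _ _)
    have h2 : |s - t| < 1 := hst.trans_le (min_le_right _ _)
    rw [abs_lt] at h2
    rw [dist_eq_norm]
    exact (h' t ⟨ht, by linarith⟩ s ⟨hs, by linarith [h2.2]⟩ h1).trans_lt (by linarith)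
  have htsum : ∀ t, 0 ≤ t → ∑' k, ‖c' t k‖ ≤ r := fun t ht =>
    tsum_le_of_bound (mul_nonneg hδ.le ht) (hbound t ht)
  refine ⟨c', ⟨?_, ?_, ?_, hbound, hcont, ?_, ?_⟩⟩
  · intro t ht k
    refine tendsto_nhds_unique (hlim t ht (-k)) ?_
    refine ((Complex.continuous_conj.tendsto _).comp (hlim t ht k)).congr fun n => ?_
    exact ((hc (φ n)).herm t k).symm
  · intro t ht
    refine tendsto_nhds_unique (hlim t ht 0) ?_
    simp only [(hc _).zero]
    exact tendsto_const_nhds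
  · intro k
    refine tendsto_nhds_unique (hlim 0 le_rfl k) (tendsto_const_nhds.congr' ?_)
    filter_upwards [hev |(k : ℝ)|] with n hn
    refine ((hc (φ n)).init k (Finset.mem_Icc.2 ?_)).symm
    rw [abs_le] at hn
    exact ⟨by exact_mod_cast hn.1, by exact_mod_cast hn.2⟩
  · intro t₀ ht₀ k
    -- Away from `t = 0` the bounds give uniform exponential decay in `k`, hence convergence of the
    -- nonlinear term; the limit satisfies the integrated equation, with continuous integrand.
    set η := t₀ / 2 with hη
    have hη0 : 0 < η := by positivity
    set T := t₀ + 1 with hT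
    have hδη : 0 < δ * η := by positivity
    have hdec : ∀ s ∈ Icc η T, ∀ k : ℤ, ‖c' s k‖ ≤ r * Real.exp (-(δ * η * |(k : ℝ)|)) :=
      fun s hs => exp_decay_mono hδ.le hr hs.1
        (exp_decay_of_bound (hbound s (hη0.le.trans hs.1)))
    have hdecn : ∀ n, T ≤ (φ n : ℝ) → ∀ s ∈ Icc η T, (∀ k : ℤ, ‖c (φ n) s k‖ ≤
        r * Real.exp (-(δ * η * |(k : ℝ)|))) ∧ ∑' k, ‖c (φ n) s k‖ ≤ r := by
      intro n hn s hs
      have hs' : s ∈ Icc (0 : ℝ) (φ n) := ⟨hη0.le.trans hs.1, hs.2.trans hn⟩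
      exact ⟨exp_decay_mono hδ.le hr hs.1 ((hc (φ n)).norm_le hs'), (hc (φ n)).tsum_le hδ hs'⟩
    have hqlim : ∀ s ∈ Icc η T, Filter.Tendsto (fun n => fourierField ν κ (c (φ n) s) k)
        Filter.atTop (nhds (fourierField ν κ (c' s) k)) := by
      intro s hs
      refine ((hlim s (hη0.le.trans hs.1) k).const_mul _).sub (Filter.Tendsto.const_mul _ ?_)
      refine tendsto_qcoeff_of_exp hδη hr1 ?_ (hdec s hs) (htsum s (hη0.le.trans hs.1))
        (hlim s (hη0.le.trans hs.1)) k
      filter_upwards [hev T] with n hn using hdecn n hn s hs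
    have hfc : ContinuousOn (fun s => fourierField ν κ (c' s) k) (Icc η T) := by
      have hcc : ∀ k, ContinuousOn (fun s => c' s k) (Icc η T) := fun k =>
        (hcont k).mono fun s hs => hη0.le.trans hs.1
      have hq : ContinuousOn (fun s => qcoeff (c' s) k) (Icc η T) := by
        intro s hs
        refine tendsto_qcoeff_of_exp hδη hr1 ?_ (hdec s hs) (htsum s (hη0.le.trans hs.1))
          (fun k => hcc k s hs) k
        filter_upwards [self_mem_nhdsWithin] with u hu using
          ⟨hdec u hu, htsum u (hη0.le.trans hu.1)⟩
      have := hcc k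
      unfold fourierField
      fun_prop
    have hinteq : ∀ t ∈ Icc η T, c' t k - c' η k = ∫ s in η..t, fourierField ν κ (c' s) k := by
      intro t ht
      have hl1 := (hlim t (hη0.le.trans ht.1) k).sub (hlim η hη0.le k)
      refine tendsto_nhds_unique hl1 ?_
      have hl2 := intervalIntegral.tendsto_integral_filter_of_dominated_convergence
        (μ := volume) (a := η) (b := t) (l := Filter.atTop)
        (F := fun n s => fourierField ν κ (c (φ n) s) k)
        (f := fun s => fourierField ν κ (c' s) k)
        (fun _ => ‖linSymbol ν κ k‖ * r + ‖quadSymbol ν κ k‖ *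
          ((∑' k : ℤ, |(k : ℝ)| * (r * Real.exp (-(δ * η * |(k : ℝ)|)))) ^ 2 / (1 - r)))
        ?_ ?_ intervalIntegrable_const ?_
      · refine hl2.congr' ?_
        filter_upwards [hev T, hev |(k : ℝ)|] with n hn hkn
        refine ((hc (φ n)).sub_eq_integral hδ hr1 (Finset.mem_Icc.2 ?_) hη0.le ht.1
          (ht.2.trans hn)).symm
        rw [abs_le] at hkn
        exact ⟨by exact_mod_cast hkn.1, by exact_mod_cast hkn.2⟩
      · filter_upwards [hev T] with n hn
        rw [uIoc_of_le ht.1]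
        refine ContinuousOn.aestronglyMeasurable ?_ measurableSet_Ioc
        exact ((hc (φ n)).continuousOn_field hδ hr1 k).mono fun s hs =>
          ⟨hη0.le.trans hs.1.le, hs.2.trans (ht.2.trans hn)⟩
      · filter_upwards [hev T] with n hn
        refine Filter.Eventually.of_forall fun s hs => ?_
        rw [uIoc_of_le ht.1] at hs
        have hs' : s ∈ Icc η T := ⟨hs.1.le, hs.2.trans ht.2⟩
        have hd := hdecn n hn s hs'
        unfold fourierField
        refine (norm_sub_le _ _).trans ?_
        rw [norm_mul, norm_mul]
        gcongr
        · exact (hc (φ n)).norm_le' hδ ⟨hη0.le.trans hs'.1, hs'.2.trans hn⟩ k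
        · exact norm_qcoeff_le_of_exp hδη hr1 hd.2 hd.1 k
      · refine Filter.Eventually.of_forall fun s hs => ?_
        rw [uIoc_of_le ht.1] at hs
        exact hqlim s ⟨hs.1.le, hs.2.trans ht.2⟩
    have ht₀' : t₀ ∈ Ioo η T := ⟨by linarith, by linarith⟩
    have hnhds : Icc η T ∈ nhds t₀ := Icc_mem_nhds ht₀'.1 ht₀'.2
    have hd : HasDerivAt (fun t => ∫ s in η..t, fourierField ν κ (c' s) k)
        (fourierField ν κ (c' t₀) k) t₀ := by
      refine intervalIntegral.integral_hasDerivAt_right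
        ((hfc.mono (Icc_subset_Icc_right ht₀'.2.le)).intervalIntegrable_of_Icc ht₀'.1.le) ?_
        (hfc.continuousAt hnhds)
      exact (hfc.mono Ioo_subset_Icc_self).stronglyMeasurableAtFilter isOpen_Ioo t₀ ht₀'
    refine (hd.add_const (c' η k)).congr_of_eventuallyEq ?_
    filter_upwards [hnhds] with t ht
    rw [← hinteq t ht]; ring
  · intro T hT F
    have hl := intervalIntegral.tendsto_integral_filter_of_dominated_convergence
      (μ := volume) (a := 0) (b := T) (l := Filter.atTop)
      (F := fun n s => ∑ k ∈ F, |(k : ℝ)| ^ 4 * ‖c (φ n) s k‖)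
      (f := fun s => ∑ k ∈ F, |(k : ℝ)| ^ 4 * ‖c' s k‖)
      (fun _ => ∑ k ∈ F, |(k : ℝ)| ^ 4 * r) ?_ ?_ intervalIntegrable_const ?_
    · refine le_of_tendsto hl ?_
      filter_upwards [hev T] with n hn
      exact (hc (φ n)).int T ⟨hT, hn⟩ F
    · filter_upwards [hev T] with n hn
      rw [uIoc_of_le hT]
      refine ContinuousOn.aestronglyMeasurable ?_ measurableSet_Ioc
      have hcc : ∀ k, ContinuousOn (fun s => c (φ n) s k) (Ioc 0 T) := fun k =>
        ((hcT _ _ hn).continuousOn k).mono Ioc_subset_Icc_self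
      fun_prop
    · filter_upwards [hev T] with n hn
      refine Filter.Eventually.of_forall fun s hs => ?_
      rw [uIoc_of_le hT] at hs
      rw [Real.norm_of_nonneg (Finset.sum_nonneg fun k _ => by positivity)]
      gcongr
      exact (hc (φ n)).norm_le' hδ ⟨hs.1.le, hs.2.trans hn⟩ _
    · refine Filter.Eventually.of_forall fun s hs => ?_
      rw [uIoc_of_le hT] at hs
      exact tendsto_finsetSum F fun k _ => ((hlim s hs.1.le k).norm).const_mul _

/-! ### Membership in Bochner spaces and weak derivatives -/

/-- A curve of absolutely summable sequences with measurable components lies in `L^p(0, T; ℓ¹)` as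
soon as its norm is dominated by an `L^p` function. -/
lemma memLpSeq_of_tsum_le {p : ℝ≥0∞} {T : ℝ} {a : ℝ → ℤ → ℂ} {H : ℝ → ℝ}
    (ha : ∀ k, ContinuousOn (fun t => a t k) (Ioo 0 T))
    (hs : ∀ t ∈ Ioo 0 T, Summable fun k => ‖a t k‖)
    (hle : ∀ t ∈ Ioo 0 T, ∑' k, ‖a t k‖ ≤ H t) (hH : MemLp H p (volume.restrict (Ioo 0 T))) :
    MemLpSeq p T a := by
  classical
  have hmem : ∀ t, Summable (fun k => ‖a t k‖) → Memℓp (a t) 1 := fun t h =>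
    memℓp_gen (by simpa using h)
  set F : ℝ → lp (fun _ : ℤ => ℂ) 1 := fun t =>
    if h : Summable fun k => ‖a t k‖ then ⟨a t, hmem t h⟩ else 0 with hF
  have hFa : ∀ t ∈ Ioo 0 T, ∀ k, F t k = a t k := by
    intro t ht k
    simp only [hF]
    rw [dif_pos (hs t ht)]
  have hFn : ∀ t ∈ Ioo 0 T, ‖F t‖ = ∑' k, ‖a t k‖ := by
    intro t ht
    rw [lp.norm_eq_tsum_rpow (by simp)]
    simp [hFa t ht]
  have hae : ∀ᵐ t ∂(volume.restrict (Ioo 0 T)), t ∈ Ioo 0 T := ae_restrict_mem measurableSet_Ioo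
  have hmeas : AEStronglyMeasurable F (volume.restrict (Ioo 0 T)) := by
    refine aestronglyMeasurable_of_tendsto_ae Filter.atTop
      (f := fun (S : Finset ℤ) t => ∑ k ∈ S, lp.single 1 k (a t k)) (fun S => ?_) ?_
    · refine Finset.aestronglyMeasurable_fun_sum S fun k _ => ?_
      have hc : Continuous fun z : ℂ => (lp.single 1 k z : lp (fun _ : ℤ => ℂ) 1) := by
        refine LipschitzWith.continuous (K := 1) (LipschitzWith.of_dist_le_mul fun x y => ?_)
        rw [dist_eq_norm, ← lp.single_sub, lp.norm_single (by simp), dist_eq_norm]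
        simp
      exact hc.comp_aestronglyMeasurable ((ha k).aestronglyMeasurable measurableSet_Ioo)
    · filter_upwards [hae] with t ht
      have h := lp.hasSum_single (by simp) (F t)
      simp only [hFa t ht] at h
      exact h
  refine ⟨F, hH.of_le hmeas ?_, ?_⟩
  · filter_upwards [hae] with t ht
    rw [hFn t ht]
    exact (hle t ht).trans (Real.le_norm_self _)
  · filter_upwards [hae] with t ht using hFa t ht

/-- A function that is jointly continuous for positive times lies in `L^p(0, T; L^q)` as soon as its
supremum norm is dominated by an `L^p` function of time. -/
lemma memLpLq_of_le {p q : ℝ≥0∞} [Fact (1 ≤ q)] {T : ℝ} {g : ℝ → Torus → ℝ} {H : ℝ → ℝ}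
    (hg : ContinuousOn (fun z : ℝ × Torus => g z.1 z.2) (Ioi 0 ×ˢ univ))
    (hle : ∀ t, 0 < t → ∀ x, |g t x| ≤ H t) (hH : MemLp H p (volume.restrict (Ioo 0 T))) :
    MemLpLq p q T g := by
  classical
  set G : C(Ioi (0 : ℝ) × Torus, ℝ) := ⟨fun z => g z.1 z.2, by
    refine hg.comp_continuous (f := fun z : Ioi (0 : ℝ) × Torus => ((z.1 : ℝ), z.2)) (by fun_prop)
      fun z => ⟨z.1.2, mem_univ _⟩⟩
  set L := ContinuousMap.toLp (E := ℝ) q (volume : Measure Torus) ℝ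
  set F : ℝ → Lp ℝ q (volume : Measure Torus) := fun t =>
    if h : 0 < t then L (G.curry ⟨t, h⟩) else 0 with hF
  have hFc : ContinuousOn F (Ioi 0) := by
    rw [continuousOn_iff_continuous_domRestrict]
    have : (Ioi (0 : ℝ)).domRestrict F = fun t => L (G.curry t) :=
      funext fun t => dif_pos (c := 0 < (t : ℝ)) t.2
    rw [this]
    fun_prop
  have hsub : Ioo 0 T ⊆ Ioi (0 : ℝ) := fun t ht => ht.1
  have hae : ∀ᵐ t ∂(volume.restrict (Ioo 0 T)), t ∈ Ioo 0 T := ae_restrict_mem measurableSet_Ioo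
  refine ⟨F, hH.of_le_mul (c := ‖L‖) ((hFc.mono hsub).aestronglyMeasurable measurableSet_Ioo) ?_, ?_⟩
  · filter_upwards [hae] with t ht
    simp only [hF]
    rw [dif_pos ht.1]
    refine (L.le_opNorm _).trans ?_
    gcongr
    have hH0 : 0 ≤ H t := (abs_nonneg _).trans (hle t ht.1 0)
    rw [Real.norm_of_nonneg hH0, ContinuousMap.norm_le _ hH0]
    exact fun x => hle t ht.1 x
  · filter_upwards [hae] with t ht
    simp only [hF]
    rw [dif_pos ht.1]
    exact ContinuousMap.coeFn_toLp volume _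

lemma hasDerivAt_synth {a : ℤ → ℂ} (ha : Summable fun k => ‖a k‖)
    (hD : Summable fun k => ‖D a k‖) (y : ℝ) :
    HasDerivAt (fun y : ℝ => synth a (y : Torus)) (synth (D a) (y : Torus)) y := by
  unfold synth
  refine hasDerivAt_tsum (u := fun k => ‖D a k‖) (y₀ := (0 : ℝ))
    (g := fun (k : ℤ) (y : ℝ) => a k * fourier k (y : Torus))
    (g' := fun (k : ℤ) (y : ℝ) => D a k * fourier k (y : Torus)) hD (fun k y => ?_)
    (fun k y => ?_) (summable_synth ha _) y
  · have h := (hasDerivAt_fourier (2 * Real.pi) k y).const_mul (a k)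
    refine h.congr_deriv ?_
    have : (Real.pi : ℂ) ≠ 0 := by exact_mod_cast Real.pi_ne_zero
    rw [D]
    push_cast
    field_simp
  · rw [norm_mul, norm_fourier_apply, mul_one]

lemma hasDerivAt_re_synth {a : ℤ → ℂ} (ha : Summable fun k => ‖a k‖)
    (hD : Summable fun k => ‖D a k‖) (y : ℝ) :
    HasDerivAt (fun y : ℝ => (synth a (y : Torus)).re) (synth (D a) (y : Torus)).re y :=
  Complex.reCLM.hasFDerivAt.comp_hasDerivAt y (hasDerivAt_synth ha hD y)

lemma coe_neg_pi : ((-Real.pi : ℝ) : Torus) = ((Real.pi : ℝ) : Torus) := by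
  rw [← AddCircle.coe_add_period (2 * Real.pi) (-Real.pi)]
  congr 1; ring

/-- Integration by parts over a period. -/
lemma integral_mul_deriv_periodic {f f' : Torus → ℝ} (hf' : Continuous f')
    (hd : ∀ y : ℝ, HasDerivAt (fun y : ℝ => f (y : Torus)) (f' (y : Torus)) y)
    {φ φ' : ℝ → ℝ} (hφ' : Continuous φ') (hφ : ∀ y, HasDerivAt φ (φ' y) y)
    (hper : Function.Periodic φ (2 * Real.pi)) :
    ∫ x in (-Real.pi)..Real.pi, f (x : Torus) * φ' x =
      - ∫ x in (-Real.pi)..Real.pi, f' (x : Torus) * φ x := by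
  have hc : Continuous fun y : ℝ => f' (y : Torus) := hf'.comp (AddCircle.continuous_mk' _)
  rw [intervalIntegral.integral_mul_deriv_eq_deriv_mul (fun y _ => hd y) (fun y _ => hφ y)
    (hc.intervalIntegrable _ _) (hφ'.intervalIntegrable _ _), coe_neg_pi]
  have : φ Real.pi = φ (-Real.pi) := by
    rw [← hper (-Real.pi)]; congr 1; ring
  rw [this]; ring

lemma integrable_of_continuous_real {g : Torus → ℝ} (hg : Continuous g) : Integrable g :=
  hg.integrable_of_hasCompactSupport (HasCompactSupport.of_compactSpace g)

lemma hasWeakDeriv_one {f f' : Torus → ℝ} (hf : Continuous f) (hf' : Continuous f')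
    (hd : ∀ y : ℝ, HasDerivAt (fun y : ℝ => f (y : Torus)) (f' (y : Torus)) y) :
    HasWeakDeriv 1 f f' := by
  refine ⟨integrable_of_continuous_real hf, integrable_of_continuous_real hf', ?_⟩
  intro φ hφ hper
  rw [iteratedDeriv_one, pow_one, neg_one_mul]
  exact integral_mul_deriv_periodic hf' hd (hφ.continuous_deriv (by simp))
    (fun y => (hφ.differentiable (by simp) y).hasDerivAt) hper

lemma periodic_deriv {φ : ℝ → ℝ} {p : ℝ} (h : Function.Periodic φ p) :
    Function.Periodic (deriv φ) p := by
  intro x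
  rw [← deriv_comp_add_const]
  congr 1
  exact funext h

lemma hasWeakDeriv_two {f f' f'' : Torus → ℝ} (hf : Continuous f) (hf' : Continuous f')
    (hf'' : Continuous f'')
    (hd : ∀ y : ℝ, HasDerivAt (fun y : ℝ => f (y : Torus)) (f' (y : Torus)) y)
    (hd' : ∀ y : ℝ, HasDerivAt (fun y : ℝ => f' (y : Torus)) (f'' (y : Torus)) y) :
    HasWeakDeriv 2 f f'' := by
  refine ⟨integrable_of_continuous_real hf, integrable_of_continuous_real hf'', ?_⟩
  intro φ hφ hper
  have h1 : ContDiff ℝ ∞ (deriv φ) := (contDiff_infty_iff_deriv.1 hφ).2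
  rw [iteratedDeriv_succ, iteratedDeriv_one, integral_mul_deriv_periodic hf' hd
    (h1.continuous_deriv (by simp)) (fun y => (h1.differentiable (by simp) y).hasDerivAt)
    (periodic_deriv hper), integral_mul_deriv_periodic hf'' hd' h1.continuous
    (fun y => (hφ.differentiable (by simp) y).hasDerivAt) hper]
  ring

/-- A series of functions continuous for positive times, with exponentially decaying terms. -/
lemma continuousOn_tsum_Ioi {X E : Type*} [TopologicalSpace X] [NormedAddCommGroup E]
    [CompleteSpace E] {f : ℤ → ℝ × X → E} {r δ : ℝ} (hδ : 0 < δ) (j : ℕ)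
    (hf : ∀ k, ContinuousOn (f k) (Ioi 0 ×ˢ univ))
    (hb : ∀ k, ∀ t, 0 < t → ∀ x, ‖f k (t, x)‖ ≤
      |(k : ℝ)| ^ j * (r * Real.exp (-(δ * t * |(k : ℝ)|)))) :
    ContinuousOn (fun z => ∑' k, f k z) (Ioi 0 ×ˢ univ) := by
  rintro ⟨t, x⟩ ⟨ht, -⟩
  rw [mem_Ioi] at ht
  have hη : 0 < t / 2 := by positivity
  have hsub : Ioi (t / 2) ×ˢ univ ⊆ Ioi (0 : ℝ) ×ˢ (univ : Set X) :=
    prod_mono (Ioi_subset_Ioi hη.le) le_rfl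
  have h : ContinuousOn (fun z => ∑' k, f k z) (Ioi (t / 2) ×ˢ univ) := by
    refine continuousOn_tsum (fun k => (hf k).mono hsub)
      (((summable_pow_mul_exp (mul_pos hδ hη) j).mul_left r)) fun k z hz => ?_
    have hz1 : t / 2 < z.1 := hz.1
    have hr : 0 ≤ |(k : ℝ)| ^ j * (r * Real.exp (-(δ * z.1 * |(k : ℝ)|))) :=
      (norm_nonneg _).trans (hb k z.1 (hη.trans hz1) z.2)
    refine (hb k z.1 (hη.trans hz1) z.2).trans ?_
    rcases eq_or_ne (|(k : ℝ)| ^ j) 0 with h0 | h0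
    · rw [h0]; simp
    have hr' : 0 ≤ r := by
      have h1 : 0 < |(k : ℝ)| ^ j := lt_of_le_of_ne (by positivity) h0.symm
      have h2 := Real.exp_pos (-(δ * z.1 * |(k : ℝ)|))
      by_contra hneg
      push Not at hneg
      have := mul_neg_of_pos_of_neg h1 (mul_neg_of_neg_of_pos hneg h2)
      linarith
    calc _ ≤ |(k : ℝ)| ^ j * (r * Real.exp (-(δ * (t / 2) * |(k : ℝ)|))) := by gcongr
      _ = _ := by ring
  refine (h.continuousAt ?_).continuousWithinAt
  exact (isOpen_Ioi.prod isOpen_univ).mem_nhds ⟨by simp only [mem_Ioi]; linarith, mem_univ _⟩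

/-! ### The solution as a function of time and space -/

/-- The real function with Fourier coefficients `c t`. Taking the real part only fixes the codomain:
the series is real when `c t` is Hermitian. -/
noncomputable def sol (c : ℝ → ℤ → ℂ) (t : ℝ) (x : Torus) : ℝ := (synth (c t) x).re

/-- The first space derivative of `sol c`. -/
noncomputable def solX (c : ℝ → ℤ → ℂ) (t : ℝ) (x : Torus) : ℝ := (synth (D (c t)) x).re

/-- The second space derivative of `sol c`. -/
noncomputable def solXX (c : ℝ → ℤ → ℂ) (t : ℝ) (x : Torus) : ℝ := (synth (D (D (c t))) x).re

/-- The fourth moment `∑ₖ |k|⁴ |û(t, k)|`. -/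
noncomputable def mFour (c : ℝ → ℤ → ℂ) (t : ℝ) : ℝ := ∑' k : ℤ, |(k : ℝ)| ^ 4 * ‖c t k‖

/-- The second derivative `uₓₓ / (1 + u) - uₓ² / (1 + u)²` of `log (1 + u)`. -/
noncomputable def solLog (c : ℝ → ℤ → ℂ) (t : ℝ) (x : Torus) : ℝ :=
  solXX c t x / (sol c t x + 1) - solX c t x ^ 2 / (sol c t x + 1) ^ 2

namespace IsFourierSol

variable {ν κ δ r : ℝ} {a₀ : ℤ → ℂ} {c : ℝ → ℤ → ℂ}

lemma decay (hS : IsFourierSol ν κ δ r a₀ c) {t : ℝ} (ht : 0 ≤ t) (k : ℤ) :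
    ‖c t k‖ ≤ r * Real.exp (-(δ * t * |(k : ℝ)|)) := exp_decay_of_bound (hS.bound t ht) k

lemma r_nonneg (hS : IsFourierSol ν κ δ r a₀ c) : 0 ≤ r := by
  simpa using hS.bound 0 le_rfl ∅

lemma summable (hS : IsFourierSol ν κ δ r a₀ c) (hδ : 0 < δ) {t : ℝ} (ht : 0 ≤ t) :
    Summable fun k => ‖c t k‖ :=
  summable_of_sum_le (fun _ => norm_nonneg _)
    (sum_le_of_bound (mul_nonneg hδ.le ht) (hS.bound t ht))

lemma tsum_le (hS : IsFourierSol ν κ δ r a₀ c) (hδ : 0 < δ) {t : ℝ} (ht : 0 ≤ t) :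
    ∑' k, ‖c t k‖ ≤ r := tsum_le_of_bound (mul_nonneg hδ.le ht) (hS.bound t ht)

/-- Since all frequencies are at least `1` in absolute value, the weight `e^{δ t |k|}` yields
exponential decay in time. -/
lemma tsum_le_exp (hS : IsFourierSol ν κ δ r a₀ c) (hδ : 0 < δ) {t : ℝ} (ht : 0 ≤ t) :
    ∑' k, ‖c t k‖ ≤ r * Real.exp (-δ * t) := by
  refine Real.tsum_le_of_sum_le (fun _ => norm_nonneg _) fun F => ?_
  have h : Real.exp (δ * t) * ∑ k ∈ F, ‖c t k‖ ≤ r := by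
    refine le_trans ?_ (hS.bound t ht F)
    rw [Finset.mul_sum]
    refine Finset.sum_le_sum fun k _ => ?_
    rcases eq_or_ne k 0 with rfl | hk
    · rw [hS.zero t ht]; simp
    · have h1 : (1 : ℝ) ≤ |(k : ℝ)| := by exact_mod_cast Int.one_le_abs hk
      refine mul_le_mul_of_nonneg_right (Real.exp_le_exp.2 ?_) (norm_nonneg _)
      exact le_mul_of_one_le_right (mul_nonneg hδ.le ht) h1
  rw [neg_mul, Real.exp_neg, ← div_eq_mul_inv, le_div_iff₀ (Real.exp_pos _), mul_comm]
  exact h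

lemma summable_pow (hS : IsFourierSol ν κ δ r a₀ c) (hδ : 0 < δ) {t : ℝ} (ht : 0 < t) (j : ℕ) :
    Summable fun k : ℤ => |(k : ℝ)| ^ j * ‖c t k‖ := by
  refine ((summable_pow_mul_exp (mul_pos hδ ht) j).mul_left r).of_nonneg_of_le
    (fun _ => by positivity) fun k => ?_
  calc _ ≤ |(k : ℝ)| ^ j * (r * Real.exp (-(δ * t * |(k : ℝ)|))) := by
        gcongr; exact hS.decay ht.le k
    _ = _ := by ring

lemma summable_D (hS : IsFourierSol ν κ δ r a₀ c) (hδ : 0 < δ) {t : ℝ} (ht : 0 < t) :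
    Summable fun k => ‖D (c t) k‖ := by
  simpa [norm_D] using hS.summable_pow hδ ht 1

lemma norm_D_D (a : ℤ → ℂ) (k : ℤ) : ‖D (D a) k‖ = |(k : ℝ)| ^ 2 * ‖a k‖ := by
  rw [norm_D, norm_D]; ring

lemma summable_D_D (hS : IsFourierSol ν κ δ r a₀ c) (hδ : 0 < δ) {t : ℝ} (ht : 0 < t) :
    Summable fun k => ‖D (D (c t)) k‖ := by
  simp only [norm_D_D]; exact hS.summable_pow hδ ht 2

lemma coeff_sol (hS : IsFourierSol ν κ δ r a₀ c) (hδ : 0 < δ) {t : ℝ} (ht : 0 ≤ t) (k : ℤ) :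
    coeff (sol c t) k = c t k := by
  unfold coeff sol
  simp only [(hS.herm t ht).synth_re]
  exact fourierCoeff_synth (hS.summable hδ ht) k

lemma abs_sol_le (hS : IsFourierSol ν κ δ r a₀ c) (hδ : 0 < δ) {t : ℝ} (ht : 0 ≤ t) (x : Torus) :
    |sol c t x| ≤ ∑' k, ‖c t k‖ :=
  (Complex.abs_re_le_norm _).trans (norm_synth_le (hS.summable hδ ht) x)

lemma continuous_sol (hS : IsFourierSol ν κ δ r a₀ c) (hδ : 0 < δ) {t : ℝ} (ht : 0 ≤ t) :
    Continuous (sol c t) := Complex.continuous_re.comp (continuous_synth (hS.summable hδ ht))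

lemma continuous_solX (hS : IsFourierSol ν κ δ r a₀ c) (hδ : 0 < δ) {t : ℝ} (ht : 0 < t) :
    Continuous (solX c t) := Complex.continuous_re.comp (continuous_synth (hS.summable_D hδ ht))

lemma continuous_solXX (hS : IsFourierSol ν κ δ r a₀ c) (hδ : 0 < δ) {t : ℝ} (ht : 0 < t) :
    Continuous (solXX c t) := Complex.continuous_re.comp (continuous_synth (hS.summable_D_D hδ ht))

lemma one_sub_le_sol (hS : IsFourierSol ν κ δ r a₀ c) (hδ : 0 < δ) {t : ℝ} (ht : 0 ≤ t)
    (x : Torus) : 1 - r ≤ sol c t x + 1 := by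
  have := neg_le_of_abs_le ((hS.abs_sol_le hδ ht x).trans (hS.tsum_le hδ ht))
  linarith

/-! ### Joint continuity for positive times -/

lemma continuousOn_coeff (hS : IsFourierSol ν κ δ r a₀ c) (X : Type*) [TopologicalSpace X] (k : ℤ) :
    ContinuousOn (fun z : ℝ × X => c z.1 k) (Ioi 0 ×ˢ univ) :=
  (hS.cont k).comp continuousOn_fst fun _ hz => le_of_lt (mem_Ioi.1 hz.1)

lemma continuousOn_sol (hS : IsFourierSol ν κ δ r a₀ c) (hδ : 0 < δ) :
    ContinuousOn (fun z : ℝ × Torus => sol c z.1 z.2) (Ioi 0 ×ˢ univ) := by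
  refine Complex.continuous_re.comp_continuousOn (continuousOn_tsum_Ioi hδ 0 (r := r)
    (f := fun k (z : ℝ × Torus) => c z.1 k * fourier k z.2) (fun k => ?_) fun k t ht x => ?_)
  · exact (hS.continuousOn_coeff Torus k).mul (Continuous.continuousOn (by fun_prop))
  · rw [norm_mul, norm_fourier_apply, mul_one, pow_zero, one_mul]
    exact hS.decay ht.le k

lemma continuousOn_solX (hS : IsFourierSol ν κ δ r a₀ c) (hδ : 0 < δ) :
    ContinuousOn (fun z : ℝ × Torus => solX c z.1 z.2) (Ioi 0 ×ˢ univ) := by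
  refine Complex.continuous_re.comp_continuousOn (continuousOn_tsum_Ioi hδ 1 (r := r)
    (f := fun k (z : ℝ × Torus) => D (c z.1) k * fourier k z.2) (fun k => ?_) fun k t ht x => ?_)
  · exact (continuousOn_const.mul (hS.continuousOn_coeff Torus k)).mul
      (Continuous.continuousOn (by fun_prop))
  · rw [norm_mul, norm_fourier_apply, mul_one, norm_D, pow_one]
    gcongr
    exact hS.decay ht.le k

lemma continuousOn_solXX (hS : IsFourierSol ν κ δ r a₀ c) (hδ : 0 < δ) :
    ContinuousOn (fun z : ℝ × Torus => solXX c z.1 z.2) (Ioi 0 ×ˢ univ) := by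
  refine Complex.continuous_re.comp_continuousOn (continuousOn_tsum_Ioi hδ 2 (r := r)
    (f := fun k (z : ℝ × Torus) => D (D (c z.1)) k * fourier k z.2) (fun k => ?_) fun k t ht x => ?_)
  · exact (continuousOn_const.mul (continuousOn_const.mul (hS.continuousOn_coeff Torus k))).mul
      (Continuous.continuousOn (by fun_prop))
  · rw [norm_mul, norm_fourier_apply, mul_one, norm_D_D]
    gcongr
    exact hS.decay ht.le k

lemma continuousOn_mFour (hS : IsFourierSol ν κ δ r a₀ c) (hδ : 0 < δ) :
    ContinuousOn (mFour c) (Ioi 0) := by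
  have h : ContinuousOn (fun z : ℝ × Unit => ∑' k : ℤ, |(k : ℝ)| ^ 4 * ‖c z.1 k‖)
      (Ioi 0 ×ˢ univ) := by
    refine continuousOn_tsum_Ioi hδ 4 (r := r) (fun k => ?_) fun k t ht x => ?_
    · exact continuousOn_const.mul (hS.continuousOn_coeff Unit k).norm
    · rw [Real.norm_of_nonneg (by positivity)]
      gcongr
      exact hS.decay ht.le k
  exact h.comp (f := fun t => (t, ())) (by fun_prop) fun t ht => ⟨ht, mem_univ _⟩

lemma mFour_nonneg (c : ℝ → ℤ → ℂ) (t : ℝ) : 0 ≤ mFour c t := tsum_nonneg fun _ => by positivity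

/-- The fourth moment is integrable in time, up to `t = 0`. -/
lemma integrableOn_mFour (hS : IsFourierSol ν κ δ r a₀ c) (hδ : 0 < δ) {T : ℝ} (hT : 0 ≤ T) :
    IntegrableOn (mFour c) (Ioo 0 T) := by
  have hsub : Ioo 0 T ⊆ Ioi (0 : ℝ) := fun t ht => ht.1
  refine ⟨((hS.continuousOn_mFour hδ).mono hsub).aestronglyMeasurable measurableSet_Ioo, ?_⟩
  have hck : ∀ k : ℤ, ContinuousOn (fun t => |(k : ℝ)| ^ 4 * ‖c t k‖) (Icc 0 T) := fun k => by
    exact continuousOn_const.mul ((hS.cont k).mono fun s hs => hs.1).norm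
  have hsum : ∀ F : Finset ℤ, ∫⁻ t in Ioo 0 T, ∑ k ∈ F, ENNReal.ofReal (|(k : ℝ)| ^ 4 * ‖c t k‖) ≤
      ENNReal.ofReal (2 * r / δ + r * T) := by
    intro F
    have e : ∀ t, ∑ k ∈ F, ENNReal.ofReal (|(k : ℝ)| ^ 4 * ‖c t k‖) =
        ENNReal.ofReal (∑ k ∈ F, |(k : ℝ)| ^ 4 * ‖c t k‖) := fun t =>
      (ENNReal.ofReal_sum_of_nonneg fun k _ => by positivity).symm
    simp_rw [e]
    rw [← ofReal_integral_eq_lintegral_ofReal]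
    · apply ENNReal.ofReal_le_ofReal
      refine le_trans (le_of_eq ?_) (hS.int T hT F)
      rw [intervalIntegral.integral_of_le hT, integral_Ioc_eq_integral_Ioo]
    · refine IntegrableOn.mono_set (t := Icc 0 T) ?_ Ioo_subset_Icc_self
      exact (continuousOn_finsetSum F fun k _ => hck k).integrableOn_Icc
    · exact Filter.Eventually.of_forall fun t => Finset.sum_nonneg fun k _ => by positivity
  calc ∫⁻ t in Ioo 0 T, ‖mFour c t‖ₑ
      = ∫⁻ t in Ioo 0 T, ∑' k : ℤ, ENNReal.ofReal (|(k : ℝ)| ^ 4 * ‖c t k‖) := by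
        refine setLIntegral_congr_fun measurableSet_Ioo fun t ht => ?_
        rw [← ofReal_norm, Real.norm_of_nonneg (mFour_nonneg c t), mFour,
          ENNReal.ofReal_tsum_of_nonneg (fun _ => by positivity) (hS.summable_pow hδ ht.1 4)]
    _ = ∑' k : ℤ, ∫⁻ t in Ioo 0 T, ENNReal.ofReal (|(k : ℝ)| ^ 4 * ‖c t k‖) := by
        refine lintegral_tsum fun k => ?_
        exact (((hck k).mono Ioo_subset_Icc_self).aemeasurable measurableSet_Ioo).ennreal_ofReal
    _ ≤ ENNReal.ofReal (2 * r / δ + r * T) := by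
        rw [ENNReal.tsum_eq_iSup_sum]
        refine iSup_le fun F => ?_
        rw [← lintegral_finsetSum']
        · exact hsum F
        · intro k _
          exact (((hck k).mono Ioo_subset_Icc_self).aemeasurable measurableSet_Ioo).ennreal_ofReal
    _ < ⊤ := ENNReal.ofReal_lt_top

lemma memLp_rpow_mFour (hS : IsFourierSol ν κ δ r a₀ c) (hδ : 0 < δ) {T : ℝ} (hT : 0 ≤ T) {C : ℝ}
    (hC : 0 ≤ C) {p : ℝ} (hp : 0 < p) :
    MemLp (fun t => (C * mFour c t) ^ (1 / p)) (ENNReal.ofReal p) (volume.restrict (Ioo 0 T)) := by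
  have hp' : (ENNReal.ofReal p).toReal = p := ENNReal.toReal_ofReal hp.le
  have hI := (hS.integrableOn_mFour hδ hT).const_mul C
  have hsub : Ioo 0 T ⊆ Ioi (0 : ℝ) := fun t ht => ht.1
  rw [← integrable_norm_rpow_iff, hp']
  · refine hI.congr (Filter.Eventually.of_forall fun t => ?_)
    have h0 : 0 ≤ C * mFour c t := mul_nonneg hC (mFour_nonneg c t)
    simp only
    rw [Real.norm_of_nonneg (by positivity), ← Real.rpow_mul h0, one_div, inv_mul_cancel₀ hp.ne',
      Real.rpow_one]
  · refine ContinuousOn.aestronglyMeasurable ?_ measurableSet_Ioo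
    have := (hS.continuousOn_mFour hδ).mono hsub
    exact (continuousOn_const.mul this).rpow_const fun t _ => Or.inr (by positivity)
  · simpa using hp
  · exact ENNReal.ofReal_ne_top

/-! ### Pointwise bounds in terms of the fourth moment -/

lemma tsum_sq_le_mFour (hS : IsFourierSol ν κ δ r a₀ c) (hδ : 0 < δ) {t : ℝ} (ht : 0 < t) :
    ∑' k : ℤ, |(k : ℝ)| ^ 2 * ‖c t k‖ ≤ mFour c t := by
  refine (hS.summable_pow hδ ht 2).tsum_le_tsum (fun k => ?_) (hS.summable_pow hδ ht 4)
  gcongr ?_ * _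
  rcases eq_or_ne k 0 with rfl | hk
  · simp
  · have h1 : (1 : ℝ) ≤ |(k : ℝ)| := by exact_mod_cast Int.one_le_abs hk
    exact pow_le_pow_right₀ h1 (by norm_num)

lemma sq_tsum_D_le_mFour (hS : IsFourierSol ν κ δ r a₀ c) (hδ : 0 < δ) {t : ℝ} (ht : 0 < t) :
    (∑' k, ‖D (c t) k‖) ^ 2 ≤ r * mFour c t := by
  refine (sq_tsum_D_le (hS.summable hδ ht.le) (hS.summable_pow hδ ht 4)).trans ?_
  exact mul_le_mul (hS.tsum_le hδ ht.le) (hS.tsum_sq_le_mFour hδ ht)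
    (tsum_nonneg fun _ => by positivity) hS.r_nonneg

lemma abs_solX_le (hS : IsFourierSol ν κ δ r a₀ c) (hδ : 0 < δ) {t : ℝ} (ht : 0 < t) (x : Torus) :
    |solX c t x| ≤ (r * mFour c t) ^ (1 / 2 : ℝ) := by
  rw [← Real.sqrt_eq_rpow]
  apply Real.le_sqrt_of_sq_le
  refine le_trans ?_ (hS.sq_tsum_D_le_mFour hδ ht)
  gcongr
  exact (Complex.abs_re_le_norm _).trans (norm_synth_le (hS.summable_D hδ ht) x)

lemma abs_solXX_le (hS : IsFourierSol ν κ δ r a₀ c) (hδ : 0 < δ) {t : ℝ} (ht : 0 < t) (x : Torus) :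
    |solXX c t x| ≤ mFour c t := by
  refine (Complex.abs_re_le_norm _).trans ((norm_synth_le (hS.summable_D_D hδ ht) x).trans ?_)
  simp only [norm_D_D]
  exact hS.tsum_sq_le_mFour hδ ht

lemma synth_D_D_re (hS : IsFourierSol ν κ δ r a₀ c) {t : ℝ} (ht : 0 < t) (x : Torus) :
    (solXX c t x : ℂ) = synth (D (D (c t))) x := (hS.herm t ht.le).D.D.synth_re x

/-- The flux `(1 + u) (log (1 + u))ₓₓ` equals `uₓₓ - uₓ² / (1 + u)`. -/
lemma solLog_mul (hS : IsFourierSol ν κ δ r a₀ c) (hδ : 0 < δ) (hr1 : r < 1) {t : ℝ} (ht : 0 < t)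
    (x : Torus) : ((solLog c t x * (1 + sol c t x) : ℝ) : ℂ) =
      synth (D (D (c t))) x - qfun (c t) x := by
  have h := hS.one_sub_le_sol hδ ht.le x
  have h0 : sol c t x + 1 ≠ 0 := by linarith
  have e : solLog c t x * (1 + sol c t x) = solXX c t x - solX c t x ^ 2 / (1 + sol c t x) := by
    unfold solLog
    rw [add_comm 1 (sol c t x)]
    field_simp
  rw [e]
  push_cast
  rw [hS.synth_D_D_re ht, qfun, sol, solX, (hS.herm t ht.le).synth_re, (hS.herm t ht.le).D.synth_re]

lemma abs_flux_le (hS : IsFourierSol ν κ δ r a₀ c) (hδ : 0 < δ) (hr1 : r < 1) {t : ℝ} (ht : 0 < t)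
    (x : Torus) : |solLog c t x * (1 + sol c t x)| ≤ (1 + r / (1 - r)) * mFour c t := by
  have hz : 0 < 1 - r := by linarith
  rw [← Real.norm_eq_abs, ← Complex.norm_real, hS.solLog_mul hδ hr1 ht]
  refine (norm_sub_le _ _).trans ?_
  have h1 := norm_synth_le (hS.summable_D_D hδ ht) x
  simp only [norm_D_D] at h1
  have h2 := norm_qfun_le (hS.summable hδ ht.le) (hS.summable_D hδ ht) hr1 (hS.tsum_le hδ ht.le) x
  have h3 : (∑' k, ‖D (c t) k‖) ^ 2 / (1 - r) ≤ r * mFour c t / (1 - r) := by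
    gcongr; exact hS.sq_tsum_D_le_mFour hδ ht
  have h4 := hS.tsum_sq_le_mFour hδ ht
  have e : (1 + r / (1 - r)) * mFour c t = mFour c t + r * mFour c t / (1 - r) := by ring
  rw [e]
  linarith

lemma continuousOn_solLog (hS : IsFourierSol ν κ δ r a₀ c) (hδ : 0 < δ) (hr1 : r < 1) :
    ContinuousOn (fun z : ℝ × Torus => solLog c z.1 z.2) (Ioi 0 ×ˢ univ) := by
  have h0 := hS.continuousOn_sol hδ
  have h1 := hS.continuousOn_solX hδ
  have h2 := hS.continuousOn_solXX hδ
  have hne : ∀ z ∈ Ioi (0 : ℝ) ×ˢ (univ : Set Torus), sol c z.1 z.2 + 1 ≠ 0 := by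
    intro z hz
    have := hS.one_sub_le_sol hδ (le_of_lt (mem_Ioi.1 hz.1)) z.2
    linarith
  unfold solLog
  exact (h2.div (h0.add continuousOn_const) hne).sub ((h1.pow 2).div
    ((h0.add continuousOn_const).pow 2) fun z hz => pow_ne_zero 2 (hne z hz))

lemma hasWeakDeriv_log (hS : IsFourierSol ν κ δ r a₀ c) (hδ : 0 < δ) (hr1 : r < 1) {t : ℝ}
    (ht : 0 < t) : HasWeakDeriv 2 (fun x => Real.log (sol c t x + 1)) (solLog c t) := by
  have hne : ∀ x, sol c t x + 1 ≠ 0 := by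
    intro x
    have := hS.one_sub_le_sol hδ ht.le x
    linarith
  have c0 := hS.continuous_sol hδ ht.le
  have c1 := hS.continuous_solX hδ ht
  have c2 := hS.continuous_solXX hδ ht
  have d0 := fun y => hasDerivAt_re_synth (hS.summable hδ ht.le) (hS.summable_D hδ ht) y
  have d1 := fun y => hasDerivAt_re_synth (hS.summable_D hδ ht) (hS.summable_D_D hδ ht) y
  refine hasWeakDeriv_two (f' := fun x => solX c t x / (sol c t x + 1)) ?_ ?_ ?_ ?_ ?_
  · exact (c0.add continuous_const).log hne
  · exact c1.div (c0.add continuous_const) hne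
  · unfold solLog
    exact (c2.div (c0.add continuous_const) hne).sub ((c1.pow 2).div
      ((c0.add continuous_const).pow 2) fun x => pow_ne_zero 2 (hne x))
  · intro y
    exact ((d0 y).add_const 1).log (hne _)
  · intro y
    refine ((d1 y).div ((d0 y).add_const 1) (hne _)).congr_deriv ?_
    have h := hne (y : Torus)
    unfold solLog solXX solX
    unfold sol at h ⊢
    field_simp

end IsFourierSol

/-! ### Pairing test functions with the Fourier basis -/

/-- `∫ f(x) e^{ikx} dx` over a period. -/
noncomputable def pairing (f : ℝ → ℝ) (k : ℤ) : ℂ :=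
  ∫ x in (-Real.pi)..Real.pi, (f x : ℂ) * fourier k (x : Torus)

lemma continuous_fourier_coe (k : ℤ) : Continuous fun x : ℝ => (fourier k (x : Torus) : ℂ) :=
  (map_continuous (fourier k)).comp (AddCircle.continuous_mk' _)

lemma norm_pairing_le {f : ℝ → ℝ} {M : ℝ} (hM : ∀ x ∈ Icc (-Real.pi) Real.pi, |f x| ≤ M) (k : ℤ) :
    ‖pairing f k‖ ≤ M * (2 * Real.pi) := by
  have hpi := Real.pi_pos
  have h := intervalIntegral.norm_integral_le_of_norm_le_const (a := -Real.pi) (b := Real.pi) (C := M)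
    (f := fun x : ℝ => (f x : ℂ) * fourier k (x : Torus)) fun x hx => by
      rw [uIoc_of_le (by linarith)] at hx
      rw [norm_mul, norm_fourier_apply, mul_one, Complex.norm_real]
      exact hM x ⟨hx.1.le, hx.2⟩
  rwa [show Real.pi - -Real.pi = 2 * Real.pi by ring, abs_of_pos Real.two_pi_pos] at h

lemma pairing_deriv {f : ℝ → ℝ} (hf : ContDiff ℝ ∞ f) (hper : Function.Periodic f (2 * Real.pi))
    (k : ℤ) : pairing (deriv f) k = -(Complex.I * k) * pairing f k := by
  have hd : ∀ x : ℝ, HasDerivAt (fun x : ℝ => (fourier k (x : Torus) : ℂ))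
      (Complex.I * k * fourier k (x : Torus)) x := fun x => by
    refine (hasDerivAt_fourier (2 * Real.pi) k x).congr_deriv ?_
    have : (Real.pi : ℂ) ≠ 0 := by exact_mod_cast Real.pi_ne_zero
    push_cast
    field_simp
  have hfd : ∀ x : ℝ, HasDerivAt (fun x : ℝ => (f x : ℂ)) ((deriv f x : ℝ) : ℂ) x := fun x =>
    ((hf.differentiable (by simp) x).hasDerivAt).ofReal_comp
  have hc := continuous_fourier_coe k
  have hc' : Continuous fun x => ((deriv f x : ℝ) : ℂ) :=
    Complex.continuous_ofReal.comp (hf.continuous_deriv (by simp))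
  have h := intervalIntegral.integral_mul_deriv_eq_deriv_mul (a := -Real.pi) (b := Real.pi)
    (fun x _ => hd x) (fun x _ => hfd x) ((continuous_const.mul hc).intervalIntegrable _ _)
    (hc'.intervalIntegrable _ _)
  have e : f Real.pi = f (-Real.pi) := by
    rw [← hper (-Real.pi)]; congr 1; ring
  rw [coe_neg_pi, e, sub_self, zero_sub] at h
  unfold pairing
  simp only [mul_comm _ (fourier k _ : ℂ)]
  rw [h, neg_mul, ← intervalIntegral.integral_const_mul]
  simp only [mul_assoc]

lemma pairing_iteratedDeriv {f : ℝ → ℝ} (hf : ContDiff ℝ ∞ f)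
    (hper : Function.Periodic f (2 * Real.pi)) (n : ℕ) (k : ℤ) :
    pairing (iteratedDeriv n f) k = (-(Complex.I * k)) ^ n * pairing f k := by
  have hp : ∀ n, ContDiff ℝ ∞ (iteratedDeriv n f) ∧
      Function.Periodic (iteratedDeriv n f) (2 * Real.pi) := by
    intro n
    induction n with
    | zero => simpa using ⟨hf, hper⟩
    | succ n ih =>
      rw [iteratedDeriv_succ]
      exact ⟨(contDiff_infty_iff_deriv.1 ih.1).2, periodic_deriv ih.2⟩
  induction n with
  | zero => simp
  | succ n ih => rw [iteratedDeriv_succ, pairing_deriv (hp n).1 (hp n).2, ih]; ring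

/-- The pairings of a smooth periodic function decay quadratically, hence are summable. -/
lemma summable_pairing {f : ℝ → ℝ} (hf : ContDiff ℝ ∞ f)
    (hper : Function.Periodic f (2 * Real.pi)) : Summable fun k => ‖pairing f k‖ := by
  have hc : Continuous (iteratedDeriv 2 f) := (contDiff_infty.1 hf 2).continuous_iteratedDeriv' 2
  obtain ⟨M, hM⟩ := (isCompact_Icc (a := -Real.pi) (b := Real.pi)).exists_bound_of_continuousOn
    hc.continuousOn
  have hs : Summable fun k : ℤ => M * (2 * Real.pi) * (1 / (k : ℝ) ^ 2) :=
    (Real.summable_one_div_int_pow.2 one_lt_two).mul_left _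
  refine Summable.of_norm_bounded_eventually hs ?_
  filter_upwards [Filter.eventually_cofinite_ne 0] with k hk
  have h := norm_pairing_le (f := iteratedDeriv 2 f) hM k
  rw [pairing_iteratedDeriv hf hper, norm_mul, norm_pow, norm_neg, norm_mul, Complex.norm_I, one_mul,
    Complex.norm_intCast, sq_abs] at h
  have hk' : 0 < (k : ℝ) ^ 2 := by positivity
  rw [norm_norm, mul_one_div, le_div_iff₀ hk']
  linarith

/-- Parseval's relation between an integrable function and a smooth one. -/
lemma hasSum_coeff_mul_pairing {u : Torus → ℝ} (hu : Integrable u) {f : ℝ → ℝ}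
    (hf : ContDiff ℝ ∞ f) (hper : Function.Periodic f (2 * Real.pi)) :
    HasSum (fun k => coeff u k * pairing f k)
      ((∫ x in (-Real.pi)..Real.pi, f x * u (x : Torus) : ℝ) : ℂ) := by
  have hpi : (Real.pi : ℂ) ≠ 0 := by exact_mod_cast Real.pi_ne_zero
  have hend : -Real.pi + 2 * Real.pi = Real.pi := by ring
  have hper' : Function.Periodic (fun x => (f x : ℂ)) (2 * Real.pi) := fun x => by
    simp only [hper x]
  set F : C(Torus, ℂ) := ⟨hper'.lift, continuous_quot_lift _ (Complex.continuous_ofReal.comp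
    hf.continuous)⟩ with hF
  have hFx : ∀ x : ℝ, F (x : Torus) = f x := fun x => hper'.lift_coe x
  have hFc : ∀ k, fourierCoeff F k = 1 / (2 * Real.pi) * pairing f (-k) := by
    intro k
    rw [fourierCoeff_eq_intervalIntegral _ k (-Real.pi), hend, pairing, Complex.real_smul]
    simp only [hFx, smul_eq_mul, mul_comm (fourier (-k) _ : ℂ)]
    push_cast
    rfl
  have huc : ∀ k, ∫ x : Torus, fourier k x * (u x : ℂ) = 2 * Real.pi * coeff u (-k) := by
    intro k
    rw [coeff, fourierCoeff_eq_intervalIntegral _ (-k) (-Real.pi), neg_neg,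
      AddCircle.intervalIntegral_preimage (2 * Real.pi) (-Real.pi)
        (fun x => fourier k x • (u x : ℂ)), Complex.real_smul]
    simp only [smul_eq_mul]
    push_cast
    field_simp
  have hsum : Summable fun k => ‖fourierCoeff F k‖ := by
    have h := ((Equiv.neg ℤ).summable_iff.2 (summable_pairing hf hper)).mul_left
      ‖(1 / (2 * Real.pi) : ℂ)‖
    refine h.congr fun k => ?_
    rw [hFc, norm_mul]; rfl
  have hu' : Integrable fun x => (u x : ℂ) := hu.ofReal
  have hnorm : ∀ (k : ℤ) (x : Torus), ‖fourierCoeff F k * fourier k x * (u x : ℂ)‖ =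
      ‖fourierCoeff F k‖ * ‖(u x : ℂ)‖ := fun k x => by
    rw [norm_mul, norm_mul, norm_fourier_apply, mul_one]
  have h := hasSum_integral_of_summable_integral_norm (μ := (volume : Measure Torus))
    (F := fun (k : ℤ) (x : Torus) => fourierCoeff F k * fourier k x * (u x : ℂ)) ?_ ?_
  · rw [← (Equiv.neg ℤ).hasSum_iff]
    convert h using 1
    · rfl
    · funext k
      simp only [Function.comp_apply, Equiv.neg_apply, mul_assoc]
      rw [integral_const_mul, huc, hFc]
      field_simp
    · have e : ∀ x : Torus, ∑' k, fourierCoeff F k * fourier k x * (u x : ℂ) = F x * u x := by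
        intro x
        have := (has_pointwise_sum_fourier_series_of_summable hsum.of_norm x).mul_right (u x : ℂ)
        simpa only [smul_eq_mul] using this.tsum_eq
      simp only [e]
      rw [← AddCircle.intervalIntegral_preimage (2 * Real.pi) (-Real.pi), hend,
        ← intervalIntegral.integral_ofReal]
      simp only [hFx, Complex.ofReal_mul]
  · intro k
    refine Integrable.mono' (hu'.norm.const_mul ‖fourierCoeff F k‖)
      (((continuous_const.mul (map_continuous (fourier k))).aestronglyMeasurable).mul
        hu'.aestronglyMeasurable) (Filter.Eventually.of_forall fun x => (hnorm k x).le)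
  · simp only [hnorm, integral_const_mul]
    exact hsum.mul_right _

/-! ### Smooth functions of time and space -/

lemma contDiff_deriv_snd {φ : ℝ → ℝ → ℝ} (h : ContDiff ℝ ∞ fun z : ℝ × ℝ => φ z.1 z.2) :
    ContDiff ℝ ∞ fun z : ℝ × ℝ => deriv (φ z.1) z.2 := by
  have e : (fun z : ℝ × ℝ => deriv (φ z.1) z.2) =
      fun z => fderiv ℝ (fun z : ℝ × ℝ => φ z.1 z.2) z (0, 1) := by
    funext z
    have h1 := ((h.differentiable (by simp)) z).hasFDerivAt
    have h2 : HasDerivAt (fun x : ℝ => (z.1, x)) ((0 : ℝ), (1 : ℝ)) z.2 :=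
      (hasDerivAt_const _ _).prodMk (hasDerivAt_id _)
    exact (h1.comp_hasDerivAt z.2 h2).deriv
  rw [e]
  exact (h.fderiv_right (by simp)).clm_apply contDiff_const

lemma contDiff_deriv_fst {φ : ℝ → ℝ → ℝ} (h : ContDiff ℝ ∞ fun z : ℝ × ℝ => φ z.1 z.2) :
    ContDiff ℝ ∞ fun z : ℝ × ℝ => deriv (fun s => φ s z.2) z.1 := by
  have h' : ContDiff ℝ ∞ fun z : ℝ × ℝ => (fun x s => φ s x) z.1 z.2 :=
    h.comp (contDiff_snd.prodMk contDiff_fst)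
  exact (contDiff_deriv_snd (φ := fun x s => φ s x) h').comp (contDiff_snd.prodMk contDiff_fst)

lemma contDiff_iteratedDeriv_snd {φ : ℝ → ℝ → ℝ} (h : ContDiff ℝ ∞ fun z : ℝ × ℝ => φ z.1 z.2)
    (n : ℕ) : ContDiff ℝ ∞ fun z : ℝ × ℝ => iteratedDeriv n (φ z.1) z.2 := by
  induction n with
  | zero => simpa using h
  | succ n ih =>
    simp only [iteratedDeriv_succ]
    exact contDiff_deriv_snd (φ := fun t => iteratedDeriv n (φ t)) ih

lemma continuous_pairing {χ : ℝ → ℝ → ℝ} (hχ : Continuous fun z : ℝ × ℝ => χ z.1 z.2) (k : ℤ) :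
    Continuous fun t => pairing (χ t) k := by
  unfold pairing
  refine intervalIntegral.continuous_parametric_intervalIntegral_of_continuous' ?_ _ _
  exact (Complex.continuous_ofReal.comp hχ).mul ((continuous_fourier_coe k).comp continuous_snd)

lemma hasDerivAt_pairing {φ : ℝ → ℝ → ℝ} (h : ContDiff ℝ ∞ fun z : ℝ × ℝ => φ z.1 z.2) (k : ℤ)
    (t : ℝ) : HasDerivAt (fun t => pairing (φ t) k)
      (pairing (fun x => deriv (fun s => φ s x) t) k) t := by
  have hc : Continuous fun z : ℝ × ℝ => deriv (fun s => φ s z.2) z.1 := (contDiff_deriv_fst h).continuous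
  obtain ⟨M, hM⟩ := ((isCompact_Icc (a := t - 1) (b := t + 1)).prod
    (isCompact_Icc (a := -Real.pi) (b := Real.pi))).exists_bound_of_continuousOn hc.continuousOn
  have hpi := Real.pi_pos
  have hf := continuous_fourier_coe k
  have hslice : ∀ (g : ℝ → ℝ → ℝ), (Continuous fun z : ℝ × ℝ => g z.1 z.2) → ∀ s,
      Continuous fun x : ℝ => (g s x : ℂ) * fourier k (x : Torus) := fun g hg s =>
    (Complex.continuous_ofReal.comp (hg.comp (by fun_prop : Continuous fun x : ℝ => (s, x)))).mul hf
  refine (intervalIntegral.hasDerivAt_integral_of_dominated_loc_of_deriv_le (μ := volume)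
    (F := fun t x => (φ t x : ℂ) * fourier k (x : Torus))
    (F' := fun t x => ((deriv (fun s => φ s x) t : ℝ) : ℂ) * fourier k (x : Torus))
    (bound := fun _ => M) (s := Icc (t - 1) (t + 1)) (Icc_mem_nhds (by linarith) (by linarith))
    ?_ ?_ ?_ ?_ ?_ ?_).2
  · exact Filter.Eventually.of_forall fun s =>
      (hslice φ h.continuous s).aestronglyMeasurable
  · exact (hslice φ h.continuous t).intervalIntegrable _ _
  · exact (hslice (fun t x => deriv (fun s => φ s x) t) hc t).aestronglyMeasurable
  · refine Filter.Eventually.of_forall fun x hx s hs => ?_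
    rw [uIoc_of_le (by linarith)] at hx
    rw [norm_mul, norm_fourier_apply, mul_one, Complex.norm_real]
    exact hM (s, x) ⟨hs, hx.1.le, hx.2⟩
  · simp
  · refine Filter.Eventually.of_forall fun x _ s _ => ?_
    have h1 : HasDerivAt (fun s => φ s x) (deriv (fun s => φ s x) s) s :=
      ((h.comp (contDiff_id.prodMk contDiff_const : ContDiff ℝ ∞ fun s : ℝ => (s, x))).differentiable
        (by simp) s).hasDerivAt
    exact h1.ofReal_comp.mul_const _

/-! ### Space-time integrals through Fourier coefficients -/

section Expansion

variable {T : ℝ} {G : ℝ → ℤ → ℂ} {g : ℝ → Torus → ℝ} {H : ℝ → ℝ} {χ : ℝ → ℝ → ℝ}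

lemma integrableOn_mul_pairing (hG : ∀ k, ContinuousOn (fun t => G t k) (Ioi 0))
    (hle : ∀ t, 0 < t → ∀ k, ‖G t k‖ ≤ H t) (hH : IntegrableOn H (Ioo 0 T))
    (hχ : Continuous fun z : ℝ × ℝ => χ z.1 z.2) (k : ℤ) :
    IntegrableOn (fun t => G t k * pairing (χ t) k) (Ioo 0 T) := by
  have hsub : Ioo 0 T ⊆ Ioi (0 : ℝ) := fun t ht => ht.1
  have hc := continuous_pairing hχ k
  obtain ⟨M, hM⟩ := (isCompact_Icc (a := (0 : ℝ)) (b := T)).exists_bound_of_continuousOn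
    hc.continuousOn
  refine Integrable.mono' (hH.mul_const M)
    ((((hG k).mono hsub).mul hc.continuousOn).aestronglyMeasurable measurableSet_Ioo) ?_
  filter_upwards [ae_restrict_mem measurableSet_Ioo] with t ht
  rw [norm_mul]
  exact mul_le_mul (hle t ht.1 k) (hM t ⟨ht.1.le, ht.2.le⟩) (norm_nonneg _)
    ((norm_nonneg _).trans (hle t ht.1 k))

/-- A space-time integral `∬ g χ` is the sum over the modes of `∫ ĝ(t, k) (∫ χ e^{ikx} dx) dt`. -/
lemma hasSum_integral_mul_pairing (hT : 0 ≤ T)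
    (hG : ∀ k, ContinuousOn (fun t => G t k) (Ioi 0))
    (hs : ∀ t, 0 < t → Summable fun k => ‖G t k‖)
    (hle : ∀ t, 0 < t → ∑' k, ‖G t k‖ ≤ H t) (hH : IntegrableOn H (Ioo 0 T))
    (hg : ∀ t, 0 < t → ∀ x, (g t x : ℂ) = synth (G t) x)
    (hχ : Continuous fun z : ℝ × ℝ => χ z.1 z.2) :
    HasSum (fun k => ∫ t in Ioo 0 T, G t k * pairing (χ t) k)
      ((∫ t in (0 : ℝ)..T, ∫ x in (-Real.pi)..Real.pi, g t (x : Torus) * χ t x : ℝ) : ℂ) := by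
  have hpi := Real.pi_pos
  have hle' : ∀ t, 0 < t → ∀ k, ‖G t k‖ ≤ H t := fun t ht k =>
    ((hs t ht).le_tsum k fun _ _ => norm_nonneg _).trans (hle t ht)
  obtain ⟨M, hM⟩ := ((isCompact_Icc (a := (0 : ℝ)) (b := T)).prod
    (isCompact_Icc (a := -Real.pi) (b := Real.pi))).exists_bound_of_continuousOn hχ.continuousOn
  have hpair : ∀ t ∈ Ioo 0 T, ∀ k, ‖pairing (χ t) k‖ ≤ M * (2 * Real.pi) := fun t ht k =>
    norm_pairing_le (fun x hx => hM (t, x) ⟨⟨ht.1.le, ht.2.le⟩, hx⟩) k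
  have hint := fun k => integrableOn_mul_pairing hG hle' hH hχ k
  have hinner : ∀ t ∈ Ioo 0 T, HasSum (fun k => G t k * pairing (χ t) k)
      ((∫ x in (-Real.pi)..Real.pi, g t (x : Torus) * χ t x : ℝ) : ℂ) := by
    intro t ht
    have hχt : Continuous (χ t) := hχ.comp (by fun_prop : Continuous fun x : ℝ => (t, x))
    have h := intervalIntegral.hasSum_integral_of_dominated_convergence (μ := volume)
      (a := -Real.pi) (b := Real.pi)
      (F := fun (k : ℤ) (x : ℝ) => G t k * ((χ t x : ℂ) * fourier k (x : Torus)))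
      (f := fun x : ℝ => ((g t (x : Torus) * χ t x : ℝ) : ℂ))
      (fun k _ => ‖G t k‖ * M) ?_ ?_ ?_ ?_ ?_
    · rw [intervalIntegral.integral_ofReal] at h
      simp only [intervalIntegral.integral_const_mul] at h
      exact h
    · intro k
      exact (continuous_const.mul ((Complex.continuous_ofReal.comp hχt).mul
        (continuous_fourier_coe k))).aestronglyMeasurable
    · refine fun k => Filter.Eventually.of_forall fun x hx => ?_
      rw [uIoc_of_le (by linarith)] at hx
      rw [norm_mul, norm_mul, norm_fourier_apply, mul_one, Complex.norm_real]
      gcongr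
      exact hM (t, x) ⟨⟨ht.1.le, ht.2.le⟩, hx.1.le, hx.2⟩
    · exact Filter.Eventually.of_forall fun x _ => (hs t ht.1).mul_right M
    · exact intervalIntegrable_const
    · refine Filter.Eventually.of_forall fun x _ => ?_
      have h := (summable_synth (hs t ht.1) (x : Torus)).hasSum.mul_right (χ t x : ℂ)
      rw [Complex.ofReal_mul, hg t ht.1]
      convert h using 1
      · rfl
      · funext k
        ring
      · rfl
  have houter := hasSum_integral_of_summable_integral_norm (μ := volume.restrict (Ioo 0 T)) hint ?_
  · rw [intervalIntegral.integral_of_le hT, integral_Ioc_eq_integral_Ioo, ← integral_complex_ofReal]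
    convert houter using 1
    · rfl
    exact setIntegral_congr_fun measurableSet_Ioo fun t ht => (hinner t ht).tsum_eq.symm
  · refine summable_of_sum_le (c := ∫ t in Ioo 0 T, H t * (M * (2 * Real.pi)))
      (fun _ => integral_nonneg fun _ => norm_nonneg _) fun F => ?_
    rw [← integral_finsetSum _ fun k _ => (hint k).norm]
    refine setIntegral_mono_on (integrable_finsetSum _ fun k _ => (hint k).norm)
      (hH.mul_const _) measurableSet_Ioo fun t ht => ?_
    simp only [norm_mul]
    calc ∑ k ∈ F, ‖G t k‖ * ‖pairing (χ t) k‖ ≤ ∑ k ∈ F, ‖G t k‖ * (M * (2 * Real.pi)) := by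
          gcongr with k; exact hpair t ht k
      _ = (∑ k ∈ F, ‖G t k‖) * (M * (2 * Real.pi)) := by rw [Finset.sum_mul]
      _ ≤ _ := by
        refine mul_le_mul_of_nonneg_right ?_ ((norm_nonneg _).trans (hpair t ht 0))
        exact ((hs t ht.1).sum_le_tsum F fun _ _ => norm_nonneg _).trans (hle t ht.1)

end Expansion

/-! ### The weak formulation -/

/-- The Fourier coefficients of the flux `uₓₓ - uₓ² / (1 + u) = (1 + u) (log (1 + u))ₓₓ`. -/
noncomputable def fluxCoeff (a : ℤ → ℂ) (k : ℤ) : ℂ := D (D a) k - qcoeff a k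

namespace IsFourierSol

variable {ν κ δ r : ℝ} {a₀ : ℤ → ℂ} {c : ℝ → ℤ → ℂ}

/-- The Fourier series of `uₓ² / (1 + u)` converges absolutely, with a sum integrable in time. -/
lemma emom_zero_qcoeff_le (hS : IsFourierSol ν κ δ r a₀ c) (hδ : 0 < δ) (hr1 : r < 1) {t : ℝ}
    (ht : 0 < t) : emom 0 0 (qcoeff (c t)) ≤ ENNReal.ofReal (r / (1 - r) * mFour c t) := by
  have hz : 0 < 1 - r := by linarith
  have h0 : emom 0 0 (c t) ≤ ENNReal.ofReal r := by
    rw [emom_zero_eq (hS.summable_pow hδ ht 0)]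
    apply ENNReal.ofReal_le_ofReal
    simpa using hS.tsum_le hδ ht.le
  have h4 : emom 0 4 (c t) ≠ ⊤ := by
    rw [emom_zero_eq (hS.summable_pow hδ ht 4)]; exact ENNReal.ofReal_ne_top
  have e1 : emom 0 1 (c t) = ENNReal.ofReal (∑' k, ‖D (c t) k‖) := by
    rw [emom_zero_eq (hS.summable_pow hδ ht 1)]
    simp only [norm_D, pow_one]
  refine (emom_qcoeff_le le_rfl hS.r_nonneg hr1 (hS.herm t ht.le).enorm h0 h4).1.trans ?_
  rw [e1, ← ENNReal.ofReal_pow (tsum_nonneg fun _ => norm_nonneg _),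
    ← ENNReal.ofReal_mul (by positivity)]
  apply ENNReal.ofReal_le_ofReal
  have := hS.sq_tsum_D_le_mFour hδ ht
  calc 1 / (1 - r) * (∑' k, ‖D (c t) k‖) ^ 2 ≤ 1 / (1 - r) * (r * mFour c t) := by gcongr
    _ = _ := by ring

lemma summable_qcoeff (hS : IsFourierSol ν κ δ r a₀ c) (hδ : 0 < δ) (hr1 : r < 1) {t : ℝ}
    (ht : 0 < t) : Summable fun k => ‖qcoeff (c t) k‖ :=
  summable_norm_of_emom le_rfl
    (ne_top_of_le_ne_top ENNReal.ofReal_ne_top (hS.emom_zero_qcoeff_le hδ hr1 ht))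

lemma summable_fluxCoeff (hS : IsFourierSol ν κ δ r a₀ c) (hδ : 0 < δ) (hr1 : r < 1) {t : ℝ}
    (ht : 0 < t) : Summable fun k => ‖fluxCoeff (c t) k‖ :=
  ((hS.summable_D_D hδ ht).add (hS.summable_qcoeff hδ hr1 ht)).of_nonneg_of_le
    (fun _ => norm_nonneg _) fun _ => norm_sub_le _ _

lemma tsum_fluxCoeff_le (hS : IsFourierSol ν κ δ r a₀ c) (hδ : 0 < δ) (hr1 : r < 1) {t : ℝ}
    (ht : 0 < t) : ∑' k, ‖fluxCoeff (c t) k‖ ≤ (1 + r / (1 - r)) * mFour c t := by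
  have hz : 0 < 1 - r := by linarith
  have h2 := hS.tsum_sq_le_mFour hδ ht
  have hq := tsum_norm_le_of_emom le_rfl
    (mul_nonneg (div_nonneg hS.r_nonneg hz.le) (mFour_nonneg c t))
    (hS.emom_zero_qcoeff_le hδ hr1 ht)
  calc ∑' k, ‖fluxCoeff (c t) k‖ ≤ ∑' k, (‖D (D (c t)) k‖ + ‖qcoeff (c t) k‖) :=
        (hS.summable_fluxCoeff hδ hr1 ht).tsum_le_tsum (fun _ => norm_sub_le _ _)
          ((hS.summable_D_D hδ ht).add (hS.summable_qcoeff hδ hr1 ht))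
    _ = ∑' k : ℤ, |(k : ℝ)| ^ 2 * ‖c t k‖ + ∑' k, ‖qcoeff (c t) k‖ := by
        rw [(hS.summable_D_D hδ ht).tsum_add (hS.summable_qcoeff hδ hr1 ht)]
        simp only [norm_D_D]
    _ ≤ _ := by linarith

lemma flux_eq_synth (hS : IsFourierSol ν κ δ r a₀ c) (hδ : 0 < δ) (hr1 : r < 1) {t : ℝ}
    (ht : 0 < t) (x : Torus) :
    ((solLog c t x * (1 + sol c t x) : ℝ) : ℂ) = synth (fluxCoeff (c t)) x := by
  have hq := hS.summable_qcoeff hδ hr1 ht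
  have hcont := continuous_qfun (hS.summable hδ ht.le) (hS.summable_D hδ ht)
    ((hS.tsum_le hδ ht.le).trans_lt hr1)
  have h1 : HasSum (fun k => qcoeff (c t) k * fourier k x) (qfun (c t) x) :=
    has_pointwise_sum_fourier_series_of_summable (f := ⟨qfun (c t), hcont⟩) hq.of_norm x
  have h2 := (summable_synth (hS.summable_D_D hδ ht) x).hasSum
  rw [hS.solLog_mul hδ hr1 ht, synth, ← (h2.sub h1).tsum_eq, synth]
  exact tsum_congr fun k => by rw [fluxCoeff, sub_mul]

lemma continuousOn_coeff_Ioi (hS : IsFourierSol ν κ δ r a₀ c) (k : ℤ) :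
    ContinuousOn (fun t => c t k) (Ioi 0) :=
  (hS.cont k).mono fun _ ht => le_of_lt (mem_Ioi.1 ht)

lemma continuousOn_fluxCoeff (hS : IsFourierSol ν κ δ r a₀ c) (hδ : 0 < δ) (hr1 : r < 1) (k : ℤ) :
    ContinuousOn (fun t => fluxCoeff (c t) k) (Ioi 0) := by
  have hq : ContinuousOn (fun t => qcoeff (c t) k) (Ioi 0) := by
    intro t ht
    rw [mem_Ioi] at ht
    have hη : 0 < t / 2 := by positivity
    have hdec : ∀ s, t / 2 ≤ s → ∀ k : ℤ,
        ‖c s k‖ ≤ r * Real.exp (-(δ * (t / 2) * |(k : ℝ)|)) := by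
      intro s hs k
      refine (hS.decay (hη.le.trans hs) k).trans ?_
      have := hS.r_nonneg
      gcongr
    refine tendsto_qcoeff_of_exp (mul_pos hδ hη) hr1 ?_ (hdec t (by linarith)) (hS.tsum_le hδ ht.le)
      (fun k => hS.continuousOn_coeff_Ioi k t ht) k
    have hev : ∀ᶠ s in nhdsWithin t (Ioi 0), t / 2 < s :=
      nhdsWithin_le_nhds (Ioi_mem_nhds (by linarith))
    filter_upwards [hev] with s hs
    exact ⟨hdec s hs.le, hS.tsum_le hδ (hη.trans hs).le⟩
  exact (continuousOn_const.mul (continuousOn_const.mul (hS.continuousOn_coeff_Ioi k))).sub hq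

/-- The equation in divergence form: with `-ik` for the adjoint of `∂ₓ`, the right-hand side consists
of the linear third-order term and the two flux terms. -/
lemma fourierField_eq (ν κ : ℝ) (a : ℤ → ℂ) (k : ℤ) :
    fourierField ν κ a k = -(κ / 3 * (-(Complex.I * k)) ^ 3 * a k +
      κ * (-(Complex.I * k)) * fluxCoeff a k + ν * (-(Complex.I * k)) ^ 2 * fluxCoeff a k) := by
  have hI : Complex.I ^ 2 = -1 := Complex.I_sq
  have hI3 : Complex.I ^ 3 = -Complex.I := by rw [pow_succ, hI]; ring
  have hI4 : Complex.I ^ 4 = 1 := by rw [show (4 : ℕ) = 2 * 2 by rfl, pow_mul, hI]; ring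
  simp only [fourierField, fluxCoeff, linSymbol, quadSymbol, D]
  push_cast
  ring_nf
  simp only [hI, hI3, hI4]
  ring

end IsFourierSol

/-- The function built from a solution of the Fourier system satisfies the weak formulation: on each
mode this is the fundamental theorem of calculus for `c(t, k) ∫ φ(t, x) e^{ikx} dx`. -/
theorem weak_formulation_of_isFourierSol {ν κ δ r : ℝ} {a₀ : ℤ → ℂ} {c : ℝ → ℤ → ℂ}
    (hS : IsFourierSol ν κ δ r a₀ c) (hδ : 0 < δ) (hr1 : r < 1) {T : ℝ}
    (hT : 0 < T) {φ : ℝ → ℝ → ℝ} (hφ : IsTestFunction T φ) {u₀ : Torus → ℝ} (hu₀ : Integrable u₀)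
    (ha₀ : ∀ k, coeff u₀ k = a₀ k) :
    - (∫ t in (0 : ℝ)..T, ∫ x in (-Real.pi)..Real.pi,
          deriv (fun s => φ s x) t * sol c t (x : Torus))
      + κ / 3 * (∫ t in (0 : ℝ)..T, ∫ x in (-Real.pi)..Real.pi,
          sol c t (x : Torus) * iteratedDeriv 3 (φ t) x)
      - (∫ x in (-Real.pi)..Real.pi, φ 0 x * u₀ (x : Torus))
      + κ * (∫ t in (0 : ℝ)..T, ∫ x in (-Real.pi)..Real.pi,
          solLog c t (x : Torus) * (1 + sol c t (x : Torus)) * deriv (φ t) x)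
      + ν * (∫ t in (0 : ℝ)..T, ∫ x in (-Real.pi)..Real.pi,
          solLog c t (x : Torus) * (1 + sol c t (x : Torus)) * iteratedDeriv 2 (φ t) x) = 0 := by
  obtain ⟨hsm, hper, T', hT', hvan⟩ := hφ
  have hφt : ∀ t, ContDiff ℝ ∞ (φ t) := fun t =>
    hsm.comp (contDiff_const.prodMk contDiff_id : ContDiff ℝ ∞ fun x : ℝ => (t, x))
  have hct : Continuous fun z : ℝ × ℝ => deriv (fun s => φ s z.2) z.1 :=
    (contDiff_deriv_fst hsm).continuous
  have hcn : ∀ n, Continuous fun z : ℝ × ℝ => iteratedDeriv n (φ z.1) z.2 :=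
    fun n => (contDiff_iteratedDeriv_snd hsm n).continuous
  have hpn : ∀ n t k, pairing (iteratedDeriv n (φ t)) k =
      (-(Complex.I * k)) ^ n * pairing (φ t) k := fun n t k =>
    pairing_iteratedDeriv (hφt t) (hper t) n k
  -- integrability in time of the coefficients
  have hHc : IntegrableOn (fun _ : ℝ => r) (Ioo 0 T) := integrableOn_const (by simp)
  have hHf := (hS.integrableOn_mFour hδ hT.le).const_mul (1 + r / (1 - r))
  have hcle := fun t ht => hS.tsum_le hδ (t := t) (le_of_lt ht)
  have hflle := fun t ht => hS.tsum_fluxCoeff_le hδ hr1 (t := t) ht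
  have hc := fun t (ht : 0 < t) => hS.summable hδ ht.le
  have hfl := fun t (ht : 0 < t) => hS.summable_fluxCoeff hδ hr1 ht
  have hcle' : ∀ t, 0 < t → ∀ k, ‖c t k‖ ≤ r := fun t ht k =>
    ((hc t ht).le_tsum k fun _ _ => norm_nonneg _).trans (hcle t ht)
  have hflle' : ∀ t, 0 < t → ∀ k, ‖fluxCoeff (c t) k‖ ≤ (1 + r / (1 - r)) * mFour c t :=
    fun t ht k => ((hfl t ht).le_tsum k fun _ _ => norm_nonneg _).trans (hflle t ht)
  have hcc := hS.continuousOn_coeff_Ioi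
  have hfc := hS.continuousOn_fluxCoeff hδ hr1
  have hg : ∀ t, 0 < t → ∀ x, (sol c t x : ℂ) = synth (c t) x := fun t ht x =>
    (hS.herm t ht.le).synth_re x
  have hgf := fun t ht x => hS.flux_eq_synth hδ hr1 (t := t) ht x
  -- the five terms as sums over the modes
  have sA := hasSum_integral_mul_pairing hT.le hcc hc hcle hHc hg
    (χ := fun t x => deriv (fun s => φ s x) t) hct
  have sB := hasSum_integral_mul_pairing hT.le hcc hc hcle hHc hg
    (χ := fun t => iteratedDeriv 3 (φ t)) (hcn 3)
  have sC := hasSum_integral_mul_pairing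
    (g := fun t x => solLog c t x * (1 + sol c t x)) hT.le hfc hfl hflle hHf hgf
    (χ := fun t => iteratedDeriv 1 (φ t)) (hcn 1)
  have sE := hasSum_integral_mul_pairing
    (g := fun t x => solLog c t x * (1 + sol c t x)) hT.le hfc hfl hflle hHf hgf
    (χ := fun t => iteratedDeriv 2 (φ t)) (hcn 2)
  have s0 := hasSum_coeff_mul_pairing hu₀ (hφt 0) (hper 0)
  have hmode : ∀ k, -(∫ t in Ioo 0 T, c t k * pairing (fun x => deriv (fun s => φ s x) t) k)
      + κ / 3 * (∫ t in Ioo 0 T, c t k * pairing (iteratedDeriv 3 (φ t)) k)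
      + κ * (∫ t in Ioo 0 T, fluxCoeff (c t) k * pairing (iteratedDeriv 1 (φ t)) k)
      + ν * (∫ t in Ioo 0 T, fluxCoeff (c t) k * pairing (iteratedDeriv 2 (φ t)) k) =
        coeff u₀ k * pairing (φ 0) k := by
    intro k
    have iA := integrableOn_mul_pairing hcc hcle' hHc (χ := fun t x => deriv (fun s => φ s x) t) hct k
    have iB := (integrableOn_mul_pairing hcc hcle' hHc (χ := fun t => iteratedDeriv 3 (φ t)) (hcn 3) k).const_mul (κ / 3 : ℂ)
    have iC := (integrableOn_mul_pairing hfc hflle' hHf (χ := fun t => iteratedDeriv 1 (φ t)) (hcn 1) k).const_mul (κ : ℂ)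
    have iE := (integrableOn_mul_pairing hfc hflle' hHf (χ := fun t => iteratedDeriv 2 (φ t)) (hcn 2) k).const_mul (ν : ℂ)
    have hftc := intervalIntegral.integral_eq_sub_of_hasDerivAt_of_le hT.le
      (f := fun t => c t k * pairing (φ t) k)
      (f' := fun t => c t k * pairing (fun x => deriv (fun s => φ s x) t) k -
        (κ / 3 * (c t k * pairing (iteratedDeriv 3 (φ t)) k) +
          κ * (fluxCoeff (c t) k * pairing (iteratedDeriv 1 (φ t)) k) +
          ν * (fluxCoeff (c t) k * pairing (iteratedDeriv 2 (φ t)) k)))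
      (((hS.cont k).mono fun t ht => ht.1).mul (continuous_pairing hsm.continuous k).continuousOn)
      (fun t ht => ?_) ?_
    -- the test function vanishes at time `T`
    · have hend : pairing (φ T) k = 0 := by
        have : φ T = fun _ => 0 := funext fun x => hvan T hT'.le x
        simp [pairing, this]
      rw [intervalIntegral.integral_of_le hT.le, integral_Ioc_eq_integral_Ioo,
        integral_sub iA, integral_add ?_ iE, integral_add iB iC,
        integral_const_mul, integral_const_mul, integral_const_mul, hend, mul_zero, zero_sub,
        hS.init k, ← ha₀ k] at hftc
      · linear_combination -hftc
      · exact iB.add iC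
      · exact (iB.add iC).add iE
    · refine ((hS.deriv t ht.1 k).mul (hasDerivAt_pairing hsm k t)).congr_deriv ?_
      rw [IsFourierSol.fourierField_eq, hpn, hpn, hpn]
      ring
    · rw [intervalIntegrable_iff_integrableOn_Ioo_of_le hT.le]
      exact iA.sub ((iB.add iC).add iE)
  have hsum := ((sA.neg.add (sB.mul_left (κ / 3 : ℂ))).add (sC.mul_left (κ : ℂ))).add
    (sE.mul_left (ν : ℂ))
  simp only [hmode] at hsum
  have huniq := hsum.unique s0
  simp only [iteratedDeriv_one] at huniq
  simp only [mul_comm (deriv _ _) (sol c _ _)]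
  norm_cast at huniq
  linarith

/-! ### Regularity of the solution -/

/-- Interpolation between the moments of order `0` and `4`. -/
lemma tsum_rpow_le {a : ℤ → ℂ} (h0 : Summable fun k => ‖a k‖)
    (h4 : Summable fun k : ℤ => |(k : ℝ)| ^ 4 * ‖a k‖) {p : ℝ} (hp : 1 < p) :
    (Summable fun k : ℤ => |(k : ℝ)| ^ (4 / p) * ‖a k‖) ∧
      ∑' k : ℤ, |(k : ℝ)| ^ (4 / p) * ‖a k‖ ≤
        (∑' k : ℤ, |(k : ℝ)| ^ 4 * ‖a k‖) ^ (1 / p) * (∑' k, ‖a k‖) ^ (1 - 1 / p) := by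
  have hp0 : 0 < p := by linarith
  obtain ⟨q, hq⟩ : ∃ q, q = Real.conjExponent p := ⟨_, rfl⟩
  have hpq : p.HolderConjugate q := hq ▸ Real.HolderConjugate.conjExponent hp
  have hq0 : 0 < q := hpq.symm.pos
  have hq1 : 1 / q = 1 - 1 / p := by
    have := hpq.inv_add_inv_eq_one
    rw [one_div, one_div]; linarith
  have e1 : ∀ k : ℤ, ((|(k : ℝ)| ^ 4 * ‖a k‖) ^ (1 / p)) ^ p = |(k : ℝ)| ^ 4 * ‖a k‖ := fun k => by
    rw [← Real.rpow_mul (by positivity), one_div_mul_cancel hp0.ne', Real.rpow_one]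
  have e2 : ∀ k : ℤ, (‖a k‖ ^ (1 / q)) ^ q = ‖a k‖ := fun k => by
    rw [← Real.rpow_mul (by positivity), one_div_mul_cancel hq0.ne', Real.rpow_one]
  have e3 : ∀ k : ℤ, (|(k : ℝ)| ^ 4 * ‖a k‖) ^ (1 / p) * ‖a k‖ ^ (1 / q) =
      |(k : ℝ)| ^ (4 / p) * ‖a k‖ := fun k => by
    have h : ‖a k‖ ^ (1 / p) * ‖a k‖ ^ (1 / q) = ‖a k‖ := by
      rw [← Real.rpow_add_of_nonneg (norm_nonneg _) (by positivity) (by positivity), hq1,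
        add_sub_cancel, Real.rpow_one]
    rw [Real.mul_rpow (by positivity) (norm_nonneg _), mul_assoc, h, ← Real.rpow_natCast,
      ← Real.rpow_mul (abs_nonneg _)]
    congr 2
    push_cast
    ring
  have h := Real.summable_and_inner_le_Lp_mul_Lq_tsum_of_nonneg hpq
    (f := fun k : ℤ => (|(k : ℝ)| ^ 4 * ‖a k‖) ^ (1 / p)) (g := fun k => ‖a k‖ ^ (1 / q))
    (fun k => by positivity) (fun k => by positivity) (by simpa only [e1] using h4)
    (by simpa only [e2] using h0)
  simp only [e1, e2, e3] at h
  rwa [hq1] at h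

lemma coeff_zero_of_integral_eq_zero {u : Torus → ℝ} (h : ∫ x, u x = 0) : coeff u 0 = 0 := by
  rw [coeff, fourierCoeff_eq_intervalIntegral _ 0 0, AddCircle.intervalIntegral_preimage
    (2 * Real.pi) 0 (fun x => fourier (-0) x • (u x : ℂ))]
  simp only [neg_zero, fourier_zero, one_smul]
  rw [integral_complex_ofReal, h]
  simp

lemma sum_norm_coeff_le {u : Torus → ℝ} (hu : MemWiener 0 u) (F : Finset ℤ) :
    ∑ k ∈ F, ‖coeff u k‖ ≤ wienerNorm 0 u := by
  have h := hu.2.sum_le_tsum F fun k _ => by positivity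
  simpa only [wienerNorm, Real.rpow_zero, one_mul] using h

namespace IsFourierSol

variable {ν κ δ r : ℝ} {a₀ : ℤ → ℂ} {c : ℝ → ℤ → ℂ}

lemma memLpLq_sol (hS : IsFourierSol ν κ δ r a₀ c) (hδ : 0 < δ) (p q : ℝ≥0∞) [Fact (1 ≤ q)]
    (T : ℝ) : MemLpLq p q T (sol c) :=
  memLpLq_of_le (hS.continuousOn_sol hδ)
    (fun _ ht x => (hS.abs_sol_le hδ ht.le x).trans (hS.tsum_le hδ ht.le)) (memLp_const r)

lemma memLp_mFour (hS : IsFourierSol ν κ δ r a₀ c) (hδ : 0 < δ) {T : ℝ} (hT : 0 ≤ T) :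
    MemLp (mFour c) 1 (volume.restrict (Ioo 0 T)) :=
  memLp_one_iff_integrable.2 (hS.integrableOn_mFour hδ hT)

lemma memLpSobolev_one (hS : IsFourierSol ν κ δ r a₀ c) (hδ : 0 < δ) {T : ℝ} (hT : 0 ≤ T) :
    MemLpSobolev 1 2 2 T (sol c) := by
  refine ⟨hS.memLpLq_sol hδ 2 2 T, solX c, memLpLq_of_le (hS.continuousOn_solX hδ)
    (fun t ht x => hS.abs_solX_le hδ ht x) ?_, ?_⟩
  · simpa using hS.memLp_rpow_mFour hδ hT hS.r_nonneg (p := 2) two_pos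
  · filter_upwards [ae_restrict_mem measurableSet_Ioo] with t ht
    exact hasWeakDeriv_one (hS.continuous_sol hδ ht.1.le) (hS.continuous_solX hδ ht.1)
      fun y => hasDerivAt_re_synth (hS.summable hδ ht.1.le) (hS.summable_D hδ ht.1) y

lemma memLpSobolev_two (hS : IsFourierSol ν κ δ r a₀ c) (hδ : 0 < δ) {T : ℝ} (hT : 0 ≤ T) :
    MemLpSobolev 2 1 1 T (sol c) := by
  refine ⟨hS.memLpLq_sol hδ 1 1 T, solXX c, memLpLq_of_le (hS.continuousOn_solXX hδ)
    (fun t ht x => hS.abs_solXX_le hδ ht x) (hS.memLp_mFour hδ hT), ?_⟩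
  filter_upwards [ae_restrict_mem measurableSet_Ioo] with t ht
  exact hasWeakDeriv_two (hS.continuous_sol hδ ht.1.le) (hS.continuous_solX hδ ht.1)
    (hS.continuous_solXX hδ ht.1)
    (fun y => hasDerivAt_re_synth (hS.summable hδ ht.1.le) (hS.summable_D hδ ht.1) y)
    fun y => hasDerivAt_re_synth (hS.summable_D hδ ht.1) (hS.summable_D_D hδ ht.1) y

lemma memLpLq_flux (hS : IsFourierSol ν κ δ r a₀ c) (hδ : 0 < δ) (hr1 : r < 1) {T : ℝ}
    (hT : 0 ≤ T) : MemLpLq 1 1 T fun t x => solLog c t x * (1 + sol c t x) :=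
  memLpLq_of_le ((hS.continuousOn_solLog hδ hr1).mul
    (continuousOn_const.add (hS.continuousOn_sol hδ)))
    (fun _ ht x => hS.abs_flux_le hδ hr1 ht x) ((hS.memLp_mFour hδ hT).const_mul _)

/-- Interpolating `∑ |k|^{4/p} |û| ≤ m₄^{1/p} m₀^{1-1/p}` turns the `L¹` bound on `m₄` into an `L^p`
bound. -/
lemma memLpWiener (hS : IsFourierSol ν κ δ r a₀ c) (hδ : 0 < δ) {T : ℝ} (hT : 0 ≤ T) {p : ℝ}
    (hp : 1 < p) : MemLpWiener (ENNReal.ofReal p) (4 / p) T (sol c) := by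
  have hp0 : 0 < p := by linarith
  have key := fun t (ht : 0 < t) =>
    tsum_rpow_le (hS.summable hδ ht.le) (hS.summable_pow hδ ht 4) hp
  have hn : ∀ t, 0 < t → ∀ k : ℤ, ‖((max 1 (|(k : ℝ)| ^ (4 / p)) : ℝ) : ℂ) * coeff (sol c t) k‖ =
      |(k : ℝ)| ^ (4 / p) * ‖c t k‖ := by
    intro t ht k
    rw [hS.coeff_sol hδ ht.le, norm_mul, Complex.norm_real, Real.norm_of_nonneg (by positivity)]
    -- the weight `1` at `k = 0` is irrelevant, as the mean vanishes
    rcases eq_or_ne k 0 with rfl | hk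
    · rw [hS.zero t ht.le]; simp
    · have h1 : (1 : ℝ) ≤ |(k : ℝ)| := by exact_mod_cast Int.one_le_abs hk
      rw [max_eq_right (Real.one_le_rpow h1 (by positivity))]
  refine ⟨?_, memLpSeq_of_tsum_le (H := fun t => r ^ (1 - 1 / p) * (1 * mFour c t) ^ (1 / p))
    (fun k => ?_) (fun t ht => ?_) (fun t ht => ?_) ?_⟩
  · filter_upwards [ae_restrict_mem measurableSet_Ioo] with t ht
    refine ⟨integrable_of_continuous_real (hS.continuous_sol hδ ht.1.le), ?_⟩
    simp only [hS.coeff_sol hδ ht.1.le]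
    exact (key t ht.1).1
  · have h : ContinuousOn (fun t => ((max 1 (|(k : ℝ)| ^ (4 / p)) : ℝ) : ℂ) * c t k) (Ioo 0 T) :=
      continuousOn_const.mul ((hS.cont k).mono fun t ht => ht.1.le)
    exact h.congr fun t ht => by simp only [hS.coeff_sol hδ ht.1.le]
  · simp only [hn t ht.1]
    exact (key t ht.1).1
  · simp only [hn t ht.1, one_mul]
    refine (key t ht.1).2.trans ?_
    rw [mul_comm]
    have h1 : 0 ≤ 1 - 1 / p := by
      rw [sub_nonneg, div_le_one hp0]; exact hp.le
    have h2 := mFour_nonneg c t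
    refine mul_le_mul_of_nonneg_right ?_ (by unfold mFour at h2; positivity)
    exact Real.rpow_le_rpow (tsum_nonneg fun _ => norm_nonneg _) (hS.tsum_le hδ ht.1.le) h1
  · exact (hS.memLp_rpow_mFour hδ hT zero_le_one hp0).const_mul _

lemma memLpSeq_exp (hS : IsFourierSol ν κ δ r a₀ c) (hδ : 0 < δ) {σ : ℝ} (hσ : σ ≤ δ) (T : ℝ) :
    MemLpSeq ⊤ T fun t k => (Real.exp (σ * t * |(k : ℝ)|) : ℂ) * coeff (sol c t) k := by
  have hn : ∀ t, 0 < t → ∀ k : ℤ, ‖(Real.exp (σ * t * |(k : ℝ)|) : ℂ) * coeff (sol c t) k‖ ≤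
      Real.exp (δ * t * |(k : ℝ)|) * ‖c t k‖ := by
    intro t ht k
    rw [hS.coeff_sol hδ ht.le, norm_mul, Complex.norm_real, Real.norm_of_nonneg (by positivity)]
    gcongr
  have hsum : ∀ t, 0 < t → ∀ F : Finset ℤ,
      ∑ k ∈ F, ‖(Real.exp (σ * t * |(k : ℝ)|) : ℂ) * coeff (sol c t) k‖ ≤ r := fun t ht F =>
    (Finset.sum_le_sum fun k _ => hn t ht k).trans (hS.bound t ht.le F)
  refine memLpSeq_of_tsum_le (fun k => ?_)
    (fun t ht => summable_of_sum_le (fun _ => norm_nonneg _) (hsum t ht.1))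
    (fun t ht => Real.tsum_le_of_sum_le (fun _ => norm_nonneg _) (hsum t ht.1)) (memLp_const r)
  have h : ContinuousOn (fun t => (Real.exp (σ * t * |(k : ℝ)|) : ℂ) * c t k) (Ioo 0 T) :=
    (Continuous.continuousOn (by fun_prop)).mul ((hS.cont k).mono fun t ht => ht.1.le)
  exact h.congr fun t ht => by simp only [hS.coeff_sol hδ ht.1.le]

lemma eLpNorm_sol_le (hS : IsFourierSol ν κ δ r a₀ c) (hδ : 0 < δ) {t : ℝ} (ht : 0 ≤ t) :
    eLpNorm (sol c t) ⊤ volume ≤ ENNReal.ofReal (r * Real.exp (-δ * t)) := by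
  rw [eLpNorm_exponent_top]
  refine eLpNormEssSup_le_of_ae_bound (Filter.Eventually.of_forall fun x => ?_)
  exact (hS.abs_sol_le hδ ht x).trans (hS.tsum_le_exp hδ ht)

end IsFourierSol

end DLSS

theorem theorem2p3 (μ Γ ε : ℝ) (hμ : μ ∈ Icc (-1 : ℝ) 1) (hΓ : Γ ∈ Icc (0 : ℝ) (1 / 4))
    (hε : 0 < ε) (u₀ : DLSS.Torus → ℝ) (hu₀ : DLSS.MemWiener 0 u₀)
    (hmean : ∫ x, u₀ x = 0) (hlt : DLSS.wienerNorm 0 u₀ < 1)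
    (hsmall : |μ| * Γ * DLSS.P₂ (DLSS.wienerNorm 0 u₀)
        + ε * (2 * Γ - 2 * Γ ^ 2) * DLSS.P₁ (DLSS.wienerNorm 0 u₀)
      < ε * (2 * Γ - 2 * Γ ^ 2)) :
    ∃ u : ℝ → DLSS.Torus → ℝ,
      (∀ T : ℝ, 0 < T →
        DLSS.IsStrongSolution μ Γ ε T u₀ u ∧
        DLSS.MemLpLq ∞ ∞ T u ∧
        ∀ p : ℝ, 1 < p → DLSS.MemLpWiener (ENNReal.ofReal p) (4 / p) T u) ∧
      (∀ t : ℝ, 0 ≤ t →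
        eLpNorm (u t) ∞ volume ≤ ENNReal.ofReal (DLSS.wienerNorm 0 u₀ *
          Real.exp (-(DLSS.rate μ Γ ε (DLSS.wienerNorm 0 u₀)) * t))) ∧
      (∀ σ : ℝ, 0 < σ → 0 < DLSS.rate μ Γ ε (DLSS.wienerNorm 0 u₀) - σ →
        ∀ T : ℝ, 0 < T →
          DLSS.MemLpSeq ∞ T fun t k =>
            (Real.exp (σ * t * |(k : ℝ)|) : ℂ) * DLSS.coeff (u t) k) := by
  have hr0 : 0 ≤ DLSS.wienerNorm 0 u₀ := by
    simpa using DLSS.sum_norm_coeff_le hu₀ ∅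
  have hν : 0 ≤ ε * (2 * Γ - 2 * Γ ^ 2) := by
    have h1 := hΓ.1
    have h2 := hΓ.2
    refine mul_nonneg hε.le ?_
    nlinarith
  have hδ : 0 < DLSS.rate μ Γ ε (DLSS.wienerNorm 0 u₀) := by
    unfold DLSS.rate; linarith
  have hrate : DLSS.rate μ Γ ε (DLSS.wienerNorm 0 u₀) = ε * (2 * Γ - 2 * Γ ^ 2) -
      |μ * Γ| * DLSS.P₂ (DLSS.wienerNorm 0 u₀) -
      ε * (2 * Γ - 2 * Γ ^ 2) * DLSS.P₁ (DLSS.wienerNorm 0 u₀) := by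
    rw [abs_mul, abs_of_nonneg hΓ.1, DLSS.rate]
  obtain ⟨c, hS⟩ := DLSS.exists_isFourierSol hν hδ hr0 hlt hrate (a₀ := DLSS.coeff u₀)
    (DLSS.isHerm_fourierCoeff fun x => Complex.conj_ofReal _)
    (DLSS.coeff_zero_of_integral_eq_zero hmean) (DLSS.sum_norm_coeff_le hu₀)
  refine ⟨DLSS.sol c, fun T hT => ⟨⟨hS.memLpLq_sol hδ _ _ T, hS.memLpSobolev_one hδ hT.le,
    hS.memLpSobolev_two hδ hT.le, ?_, DLSS.solLog c, ?_, hS.memLpLq_flux hδ hlt hT.le,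
    fun φ hφ => DLSS.weak_formulation_of_isFourierSol hS hδ hlt hT hφ hu₀.1 fun _ => rfl⟩,
    hS.memLpLq_sol hδ _ _ T, fun p hp => hS.memLpWiener hδ hT.le hp⟩,
    fun t ht => hS.eLpNorm_sol_le hδ ht,
    fun σ _ hσ T _ => hS.memLpSeq_exp hδ (sub_pos.1 hσ).le T⟩
  · filter_upwards [ae_restrict_mem measurableSet_Ioo] with t ht
    refine Filter.Eventually.of_forall fun x => ?_
    have := hS.one_sub_le_sol hδ ht.1.le x
    linarith
  · filter_upwards [ae_restrict_mem measurableSet_Ioo] with t ht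
    exact hS.hasWeakDeriv_log hδ hlt ht.1
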